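/- Let $\mathfrak g$ be a finite-dimensional complex simple Lie algebra, $\mathfrak h\subset\mathfrak g$ a Cartan subalgebra with root spaces $\mathfrak g_\alpha$ ($\alpha\in\Delta$), $\mathfrak g_0=\mathfrak h$, and let $n\ge 1$. For $\operatorname{Im}\tau>0$ put $L(\tau)=\mathbb Z+\tau\mathbb Z$, and let $$C^{[n]}=\{(z_1,\dots,z_n,\tau)\in\mathbb C^n\times\mathbb C:\ \operatorname{Im}\tau>0,\ z_i-z_j\notin L(\tau)\text{ for }i\ne j\}.$$ For $(z,\tau)\in C^{[n]}$ and $\lambda\in\mathfrak h$ let $\mathcal L(z,\tau,\lambda)$ be the space of meromorphic functions $X:\mathbb C\to\mathfrak g$ with poles in $\bigcup_i(z_i+L(\tau))$ such that $$X(t+1)=X(t),\qquad X(t+\tau)=\exp(2\pi i\operatorname{ad}\lambda)X(t).$$ For an integer $j\ge 0$ and an open set $U\subset C^{[n]}\times\mathfrak h$, with $\mathcal O(U)$ its algebra of holomorphic functions, let $\mathcal L^{\le j}_{\mathfrak h}(U)$ be the $\mathcal O(U)$-module of meromorphic functions $X(t,z,\tau,\lambda)$ on $\mathbb C\times U$ with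 values in $\mathfrak g$, whose only poles are on the hypersurfaces $t=z_i+r+s\tau$ ($1\le i\le n$, $r,s\in\mathbb Z$) and of order at most $j$, and such that $X(\cdot,z,\tau,\lambda)\in\mathcal L(z,\tau,\lambda)$ for all $(z,\tau,\lambda)\in U$. For open $U\subset C^{[n]}$ define $\mathcal L^{\le j}(U)$ in the same way, with $\lambda=0$. (1) For every $j\ge0$ the sheaf $\mathcal L^{\le j}_{\mathfrak h}$ is locally free and locally finitely generated, of some rank $n_j<\infty$: every point of $C^{[n]}\times\mathfrak h$ has an open neighbourhood $U$ and $n_j$ sections over $U$ whose restrictions to each open $V\subset U$ form a basis of the $\mathcal O(V)$-module $\mathcal L^{\le j}_{\mathfrak h}(V)$. In particular $\mathcal L^{\le j}_{\mathfrak h}(U)\simeq\mathbb C^{n_j}\otimes\mathcal O(U)$. (2) For every $x\in C^{[n]}\times\mathfrak h$, every $X\in\mathcal L(x)$ extends to an element of $\mathcal L^{\le j}_{\mathfrak h}(U)$ for some $j$ and some open $U\ni x$. (3) The analogues of (1) and (2) hold for the sheaves $\mathcal L^{\le j}$ on $C^{[n]}$ and the fibres $\mathcal L(z,\tau,0)$.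 (4) Let $$\theta_1(t|\tau)=-\sum_{m\in\mathbb Z}e^{2\pi i(t+\frac12)(m+\frac12)+\pi i\tau(m+\frac12)^2},\qquad \rho(t)=\frac{\partial}{\partial t}\log\theta_1(t|\tau),\qquad \sigma_w(t)=\frac{\theta_1(t-w|\tau)\,\theta_1'(0|\tau)}{\theta_1(t|\tau)\,\theta_1(-w|\tau)},$$ and for $w\in\mathbb C$ with $|\operatorname{Im}w|<\operatorname{Im}\tau$, $m\ge0$ and $1\le l\le n$ let $$f^{w}_{0,1}(t)=(e^{2\pi iw}-1)\sigma_w(t-z_1),\qquad f^{w}_{0,l}(t)=\sigma_w(t-z_l)-\sigma_w(t-z_1)\ (l\ge2),\qquad f^{w}_{m,l}(t)=\frac{\partial^m}{\partial t^m}\sigma_w(t-z_l)\ (m\ge1,\ 1\le l\le n).$$ The singularities of these expressions at $w\in\mathbb Z$ are removable, and there $f^w_{m,l}$ denotes the limit; these limits are $-2\pi i$, $\rho(t-z_l)-\rho(t-z_1)$ and $\frac{\partial^m}{\partial t^m}\rho(t-z_l)$ respectively. Fix a basis of each $\mathfrak g_\alpha$, $\alpha\in\Delta\cup\{0\}$.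 (a) If $(z,\tau)\in C^{[n]}$, and $\lambda\in\mathfrak h$ satisfies $|\operatorname{Im}\alpha(\lambda)|<\operatorname{Im}\tau$ for all $\alpha\in\Delta$, then the functions $t\mapsto f^{\alpha(\lambda)}_{m,l}(t)\,X$, with $\alpha\in\Delta\cup\{0\}$, $X$ in the chosen basis of $\mathfrak g_\alpha$, $m\ge0$ and $1\le l\le n$, form a basis of $\mathcal L(z,\tau,\lambda)$. (b) If $j\ge1$ and $U\subset C^{[n]}\times\mathfrak h$ is an open set on which $|\operatorname{Im}\alpha(\lambda)|<\operatorname{Im}\tau$ for all $\alpha\in\Delta$, then the functions $f^{\alpha(\lambda)}_{m,l}(t)X$ with $0\le m\le j-1$ and $\alpha,X,l$ as in (a) form a basis of the $\mathcal O(U)$-module $\mathcal L^{\le j}_{\mathfrak h}(U)$. If $j\ge1$ and $U\subset C^{[n]}$ is open, then the same functions with $\lambda=0$ form a basis of the $\mathcal O(U)$-module $\mathcal L^{\le j}(U)$. -/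

import Mathlib

open Filter Topology TopologicalSpace Module

namespace EllipticLie

noncomputable section

/-- A Lie subalgebra of a finite-dimensional complex Lie algebra is normed by the sup norm of the
coordinates in some basis (all norms are equivalent, so the topology and the holomorphic functions
do not depend on the basis). -/
instance subalgebraNormedAddCommGroup {𝔤 : Type*} [LieRing 𝔤] [LieAlgebra ℂ 𝔤]
    [FiniteDimensional ℂ 𝔤] (H : LieSubalgebra ℂ 𝔤) : NormedAddCommGroup H :=
  NormedAddCommGroup.induced H (Fin (finrank ℂ H) → ℂ) (finBasis ℂ H).equivFun
    (finBasis ℂ H).equivFun.injective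

instance subalgebraNormedSpace {𝔤 : Type*} [LieRing 𝔤] [LieAlgebra ℂ 𝔤]
    [FiniteDimensional ℂ 𝔤] (H : LieSubalgebra ℂ 𝔤) : NormedSpace ℂ H :=
  NormedSpace.induced ℂ H (Fin (finrank ℂ H) → ℂ) (finBasis ℂ H).equivFun

/-- The exponential of an endomorphism of a finite-dimensional complex vector space. -/
def expEnd {V : Type*} [AddCommGroup V] [Module ℂ V] [FiniteDimensional ℂ V]
    (A : Module.End ℂ V) : Module.End ℂ V :=
  Matrix.toLin (finBasis ℂ V) (finBasis ℂ V)
    (NormedSpace.exp (LinearMap.toMatrix (finBasis ℂ V) (finBasis ℂ V) A))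

/-- `exp (2 π i ad h)`. -/
def twist {𝔤 : Type*} [LieRing 𝔤] [LieAlgebra ℂ 𝔤] [FiniteDimensional ℂ 𝔤]
    (h : 𝔤) : Module.End ℂ 𝔤 :=
  expEnd ((2 * Real.pi * Complex.I : ℂ) • (LieAlgebra.ad ℂ 𝔤 h : Module.End ℂ 𝔤))

/-- The lattice `ℤ + τ ℤ`. -/
def lattice (τ : ℂ) : Set ℂ := {w | ∃ r s : ℤ, w = r + s * τ}

/-- The ambient space of the points `(z, τ)`. -/
abbrev Conf (n : ℕ) : Type := (Fin n → ℂ) × ℂ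

/-- The elliptic configuration space. -/
def ellipticConf (n : ℕ) : Set (Conf n) :=
  {c | 0 < c.2.im ∧ ∀ i j, i ≠ j → c.1 i - c.1 j ∉ lattice c.2}

/-- The product of the elliptic configuration space with a Cartan subalgebra. -/
def ellipticConfTimes {𝔤 : Type*} [LieRing 𝔤] [LieAlgebra ℂ 𝔤] (n : ℕ) (H : LieSubalgebra ℂ 𝔤) :
    Set (Conf n × H) :=
  {x | x.1 ∈ ellipticConf n}

/-! ### The Lie algebra attached to one point -/

/-- The complement in the complex plane of the translates `z_i + ℤ + τ ℤ`. -/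
def fibreRegular {n : ℕ} (c : Conf n) : Set ℂ := {t | ∀ i, t - c.1 i ∉ lattice c.2}

/-- The space of meromorphic functions `X : ℂ → 𝔤` with poles in the union of the `z_i + ℤ + τ ℤ`,
such that `X (t + 1) = X t` and `X (t + τ) = exp (2 π i ad h) X t`. Elements are recorded by their
values away from that union; `Function.extend` extends by zero. -/
def fibre {𝔤 : Type*} [LieRing 𝔤] [LieAlgebra ℂ 𝔤] [FiniteDimensional ℂ 𝔤] {n : ℕ}
    (c : Conf n) (h : 𝔤) : Submodule ℂ (fibreRegular c → 𝔤) where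
  carrier := {X |
    (∀ φ : Module.Dual ℂ 𝔤,
      DifferentiableOn ℂ (fun t => φ (Function.extend Subtype.val X 0 t)) (fibreRegular c) ∧
      ∀ t, MeromorphicAt (fun t => φ (Function.extend Subtype.val X 0 t)) t) ∧
    ∀ t ∈ fibreRegular c,
      Function.extend Subtype.val X 0 (t + 1) = Function.extend Subtype.val X 0 t ∧
      Function.extend Subtype.val X 0 (t + c.2) = twist h (Function.extend Subtype.val X 0 t)}
  zero_mem' := by
    have e : Function.extend (Subtype.val : fibreRegular c → ℂ) (0 : fibreRegular c → 𝔤) 0 = 0 :=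
      Function.extend_zero _
    simp only [Set.mem_ofPred_eq, e]
    refine ⟨fun φ => ⟨?_, fun t => ?_⟩, ?_⟩
    · simpa using differentiableOn_const (0 : ℂ)
    · simpa using MeromorphicAt.const (0 : ℂ) t
    · simp
  add_mem' := by
    rintro X Y ⟨hX, hX'⟩ ⟨hY, hY'⟩
    have e : Function.extend (Subtype.val : fibreRegular c → ℂ) (X + Y) (0 : ℂ → 𝔤) =
        Function.extend Subtype.val X 0 + Function.extend Subtype.val Y 0 := by
      rw [← Function.extend_add, add_zero]
    simp only [Set.mem_ofPred_eq, e, Pi.add_apply, map_add]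
    refine ⟨fun φ => ⟨(hX φ).1.add (hY φ).1, fun t => ((hX φ).2 t).add ((hY φ).2 t)⟩,
      fun t ht => ⟨?_, ?_⟩⟩
    · rw [(hX' t ht).1, (hY' t ht).1]
    · rw [(hX' t ht).2, (hY' t ht).2]
  smul_mem' := by
    rintro a X ⟨hX, hX'⟩
    have e : Function.extend (Subtype.val : fibreRegular c → ℂ) (a • X) (0 : ℂ → 𝔤) =
        a • Function.extend Subtype.val X 0 := by
      rw [← Function.extend_smul, smul_zero]
    simp only [Set.mem_ofPred_eq, e, Pi.smul_apply, map_smul]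
    refine ⟨fun φ => ⟨(hX φ).1.const_smul a, fun t => ?_⟩, fun t ht => ⟨?_, ?_⟩⟩
    · exact (MeromorphicAt.const a t).smul ((hX φ).2 t)
    · rw [(hX' t ht).1]
    · rw [(hX' t ht).2]

/-! ### The sheaves -/

section Sheaf

variable {E : Type*} [NormedAddCommGroup E] [NormedSpace ℂ E]

/-- The algebra of holomorphic functions on an open set. -/
def holo (U : Opens E) : Subalgebra ℂ (U → ℂ) where
  carrier := {f | DifferentiableOn ℂ (Function.extend Subtype.val f 0) (U : Set E)}
  mul_mem' := by
    intro f g hf hg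
    have e : Function.extend (Subtype.val : U → E) (f * g) (0 : E → ℂ) =
        Function.extend Subtype.val f 0 * Function.extend Subtype.val g 0 := by
      rw [← Function.extend_mul, mul_zero]
    simp only [Set.mem_ofPred_eq, e] at *
    exact hf.mul hg
  add_mem' := by
    intro f g hf hg
    have e : Function.extend (Subtype.val : U → E) (f + g) (0 : E → ℂ) =
        Function.extend Subtype.val f 0 + Function.extend Subtype.val g 0 := by
      rw [← Function.extend_add, add_zero]
    simp only [Set.mem_ofPred_eq, e] at *
    exact hf.add hg
  algebraMap_mem' := by
    intro a
    refine (differentiableOn_const (c := a)).congr fun x hx => ?_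
    exact Subtype.val_injective.extend_apply _ _ (⟨x, hx⟩ : U)

variable {n : ℕ} (κ : E → Conf n)

/-- For a space `E` of parameters `x` and a map `x ↦ κ x = (z, τ)`: the complement in `ℂ × U` of
the hypersurfaces `t = z_i + r + s τ`. -/
def regularSet (U : Opens E) : Set (ℂ × E) :=
  {p | p.2 ∈ U ∧ ∀ i, p.1 - (κ p.2).1 i ∉ lattice (κ p.2).2}

theorem regularSet_mono {U V : Opens E} (h : V ≤ U) : regularSet κ V ⊆ regularSet κ U :=
  fun _ hp => ⟨h hp.1, hp.2⟩

/-- `f` is holomorphic on `regularSet κ U` and has poles of order at most `j` along the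
hypersurfaces `t = z_i + r + s τ`: near each point of these, the product
`(t - z_i - r - s τ) ^ j * f` extends to a holomorphic function `G`. -/
def HasPolesLE (U : Opens E) (j : ℕ) (f : ℂ × E → ℂ) : Prop :=
  DifferentiableOn ℂ f (regularSet κ U) ∧
  ∀ x ∈ U, ∀ (i : Fin n) (r s : ℤ), ∃ G : ℂ × E → ℂ,
    ∀ᶠ p in 𝓝 (((κ x).1 i + r + s * (κ x).2, x) : ℂ × E), DifferentiableAt ℂ G p ∧
      (p ∈ regularSet κ U →
        (p.1 - (κ p.2).1 i - r - s * (κ p.2).2) ^ j * f p = G p)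

/-- Functions of `x ∈ U`, regarded as functions of `(t, x)`. -/
def pullback (U : Opens E) : holo U →+* (regularSet κ U → ℂ) where
  toFun f p := (f : U → ℂ) ⟨p.1.2, p.2.1⟩
  map_one' := rfl
  map_mul' _ _ := rfl
  map_zero' := rfl
  map_add' _ _ := rfl

/-- The algebra of holomorphic functions on `U` acts by `(f • X) (t, x) = f x • X (t, x)`. -/
instance functionModule {W : Type*} [AddCommGroup W] [Module ℂ W] (U : Opens E) :
    Module (holo U) (regularSet κ U → W) :=
  Module.compHom _ (pullback κ U)

theorem functionModule_smul_apply {W : Type*} [AddCommGroup W] [Module ℂ W] (U : Opens E)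
    (f : holo U) (X : regularSet κ U → W) (p : regularSet κ U) :
    (f • X) p = (f : U → ℂ) ⟨p.1.2, p.2.1⟩ • X p := rfl

variable {𝔤 : Type*} [LieRing 𝔤] [LieAlgebra ℂ 𝔤] [FiniteDimensional ℂ 𝔤]

/-- For a space `E` of parameters `x` with maps `x ↦ κ x = (z, τ)` and `x ↦ Λ x ∈ 𝔤`: the module,
over the holomorphic functions on `U`, of the meromorphic functions `X (t, x)` on `ℂ × U` with
values in `𝔤`, with poles of order at most `j` along the hypersurfaces `t = z_i + r + s τ` and no
others, such that `X (t + 1, x) = X (t, x)` and `X (t + τ, x) = exp (2 π i ad (Λ x)) X (t, x)`.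
Elements are recorded by their values away from these hypersurfaces. -/
def sections (Λ : E → 𝔤) (U : Opens E) (j : ℕ) : Submodule (holo U) (regularSet κ U → 𝔤) where
  carrier := {X |
    (∀ φ : Module.Dual ℂ 𝔤,
      HasPolesLE κ U j (fun p => φ (Function.extend Subtype.val X 0 p))) ∧
    ∀ t x, (t, x) ∈ regularSet κ U →
      Function.extend Subtype.val X 0 (t + 1, x) = Function.extend Subtype.val X 0 (t, x) ∧
      Function.extend Subtype.val X 0 (t + (κ x).2, x) =
        twist (Λ x) (Function.extend Subtype.val X 0 (t, x))}
  zero_mem' := by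
    have e : Function.extend (Subtype.val : regularSet κ U → ℂ × E)
        (0 : regularSet κ U → 𝔤) 0 = 0 := Function.extend_zero _
    simp only [Set.mem_ofPred_eq, e]
    refine ⟨fun φ => ⟨?_, fun x hx i r s => ⟨fun _ => 0, Eventually.of_forall fun p => ?_⟩⟩, ?_⟩
    · simpa using differentiableOn_const (0 : ℂ)
    · exact ⟨differentiableAt_const _, fun _ => by simp⟩
    · simp
  add_mem' := by
    rintro X Y ⟨hX, hX'⟩ ⟨hY, hY'⟩
    have e : Function.extend (Subtype.val : regularSet κ U → ℂ × E) (X + Y) (0 : ℂ × E → 𝔤) =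
        Function.extend Subtype.val X 0 + Function.extend Subtype.val Y 0 := by
      rw [← Function.extend_add, add_zero]
    simp only [Set.mem_ofPred_eq, e, Pi.add_apply, map_add]
    refine ⟨fun φ => ⟨(hX φ).1.add (hY φ).1, fun x hx i r s => ?_⟩, fun t x ht => ⟨?_, ?_⟩⟩
    · obtain ⟨G, hG⟩ := (hX φ).2 x hx i r s
      obtain ⟨G', hG'⟩ := (hY φ).2 x hx i r s
      refine ⟨G + G', ?_⟩
      filter_upwards [hG, hG'] with p hp hp'
      exact ⟨hp.1.add hp'.1, fun h => by rw [mul_add, hp.2 h, hp'.2 h]; rfl⟩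
    · rw [(hX' t x ht).1, (hY' t x ht).1]
    · rw [(hX' t x ht).2, (hY' t x ht).2]
  smul_mem' := by
    rintro f X ⟨hX, hX'⟩
    have e : Function.extend (Subtype.val : regularSet κ U → ℂ × E) (f • X) (0 : ℂ × E → 𝔤) =
        fun p => Function.extend Subtype.val (f : U → ℂ) 0 p.2 •
          Function.extend Subtype.val X 0 p := by
      funext p
      by_cases hp : p ∈ regularSet κ U
      · have h1 := Subtype.val_injective.extend_apply (f • X) (0 : ℂ × E → 𝔤) ⟨p, hp⟩
        have h2 := Subtype.val_injective.extend_apply X (0 : ℂ × E → 𝔤) ⟨p, hp⟩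
        have h3 := Subtype.val_injective.extend_apply (f : U → ℂ) (0 : E → ℂ) ⟨p.2, hp.1⟩
        simp only at h1 h2 h3
        rw [h1, h2, h3, functionModule_smul_apply]
      · have hn : ¬∃ a : regularSet κ U, (a : ℂ × E) = p := by
          rintro ⟨a, rfl⟩
          exact hp a.2
        rw [Function.extend_apply' _ _ _ hn, Function.extend_apply' _ _ _ hn]
        simp
    have hf : DifferentiableOn ℂ (Function.extend Subtype.val (f : U → ℂ) 0) (U : Set E) := f.2
    simp only [Set.mem_ofPred_eq, e, map_smul, smul_eq_mul]
    refine ⟨fun φ => ⟨?_, fun x hx i r s => ?_⟩, fun t x ht => ⟨?_, ?_⟩⟩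
    · exact (hf.comp differentiableOn_snd fun p hp => hp.1).mul (hX φ).1
    · obtain ⟨G, hG⟩ := (hX φ).2 x hx i r s
      refine ⟨fun p => Function.extend Subtype.val (f : U → ℂ) 0 p.2 * G p, ?_⟩
      have hU : ∀ᶠ p : ℂ × E in 𝓝 ((κ x).1 i + r + s * (κ x).2, x), p.2 ∈ U :=
        continuous_snd.continuousAt.eventually (U.isOpen.mem_nhds hx)
      filter_upwards [hG, hU] with p hp hpU
      refine ⟨?_, fun h => ?_⟩
      · have h1 : DifferentiableAt ℂ (Function.extend Subtype.val (f : U → ℂ) 0) p.2 :=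
          hf.differentiableAt (U.isOpen.mem_nhds hpU)
        exact (h1.comp p differentiableAt_snd).mul hp.1
      · rw [← hp.2 h]
        ring
    · rw [(hX' t x ht).1]
    · rw [(hX' t x ht).2]

/-- Local freeness of rank `N` over `S` of the sheaf `U ↦ sections κ Λ U j`: every point of `S` has
an open neighbourhood `U` with sections `e_1, …, e_N` over `U` whose restrictions to any open
`V ⊆ U` form a basis of the module of sections over `V`. -/
def IsLocallyFreeOfRank (Λ : E → 𝔤) (S : Set E) (j N : ℕ) : Prop :=
  ∀ x ∈ S, ∃ U : Opens E, x ∈ U ∧ (U : Set E) ⊆ S ∧ ∃ e : Fin N → sections κ Λ U j,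
    ∀ (V : Opens E) (hVU : V ≤ U), ∃ B : Basis (Fin N) (holo V) (sections κ Λ V j),
      ∀ i p, (B i : regularSet κ V → 𝔤) p =
        (e i : regularSet κ U → 𝔤) ⟨p, regularSet_mono κ hVU p.2⟩

/-- Every element of the fibre at a point of `S` extends to a section near that point. -/
def FibresExtend (Λ : E → 𝔤) (S : Set E) : Prop :=
  ∀ x ∈ S, ∀ X : fibre (κ x) (Λ x), ∃ (j : ℕ) (U : Opens E) (hx : x ∈ U),
    (U : Set E) ⊆ S ∧ ∃ Y : sections κ Λ U j, ∀ t : fibreRegular (κ x),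
      (Y : regularSet κ U → 𝔤) ⟨(t, x), hx, t.2⟩ = (X : fibreRegular (κ x) → 𝔤) t

end Sheaf

/-! ### The explicit functions -/

/-- The Jacobi theta function `θ₁(t | τ)`. -/
def theta1 (t τ : ℂ) : ℂ :=
  -∑' m : ℤ, Complex.exp (2 * Real.pi * Complex.I * (t + 1 / 2) * (m + 1 / 2) +
    Real.pi * Complex.I * τ * (m + 1 / 2) ^ 2)

/-- `ρ(t) = ∂/∂t log θ₁(t | τ)`. -/
def rho (τ t : ℂ) : ℂ := logDeriv (fun u => theta1 u τ) t

/-- `σ_w(t) = θ₁(t - w | τ) θ₁'(0 | τ) / (θ₁(t | τ) θ₁(-w | τ))`. -/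
def sigma (τ w t : ℂ) : ℂ :=
  theta1 (t - w) τ * deriv (fun u => theta1 u τ) 0 / (theta1 t τ * theta1 (-w) τ)

/-- The generic formulas, with removable singularities at `w ∈ ℤ`; the point `z_1` is indexed by
`0 : Fin n`. -/
def genericFun {n : ℕ} [NeZero n] (c : Conf n) (w : ℂ) (m : ℕ) (l : Fin n) (t : ℂ) : ℂ :=
  if m = 0 then
    if l = 0 then (Complex.exp (2 * Real.pi * Complex.I * w) - 1) * sigma c.2 w (t - c.1 0)
    else sigma c.2 w (t - c.1 l) - sigma c.2 w (t - c.1 0)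
  else iteratedDeriv m (sigma c.2 w) (t - c.1 l)

open scoped Classical in
/-- The generic formulas, with their limits at the removable singularities `w ∈ ℤ` filled in. -/
def basisFun {n : ℕ} [NeZero n] (c : Conf n) (w : ℂ) (m : ℕ) (l : Fin n) (t : ℂ) : ℂ :=
  if ∃ k : ℤ, w = k then
    if m = 0 then
      if l = 0 then -(2 * Real.pi * Complex.I)
      else rho c.2 (t - c.1 l) - rho c.2 (t - c.1 0)
    else iteratedDeriv m (rho c.2) (t - c.1 l)
  else genericFun c w m l t

end

end EllipticLie

set_option linter.unusedSectionVars false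

/-! Simplicity makes the Killing form non-degenerate, so `exp (2 π i ad λ)` acts on the root space
of `α` as the scalar `expTwoPi (α λ)`. In a basis of root vectors every assertion splits into scalar
ones about meromorphic `f` with `f (t + 1) = f t`, `f (t + τ) = expTwoPi w * f t` and poles at the
translates of the `z_i`, where `w = α λ` (`QuasiPeriodic`).

For one fixed `(z, τ, w)` with `|Im w| < Im τ` the argument is classical. For `m ≥ 1` the explicit
function of index `(m, l)` has the leading term `(-1) ^ m m! (t - z_l) ^ (-m - 1)` at `z_l` and no
pole at the other `z_i`, so pole orders can be lowered one at a time. Among functions with simple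
poles, the residues at all points but the first are removed by differences of two kernels. What
remains is a multiple of `basisFun c w 0 0`: by Liouville's theorem if `w` is not an integer, and
because a single simple pole is impossible if it is (`exists_eq_mul_basisFun_zero_zero`). The same
leading coefficients give linear independence. The outcome is `exists_eq_sum_basisFun` and
`eq_zero_of_sum_basisFun`. The input on `θ₁`, that it vanishes exactly on the lattice and has
non-zero derivative at `0`, comes from comparing it with an infinite product
(`theta1_eq_mul_thetaProd`).

Two facts pass from points to families. The explicit functions are jointly holomorphic, also across
integral `w` (`differentiableAt_basisFun`). The coefficients found fibre by fibre are holomorphic,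
by Cramer's rule at well-chosen evaluation points (`differentiableOn_of_eq_sum`). Pole bounds in
each fibre and joint pole bounds are equivalent, by removing singularities along the graph of a
moving pole (`ScalarSection.hasPolesLE`, `ScalarSection.of_hasPolesLE`).

Multiplication by `expTwoPi (s * t)` replaces `w` by `w + s τ`, so near any point every `α λ` can be
brought into the strip. This gives local freeness for `j ≥ 1`. For `j = 0` the Cartan part
contributes constants, and a root contributes nothing, since `α λ` avoids the lattice on a dense
set. A fibre element is extended by keeping its coefficients constant. -/

namespace EllipticLie

noncomputable section

/-! ### Cauchy integrals and removable singularities with holomorphic parameters -/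

section ComplexAnalysis

open Metric

variable {F : Type*} [NormedAddCommGroup F] [NormedSpace ℂ F]

/-- A circle integral depends holomorphically on parameters. -/
theorem differentiableAt_circleIntegral [FiniteDimensional ℂ F] {K : ℂ × F → ℂ} {c : ℂ} {R : ℝ}
    {p₀ : F} (h : ∀ ζ ∈ sphere c |R|, ∀ᶠ q in 𝓝 (ζ, p₀), DifferentiableAt ℂ K q) :
    DifferentiableAt ℂ (fun p => ∮ ζ in C(c, R), K (ζ, p)) p₀ := by
  have hcK : ContinuousOn (fun ζ => K (ζ, p₀)) (sphere c |R|) := fun ζ hζ =>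
    ((h ζ hζ).self_of_nhds.continuousAt.comp (f := fun ζ : ℂ => (ζ, p₀))
      (by fun_prop)).continuousWithinAt
  obtain ⟨M, hM⟩ := (isCompact_sphere c |R|).exists_bound_of_continuousOn hcK
  -- Compactness of the circle provides one neighbourhood of `p₀` that works for all `ζ`.
  have hev : ∀ᶠ p in 𝓝 p₀, ∀ ζ ∈ sphere c |R|, DifferentiableAt ℂ K (ζ, p) ∧ ‖K (ζ, p)‖ < M + 1 := by
    refine (isCompact_sphere c |R|).eventually_forall_of_forall_eventually fun ζ hζ => ?_
    have h1 : ∀ᶠ q in 𝓝 (ζ, p₀), ‖K q‖ < M + 1 :=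
      (h ζ hζ).self_of_nhds.continuousAt.norm.eventually_lt continuousAt_const
        (by have := hM ζ hζ; linarith)
    have h2 := (h ζ hζ).and h1
    have hs : Tendsto (fun z : F × ℂ => (z.2, z.1)) (𝓝 (p₀, ζ)) (𝓝 (ζ, p₀)) :=
      continuous_swap.tendsto (p₀, ζ)
    exact hs.eventually h2
  obtain ⟨ε, hε, hball⟩ := Metric.eventually_nhds_iff_ball.1 hev
  let _ : MeasurableSpace F := borel F
  have : BorelSpace F := ⟨rfl⟩
  have : ProperSpace F := FiniteDimensional.proper ℂ F
  have hsph : ∀ θ : ℝ, circleMap c R θ ∈ sphere c |R| := fun θ => circleMap_mem_sphere' c R θ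
  have hderiv : Continuous fun θ : ℝ => deriv (circleMap c R) θ := by
    simp only [deriv_circleMap]; fun_prop
  have hd : ∀ p ∈ ball p₀ ε, ∀ θ : ℝ, DifferentiableAt ℂ (fun p => K (circleMap c R θ, p)) p :=
    fun p hp θ => ((hball p hp _ (hsph θ)).1).comp p
      (by fun_prop : DifferentiableAt ℂ (fun p => (circleMap c R θ, p)) p)
  have hcont : ∀ p ∈ ball p₀ ε, Continuous fun θ : ℝ => K (circleMap c R θ, p) := fun p hp =>
    continuous_iff_continuousAt.2 fun θ => ((hball p hp _ (hsph θ)).1).continuousAt.comp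
      (f := fun θ : ℝ => (circleMap c R θ, p)) (by fun_prop)
  set F' : ℝ → F →L[ℂ] ℂ := fun θ =>
    deriv (circleMap c R) θ • (fderiv ℂ K (circleMap c R θ, p₀)).comp (.inr ℂ ℂ F) with hF'
  have hF'm : Measurable F' := by
    have h1 : Measurable fun θ : ℝ => fderiv ℂ K (circleMap c R θ, p₀) :=
      (measurable_fderiv ℂ K).comp (by fun_prop : Continuous fun θ : ℝ =>
        (circleMap c R θ, p₀)).measurable
    have h2 : Continuous fun L : ℂ × F →L[ℂ] ℂ => L.comp (.inr ℂ ℂ F) := by fun_prop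
    exact hderiv.measurable.smul (h2.measurable.comp h1)
  -- Differentiation under the integral needs a Lipschitz bound near `p₀`, and the sup bound `M + 1`
  -- yields one. Points of the ball of radius `ε / 4` are within `ε / 2` of each other, and a ball
  -- of radius `ε / 2` around any of them stays inside the ball of radius `ε`.
  have key := intervalIntegral.hasFDerivAt_integral_of_dominated_loc_of_lip (μ := MeasureTheory.volume)
    (F := fun p θ => deriv (circleMap c R) θ • K (circleMap c R θ, p)) (F' := F') (x₀ := p₀)
    (s := ball p₀ (ε / 4)) (a := 0) (b := 2 * Real.pi)
    (bound := fun _ => |R| * ((2 * (M + 1)) / (ε / 2)))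
    (ball_mem_nhds _ (by positivity)) ?_ ?_ hF'm.aestronglyMeasurable ?_
    intervalIntegrable_const ?_
  · exact key.2.differentiableAt
  · filter_upwards [ball_mem_nhds p₀ hε] with p hp
    exact (hderiv.smul (hcont p hp)).aestronglyMeasurable
  · exact (hderiv.smul (hcont p₀ (mem_ball_self hε))).intervalIntegrable _ _
  · refine Eventually.of_forall fun θ _ => ?_
    refine LipschitzOnWith.of_dist_le_mul fun x hx y hy => ?_
    have hsub : ball y (ε / 2) ⊆ ball p₀ ε := fun z hz => by
      have h1 := mem_ball.1 hz
      have h2 := mem_ball.1 hy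
      have := dist_triangle z y p₀
      rw [mem_ball]; linarith
    have hM0 : 0 ≤ M + 1 := (norm_nonneg _).trans (hball p₀ (mem_ball_self hε) _ (hsph θ)).2.le
    have hxy : x ∈ ball y (ε / 2) := by
      have h1 := mem_ball.1 hx
      have h2 := mem_ball'.1 hy
      have := dist_triangle x p₀ y
      rw [mem_ball]; linarith
    have hmaps : Set.MapsTo (fun p => K (circleMap c R θ, p)) (ball y (ε / 2))
        (closedBall (K (circleMap c R θ, y)) (2 * (M + 1))) := fun z hz => by
      rw [mem_closedBall, dist_eq_norm]
      have h1 := (hball z (hsub hz) _ (hsph θ)).2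
      have h2 := (hball y (hsub (mem_ball_self (by positivity))) _ (hsph θ)).2
      exact (norm_sub_le _ _).trans (by linarith)
    -- Schwarz lemma: a holomorphic map that moves values by at most `2 (M + 1)` on a ball of radius
    -- `ε / 2` is Lipschitz at its centre with the quotient as constant.
    have h3 := Complex.dist_le_div_mul_dist_of_mapsTo_ball
      (fun z hz => (hd z (hsub hz) θ).differentiableWithinAt) hmaps hxy
    have hb : 0 ≤ |R| * (2 * (M + 1) / (ε / 2)) := by positivity
    rw [dist_smul₀, deriv_circleMap, norm_mul, norm_circleMap_zero, Complex.norm_I, mul_one,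
      Real.coe_nnabs, abs_of_nonneg hb, mul_assoc]
    exact mul_le_mul_of_nonneg_left h3 (abs_nonneg _)
  · refine Eventually.of_forall fun θ _ => ?_
    have h1 : HasFDerivAt (fun p => K (circleMap c R θ, p))
        ((fderiv ℂ K (circleMap c R θ, p₀)).comp (.inr ℂ ℂ F)) p₀ :=
      ((h _ (hsph θ)).self_of_nhds.hasFDerivAt).comp p₀ (hasFDerivAt_prodMk_right _ _)
    exact h1.const_smul (deriv (circleMap c R) θ)

/-- A Cauchy integral depends holomorphically on the pole of its kernel and on parameters. -/
theorem differentiableAt_circleIntegral_inv_pow [FiniteDimensional ℂ F] {f : ℂ × F → ℂ} {c : ℂ}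
    {R : ℝ} (k : ℕ) {q : ℂ × F} (h : ∀ ζ ∈ sphere c |R|, ζ ≠ q.1 ∧
      ∀ᶠ p in 𝓝 (ζ, q.2), DifferentiableAt ℂ f p) :
    DifferentiableAt ℂ (fun q : ℂ × F => ∮ z in C(c, R), ((z - q.1) ^ k)⁻¹ * f (z, q.2)) q := by
  refine differentiableAt_circleIntegral
    (K := fun p : ℂ × ℂ × F => ((p.1 - p.2.1) ^ k)⁻¹ * f (p.1, p.2.2)) fun ζ hζ => ?_
  have h1 : ∀ᶠ p : ℂ × ℂ × F in 𝓝 (ζ, q), p.1 - p.2.1 ≠ 0 :=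
    ContinuousAt.eventually_ne (by fun_prop) (sub_ne_zero.2 (h ζ hζ).1)
  have h2 : Tendsto (fun p : ℂ × ℂ × F => (p.1, p.2.2)) (𝓝 (ζ, q)) (𝓝 (ζ, q.2)) :=
    Continuous.tendsto (by fun_prop) (ζ, q)
  filter_upwards [h1, h2.eventually (h ζ hζ).2] with p hp1 hp2
  have h4 : DifferentiableAt ℂ (fun p : ℂ × ℂ × F => f (p.1, p.2.2)) p :=
    hp2.comp p (f := fun p : ℂ × ℂ × F => (p.1, p.2.2)) (by fun_prop)
  have h5 : DifferentiableAt ℂ (fun p : ℂ × ℂ × F => (p.1 - p.2.1) ^ k) p := by fun_prop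
  exact (h5.inv (pow_ne_zero k hp1)).mul h4

/-- The Cauchy integral formula with one removable singularity. -/
theorem circleIntegral_eq_update {g : ℂ → ℂ} {c u a : ℂ} {R : ℝ} (hu : u ∈ ball c R)
    (hg : ∀ z ∈ closedBall c R, z ≠ u → DifferentiableAt ℂ g z)
    (ha : Tendsto g (𝓝[≠] u) (𝓝 a)) {t : ℂ} (ht : t ∈ ball c R) :
    (2 * Real.pi * Complex.I : ℂ)⁻¹ * ∮ z in C(c, R), ((z - t) ^ 1)⁻¹ * g z =
      Function.update g u a t := by
  have h1 : ∀ z ∈ closedBall c R, z ≠ u → DifferentiableAt ℂ (Function.update g u a) z := by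
    intro z hz hne
    refine (hg z hz hne).congr_of_eventuallyEq ?_
    filter_upwards [isOpen_ne.mem_nhds hne] with w hw
    exact Function.update_of_ne hw _ _
  have h3 := Complex.two_pi_I_inv_smul_circleIntegral_sub_inv_smul_of_differentiable_on_off_countable
    (f := Function.update g u a) (c := c) (R := R) (w := t)
    (Set.countable_singleton u) ht (fun z hz => ?_) (fun z hz => h1 z (ball_subset_closedBall hz.1) hz.2)
  · rw [← h3, smul_eq_mul]
    congr 1
    refine circleIntegral.integral_congr (pos_of_mem_ball ht).le fun z hz => ?_
    have hne : z ≠ u := by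
      rintro rfl
      exact (mem_ball.1 hu).ne (mem_sphere.1 hz)
    simp only [Function.update_of_ne hne, pow_one, smul_eq_mul]
  · by_cases hne : z = u
    · rw [hne]
      exact (continuousAt_update_same.2 ha).continuousWithinAt
    · exact (h1 z hz hne).continuousAt.continuousWithinAt

/-- The partial derivative of a jointly holomorphic function is jointly holomorphic. -/
theorem differentiableAt_deriv_fst [FiniteDimensional ℂ F] {f : ℂ × F → ℂ} {q₀ : ℂ × F}
    (hf : ∀ᶠ q in 𝓝 q₀, DifferentiableAt ℂ f q) :
    DifferentiableAt ℂ (fun q : ℂ × F => deriv (fun t => f (t, q.2)) q.1) q₀ := by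
  obtain ⟨t₀, y₀⟩ := q₀
  obtain ⟨r, hr, hball⟩ := Metric.eventually_nhds_iff_ball.1 hf.eventually_nhds
  have hmem : ∀ t y, dist t t₀ < r → dist y y₀ < r → ∀ᶠ q in 𝓝 (t, y), DifferentiableAt ℂ f q :=
    fun t y ht hy => hball _ (by rw [mem_ball, Prod.dist_eq]; exact max_lt ht hy)
  -- Near `t₀` the derivative is a Cauchy integral over a fixed circle, so its joint holomorphy is
  -- that of an integral with parameters.
  have hG : DifferentiableAt ℂ (fun q : ℂ × F => (2 * Real.pi * Complex.I : ℂ)⁻¹ *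
      ∮ z in C(t₀, r / 2), ((z - q.1) ^ 2)⁻¹ * f (z, q.2)) (t₀, y₀) := by
    refine DifferentiableAt.const_mul (differentiableAt_circleIntegral_inv_pow 2 fun ζ hζ => ?_) _
    rw [abs_of_pos (by positivity), mem_sphere] at hζ
    refine ⟨?_, hmem ζ y₀ (by linarith) (by simpa using hr)⟩
    rintro rfl
    rw [dist_self] at hζ
    linarith
  refine hG.congr_of_eventuallyEq ?_
  have h2 : ∀ᶠ q : ℂ × F in 𝓝 (t₀, y₀), dist q.1 t₀ < r / 2 :=
    ContinuousAt.eventually_lt (by fun_prop) continuousAt_const (by simpa using hr)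
  have h3 : ∀ᶠ q : ℂ × F in 𝓝 (t₀, y₀), dist q.2 y₀ < r :=
    ContinuousAt.eventually_lt (by fun_prop) continuousAt_const (by simpa using hr)
  filter_upwards [h2, h3] with q hq2 hq3
  refine (Complex.two_pi_I_inv_smul_circleIntegral_sub_sq_inv_smul_of_differentiable
    (U := ball t₀ r) isOpen_ball (closedBall_subset_ball (by linarith)) (fun t ht => ?_) hq2).symm
  exact ((hmem t q.2 ht hq3).self_of_nhds.comp t (f := fun t : ℂ => (t, q.2))
    (by fun_prop)).differentiableWithinAt

/-- Iterated partial derivatives of jointly holomorphic functions are jointly holomorphic. -/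
theorem differentiableAt_iteratedDeriv_fst [FiniteDimensional ℂ F] {f : ℂ × F → ℂ} (m : ℕ)
    {q₀ : ℂ × F} (hf : ∀ᶠ q in 𝓝 q₀, DifferentiableAt ℂ f q) :
    DifferentiableAt ℂ (fun q : ℂ × F => iteratedDeriv m (fun t => f (t, q.2)) q.1) q₀ := by
  induction m generalizing q₀ with
  | zero => simpa using hf.self_of_nhds
  | succ m ih =>
    simp only [iteratedDeriv_succ]
    exact differentiableAt_deriv_fst
      (f := fun q : ℂ × F => iteratedDeriv m (fun t => f (t, q.2)) q.1)
      (hf.eventually_nhds.mono fun q hq => ih hq)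

/-- Removable singularities along a graph `t = h y`, with holomorphic dependence on `y`. -/
theorem exists_differentiableAt_of_tendsto [FiniteDimensional ℂ F] {f : ℂ × F → ℂ} {h : F → ℂ}
    {y₀ : F} (hh : ∀ᶠ y in 𝓝 y₀, ContinuousAt h y)
    (hf : ∀ᶠ q in 𝓝 (h y₀, y₀), q.1 ≠ h q.2 → DifferentiableAt ℂ f q)
    (hlim : ∀ᶠ y in 𝓝 y₀, ∃ a, Tendsto (fun t => f (t, y)) (𝓝[≠] h y) (𝓝 a)) :
    ∃ G : ℂ × F → ℂ, ∀ᶠ q in 𝓝 (h y₀, y₀), DifferentiableAt ℂ G q ∧ (q.1 ≠ h q.2 → f q = G q) ∧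
      Tendsto (fun t => f (t, q.2)) (𝓝[≠] h q.2) (𝓝 (G (h q.2, q.2))) := by
  generalize ht₀ : h y₀ = t₀ at *
  obtain ⟨r, hr, hball⟩ := Metric.eventually_nhds_iff_ball.1 hf.eventually_nhds
  have hmem : ∀ t y, dist t t₀ < r → dist y y₀ < r →
      ∀ᶠ q in 𝓝 (t, y), q.1 ≠ h q.2 → DifferentiableAt ℂ f q :=
    fun t y ht hy => hball (t, y) (by rw [mem_ball, Prod.dist_eq]; exact max_lt ht hy)
  have hev : ∀ᶠ y in 𝓝 y₀, dist y y₀ < r ∧ dist (h y) t₀ < r / 2 ∧ ContinuousAt h y ∧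
      ∃ a, Tendsto (fun t => f (t, y)) (𝓝[≠] h y) (𝓝 a) := by
    refine (ContinuousAt.eventually_lt (by fun_prop) continuousAt_const (by simpa using hr)).and
      (Eventually.and ?_ (hh.and hlim))
    exact (hh.self_of_nhds.dist continuousAt_const).eventually_lt continuousAt_const
      (by rw [ht₀, dist_self]; positivity)
  -- The extension is the Cauchy integral over a circle that does not move with `y`. For `y` near
  -- `y₀` the point `h y` lies strictly inside it, so the integrand is holomorphic along the circle.
  refine ⟨fun q => (2 * Real.pi * Complex.I : ℂ)⁻¹ *
      ∮ z in C(t₀, r / 2), ((z - q.1) ^ 1)⁻¹ * f (z, q.2), ?_⟩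
  have hG : ∀ t y a, dist t t₀ < r / 2 → dist y y₀ < r → dist (h y) t₀ < r / 2 →
      Tendsto (fun t => f (t, y)) (𝓝[≠] h y) (𝓝 a) →
      (2 * Real.pi * Complex.I : ℂ)⁻¹ * ∮ z in C(t₀, r / 2), ((z - t) ^ 1)⁻¹ * f (z, y) =
        Function.update (fun t => f (t, y)) (h y) a t := by
    intro t y a ht hy hhy ha
    refine circleIntegral_eq_update hhy (fun z hz hne => ?_) ha ht
    have hz' := mem_closedBall.1 hz
    exact ((hmem z y (by linarith) hy).self_of_nhds hne).comp z (f := fun t : ℂ => (t, y))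
      (by fun_prop)
  have h1 : ∀ᶠ q : ℂ × F in 𝓝 (t₀, y₀), dist q.1 t₀ < r / 2 :=
    ContinuousAt.eventually_lt (by fun_prop) continuousAt_const (by simpa using hr)
  have h2 := (continuous_snd.tendsto (t₀, y₀)).eventually hev
  filter_upwards [h1, h2] with q hq1 ⟨hqy, hqh, hqc, a, ha⟩
  refine ⟨?_, fun hne => ?_, ?_⟩
  · refine DifferentiableAt.const_mul (differentiableAt_circleIntegral_inv_pow 1 fun ζ hζ => ?_) _
    rw [abs_of_pos (by positivity), mem_sphere] at hζ
    have hne : ζ ≠ h q.2 := by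
      rintro rfl
      linarith
    refine ⟨by rintro rfl; linarith, ?_⟩
    have h3 : ∀ᶠ p : ℂ × F in 𝓝 (ζ, q.2), p.1 - h p.2 ≠ 0 :=
      (continuousAt_fst.sub (ContinuousAt.comp (f := Prod.snd) (x := (ζ, q.2)) hqc
        continuousAt_snd)).eventually_ne (sub_ne_zero.2 hne)
    filter_upwards [hmem ζ q.2 (by linarith) hqy, h3] with p hp hp'
    exact hp (sub_ne_zero.1 hp')
  · rw [hG q.1 q.2 a hq1 hqy hqh ha, Function.update_of_ne hne]
  · rw [hG _ q.2 a hqh hqy hqh ha, Function.update_self]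
    exact ha

/-- A function whose values on the graph `t = h y` are the limits of its values nearby is jointly
holomorphic if it is so outside of the graph. -/
theorem differentiableAt_of_tendsto_fst [FiniteDimensional ℂ F] {f : ℂ × F → ℂ} {h : F → ℂ}
    {y₀ : F} (hh : ∀ᶠ y in 𝓝 y₀, ContinuousAt h y)
    (hf : ∀ᶠ q in 𝓝 (h y₀, y₀), q.1 ≠ h q.2 → DifferentiableAt ℂ f q)
    (hlim : ∀ᶠ y in 𝓝 y₀, Tendsto (fun t => f (t, y)) (𝓝[≠] h y) (𝓝 (f (h y, y)))) :
    DifferentiableAt ℂ f (h y₀, y₀) := by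
  obtain ⟨G, hG⟩ := exists_differentiableAt_of_tendsto hh hf (hlim.mono fun y hy => ⟨_, hy⟩)
  refine hG.self_of_nhds.1.congr_of_eventuallyEq ?_
  filter_upwards [hG, (continuous_snd.tendsto (h y₀, y₀)).eventually hlim] with q hq hq'
  by_cases hne : q.1 = h q.2
  · have := tendsto_nhds_unique hq' hq.2.2
    rw [← Prod.mk.eta (p := q), hne, this]
  · exact hq.2.1 hne

/-- A holomorphic function on a punctured neighbourhood whose product with `t - c` tends to `0`
has a limit. -/
theorem exists_tendsto_of_sub_mul_tendsto_zero {f : ℂ → ℂ} {c : ℂ}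
    (hd : ∀ᶠ z in 𝓝[≠] c, DifferentiableAt ℂ f z)
    (ho : Tendsto (fun z => (z - c) * f z) (𝓝[≠] c) (𝓝 0)) : ∃ a, Tendsto f (𝓝[≠] c) (𝓝 a) := by
  refine ⟨_, Complex.tendsto_limUnder_of_differentiable_on_punctured_nhds_of_isLittleO hd ?_⟩
  -- The removable singularity theorem concerns `f z - f c`; the arbitrary value `f c` has to be
  -- seen to contribute nothing.
  have hc : Tendsto (fun z => (z - c) * f c) (𝓝[≠] c) (𝓝 0) := by
    have h1 : Tendsto (fun z => (z - c) * f c) (𝓝 c) (𝓝 ((c - c) * f c)) :=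
      Continuous.tendsto (by fun_prop) c
    rw [sub_self, zero_mul] at h1
    exact h1.mono_left nhdsWithin_le_nhds
  rw [Asymptotics.isLittleO_iff_tendsto']
  · have h1 := ho.sub hc
    rw [sub_zero] at h1
    refine h1.congr fun z => ?_
    rw [div_inv_eq_mul]
    ring
  · filter_upwards [self_mem_nhdsWithin] with z hz h0
    exact absurd (inv_eq_zero.1 h0) (sub_ne_zero.2 hz)

end ComplexAnalysis

end

noncomputable section

open Complex (I)

/-! ### Lattices -/

/-- `e t = exp (2 π i t)`. -/
def expTwoPi (t : ℂ) : ℂ := Complex.exp (2 * Real.pi * I * t)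

theorem expTwoPi_ne_zero (t : ℂ) : expTwoPi t ≠ 0 := Complex.exp_ne_zero _

theorem expTwoPi_zero : expTwoPi 0 = 1 := by simp [expTwoPi]

theorem expTwoPi_add (s t : ℂ) : expTwoPi (s + t) = expTwoPi s * expTwoPi t := by
  rw [expTwoPi, mul_add, Complex.exp_add]; rfl

theorem expTwoPi_neg (t : ℂ) : expTwoPi (-t) = (expTwoPi t)⁻¹ := by
  rw [expTwoPi, mul_neg, Complex.exp_neg]; rfl

theorem expTwoPi_sub (s t : ℂ) : expTwoPi (s - t) = expTwoPi s / expTwoPi t := by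
  rw [sub_eq_add_neg, expTwoPi_add, expTwoPi_neg, div_eq_mul_inv]

theorem expTwoPi_int_mul (k : ℤ) (t : ℂ) : expTwoPi (k * t) = expTwoPi t ^ k := by
  rw [expTwoPi, expTwoPi, ← Complex.exp_int_mul]; ring_nf

theorem expTwoPi_eq_one_iff {t : ℂ} : expTwoPi t = 1 ↔ ∃ k : ℤ, t = k := by
  rw [expTwoPi, Complex.exp_eq_one_iff]
  refine exists_congr fun k => ⟨fun h => ?_, fun h => by rw [h]; ring⟩
  have h2 : (2 * Real.pi * I : ℂ) ≠ 0 := Complex.two_pi_I_ne_zero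
  exact mul_left_cancel₀ h2 (by rw [h]; ring)

theorem expTwoPi_int (k : ℤ) : expTwoPi k = 1 := expTwoPi_eq_one_iff.2 ⟨k, rfl⟩

theorem expTwoPi_one : expTwoPi 1 = 1 := by simpa using expTwoPi_int 1

theorem norm_expTwoPi (t : ℂ) : ‖expTwoPi t‖ = Real.exp (-(2 * Real.pi * t.im)) := by
  rw [expTwoPi, Complex.norm_exp]
  simp

theorem norm_expTwoPi_lt_one {t : ℂ} (ht : 0 < t.im) : ‖expTwoPi t‖ < 1 := by
  rw [norm_expTwoPi, Real.exp_lt_one_iff]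
  have := Real.pi_pos
  nlinarith [mul_pos this ht]

theorem differentiable_expTwoPi : Differentiable ℂ expTwoPi := by
  unfold expTwoPi; fun_prop

theorem hasDerivAt_expTwoPi (t : ℂ) : HasDerivAt expTwoPi (2 * Real.pi * I * expTwoPi t) t := by
  have h : HasDerivAt (fun t : ℂ => Complex.exp (2 * Real.pi * I * t)) _ t :=
    ((hasDerivAt_id t).const_mul (2 * Real.pi * I : ℂ)).cexp
  have e : Complex.exp (2 * Real.pi * I * id t) * (2 * Real.pi * I * 1) =
      2 * Real.pi * I * expTwoPi t := by
    simp only [id, expTwoPi]; ring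
  rwa [e] at h

theorem add_mem_lattice {τ a b : ℂ} (ha : a ∈ lattice τ) (hb : b ∈ lattice τ) :
    a + b ∈ lattice τ := by
  obtain ⟨r, s, rfl⟩ := ha
  obtain ⟨r', s', rfl⟩ := hb
  exact ⟨r + r', s + s', by push_cast; ring⟩

theorem neg_mem_lattice {τ a : ℂ} (ha : a ∈ lattice τ) : -a ∈ lattice τ := by
  obtain ⟨r, s, rfl⟩ := ha
  exact ⟨-r, -s, by push_cast; ring⟩

theorem neg_mem_lattice_iff {τ a : ℂ} : -a ∈ lattice τ ↔ a ∈ lattice τ :=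
  ⟨fun h => by simpa using neg_mem_lattice h, neg_mem_lattice⟩

theorem add_mem_lattice_iff {τ a b : ℂ} (hb : b ∈ lattice τ) :
    a + b ∈ lattice τ ↔ a ∈ lattice τ :=
  ⟨fun h => by simpa using add_mem_lattice h (neg_mem_lattice hb), fun h => add_mem_lattice h hb⟩

theorem int_mem_lattice (τ : ℂ) (k : ℤ) : (k : ℂ) ∈ lattice τ := ⟨k, 0, by simp⟩

theorem one_mem_lattice (τ : ℂ) : 1 ∈ lattice τ := by simpa using int_mem_lattice τ 1

theorem self_mem_lattice (τ : ℂ) : τ ∈ lattice τ := ⟨0, 1, by simp⟩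

theorem exists_int_eq_of_mem_lattice {τ w : ℂ} (hw : |w.im| < τ.im) (h : w ∈ lattice τ) :
    ∃ k : ℤ, w = k := by
  obtain ⟨r, s, rfl⟩ := h
  have hτ : 0 < τ.im := (abs_nonneg _).trans_lt hw
  simp only [Complex.add_im, Complex.intCast_im, Complex.mul_im, Complex.intCast_re, zero_mul,
    zero_add, add_zero, abs_mul, abs_of_pos hτ] at hw
  have h1 : |(s : ℝ)| < 1 := by
    by_contra hh
    nlinarith [not_lt.1 hh]
  have h2 : s = 0 := by
    rw [← Int.abs_lt_one_iff]
    exact_mod_cast h1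
  exact ⟨r, by simp [h2]⟩

/-! ### The product `∏ (1 - q ^ n u)` -/

/-- The product `∏ (1 - q ^ n u)` over `n ≥ 0`. -/
def qProd (q u : ℂ) : ℂ := ∏' n : ℕ, (1 + -(q ^ n * u))

theorem summable_norm_pow_mul {q : ℂ} (hq : ‖q‖ < 1) (u : ℂ) :
    Summable fun n : ℕ => ‖-(q ^ n * u)‖ := by
  simp only [norm_neg, norm_mul, norm_pow]
  exact (summable_geometric_of_lt_one (norm_nonneg _) hq).mul_right _

theorem qProd_eq {q : ℂ} (hq : ‖q‖ < 1) (u : ℂ) : qProd q u = (1 - u) * qProd q (q * u) := by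
  have e : (fun n : ℕ => 1 + -(q ^ (n + 1) * u)) = fun n : ℕ => 1 + -(q ^ n * (q * u)) := by
    funext n
    rw [pow_succ, mul_assoc]
  have h : Multipliable fun n : ℕ => 1 + -(q ^ n * (q * u)) :=
    multipliable_one_add_of_summable (summable_norm_pow_mul hq _)
  rw [← e] at h
  have h2 : ∏' n : ℕ, (1 + -(q ^ n * u)) =
      (1 + -(q ^ 0 * u)) * ∏' n : ℕ, (1 + -(q ^ (n + 1) * u)) :=
    tprod_eq_zero_mul' (f := fun n : ℕ => 1 + -(q ^ n * u)) h
  rw [e, pow_zero, one_mul, ← sub_eq_add_neg] at h2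
  exact h2

theorem qProd_ne_zero {q u : ℂ} (hq : ‖q‖ < 1) (h : ∀ n : ℕ, q ^ n * u ≠ 1) : qProd q u ≠ 0 := by
  refine tprod_one_add_ne_zero_of_summable (fun n hn => h n ?_) (summable_norm_pow_mul hq u)
  linear_combination -hn

theorem differentiable_qProd {q : ℂ} (hq : ‖q‖ < 1) : Differentiable ℂ (qProd q) := by
  intro u
  have h := Summable.hasProdLocallyUniformlyOn_nat_one_add (K := Metric.ball (0 : ℂ) (‖u‖ + 1))
    (f := fun n x => -(q ^ n * x)) Metric.isOpen_ball
    (u := fun n => ‖q‖ ^ n * (‖u‖ + 1))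
    ((summable_geometric_of_lt_one (norm_nonneg _) hq).mul_right _)
    (Eventually.of_forall fun n x hx => by
      rw [norm_neg, norm_mul, norm_pow]
      exact mul_le_mul_of_nonneg_left (mem_ball_zero_iff.1 hx).le (by positivity))
    (fun n => by fun_prop)
  refine (h.tendstoLocallyUniformlyOn_finsetRange.differentiableOn
    (Eventually.of_forall fun N => ?_) Metric.isOpen_ball).differentiableAt
    (Metric.isOpen_ball.mem_nhds (by simp))
  exact DifferentiableOn.fun_finsetProd fun n _ => by fun_prop

/-- The product `∏ (1 - q ^ n u) ∏ (1 - q ^ (n + 1) / u)` for `u = exp (2 π i t)` and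
`q = exp (2 π i τ)`. -/
def thetaProd (τ t : ℂ) : ℂ :=
  qProd (expTwoPi τ) (expTwoPi t) * qProd (expTwoPi τ) (expTwoPi (τ - t))

variable {τ : ℂ}

/-- Splitting off the factor `n = 0` isolates the zero at `t = 0`; the remaining product is even in
`t`. -/
theorem thetaProd_eq (hτ : 0 < τ.im) (t : ℂ) : thetaProd τ t = (1 - expTwoPi t) *
    (qProd (expTwoPi τ) (expTwoPi (τ + t)) * qProd (expTwoPi τ) (expTwoPi (τ - t))) := by
  rw [thetaProd, qProd_eq (norm_expTwoPi_lt_one hτ), expTwoPi_add, mul_assoc]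

theorem thetaProd_add_one (t : ℂ) : thetaProd τ (t + 1) = thetaProd τ t := by
  rw [thetaProd, thetaProd, ← sub_sub, expTwoPi_add, expTwoPi_sub (τ - t), expTwoPi_one]
  simp

/-- Translation by `τ` moves one linear factor from one product to the other, and `1 - u⁻¹ = -u⁻¹ (1
- u)` gives the multiplier. -/
theorem thetaProd_add_self (hτ : 0 < τ.im) (t : ℂ) :
    thetaProd τ (t + τ) = -expTwoPi (-t) * thetaProd τ t := by
  have h1 := qProd_eq (norm_expTwoPi_lt_one hτ) (expTwoPi (-t))
  rw [← expTwoPi_add, ← sub_eq_add_neg] at h1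
  have h2 : (1 - expTwoPi (-t)) = -expTwoPi (-t) * (1 - expTwoPi t) := by
    rw [expTwoPi_neg]
    field_simp [expTwoPi_ne_zero t]
    ring
  rw [thetaProd_eq hτ t, thetaProd, add_comm t τ, sub_add_cancel_left, h1, h2]
  ring

theorem thetaProd_ne_zero (hτ : 0 < τ.im) {t : ℂ} (ht : t ∉ lattice τ) : thetaProd τ t ≠ 0 := by
  have hq := norm_expTwoPi_lt_one hτ
  refine mul_ne_zero (qProd_ne_zero hq fun n hn => ht ?_) (qProd_ne_zero hq fun n hn => ht ?_)
  · rw [← zpow_natCast, ← expTwoPi_int_mul, ← expTwoPi_add, expTwoPi_eq_one_iff] at hn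
    obtain ⟨k, hk⟩ := hn
    exact ⟨k, -n, by push_cast at hk ⊢; linear_combination hk⟩
  · rw [← zpow_natCast, ← expTwoPi_int_mul, ← expTwoPi_add, expTwoPi_eq_one_iff] at hn
    obtain ⟨k, hk⟩ := hn
    exact ⟨-k, n + 1, by push_cast at hk ⊢; linear_combination -hk⟩

theorem differentiable_thetaProd (hτ : 0 < τ.im) : Differentiable ℂ (thetaProd τ) := by
  have h := differentiable_qProd (norm_expTwoPi_lt_one hτ)
  exact (h.comp differentiable_expTwoPi).mul
    (h.comp (differentiable_expTwoPi.comp (differentiable_id.const_sub τ)))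

theorem thetaProd_zero (hτ : 0 < τ.im) : thetaProd τ 0 = 0 := by
  rw [thetaProd_eq hτ, expTwoPi_zero]; ring

/-- The zero at `0` is simple: the derivative of `1 - expTwoPi t` there is `-2 π i`, and the
cofactor is the square of `∏ (1 - q ^ (n + 1))`, which is non-zero because `‖q‖ < 1`. -/
theorem exists_hasDerivAt_thetaProd (hτ : 0 < τ.im) :
    ∃ d ≠ 0, HasDerivAt (thetaProd τ) d 0 := by
  have hq := norm_expTwoPi_lt_one hτ
  have h := differentiable_qProd hq
  have h1 : DifferentiableAt ℂ (fun t => qProd (expTwoPi τ) (expTwoPi (τ + t)) *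
      qProd (expTwoPi τ) (expTwoPi (τ - t))) 0 :=
    ((h.comp (differentiable_expTwoPi.comp (differentiable_id.const_add τ))).mul
      (h.comp (differentiable_expTwoPi.comp (differentiable_id.const_sub τ)))) 0
  have h2 := ((hasDerivAt_expTwoPi 0).const_sub 1).mul h1.hasDerivAt
  have h3 : qProd (expTwoPi τ) (expTwoPi τ) ≠ 0 := qProd_ne_zero hq fun n hn => by
    have h4 : ‖expTwoPi τ ^ n * expTwoPi τ‖ < 1 := by
      rw [← pow_succ, norm_pow]
      exact pow_lt_one₀ (norm_nonneg _) hq (by simp)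
    rw [hn, norm_one] at h4
    exact lt_irrefl _ h4
  refine ⟨_, ?_, h2.congr_of_eventuallyEq (Eventually.of_forall fun t => thetaProd_eq hτ t)⟩
  simp [expTwoPi_zero, h3, Real.pi_ne_zero]

theorem thetaProd_eq_zero (hτ : 0 < τ.im) {t : ℂ} (ht : t ∈ lattice τ) : thetaProd τ t = 0 := by
  obtain ⟨r, m, rfl⟩ := ht
  have e : ∀ s : ℤ, thetaProd τ (s * τ) = 0 := by
    intro s
    induction s using Int.induction_on with
    | zero => simpa using thetaProd_zero hτ
    | succ i ih =>
      push_cast at ih ⊢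
      rw [add_mul, one_mul, thetaProd_add_self hτ, ih, mul_zero]
    | pred i ih =>
      have h := thetaProd_add_self hτ ((-(i : ℤ) - 1 : ℤ) * τ)
      rw [show ((-(i : ℤ) - 1 : ℤ) * τ + τ) = ((-(i : ℤ) : ℤ) * τ : ℂ) by push_cast; ring, ih] at h
      exact (mul_eq_zero.1 h.symm).resolve_left (neg_ne_zero.2 (expTwoPi_ne_zero _))
  have h := (show Function.Periodic (thetaProd τ) 1 from thetaProd_add_one).int_mul r (m * τ)
  rw [mul_one] at h
  rw [add_comm, h, e]

theorem tendsto_sub_nhdsNE (a t : ℂ) : Tendsto (fun s => s - a) (𝓝[≠] t) (𝓝[≠] (t - a)) := by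
  refine tendsto_nhdsWithin_iff.2 ⟨?_, ?_⟩
  · exact (Continuous.tendsto (by fun_prop : Continuous fun s => s - a) t).mono_left
      nhdsWithin_le_nhds
  · filter_upwards [self_mem_nhdsWithin] with s hs
    exact fun h => hs (sub_left_injective h)

theorem tendsto_add_nhdsNE (a t : ℂ) : Tendsto (fun s => s + a) (𝓝[≠] t) (𝓝[≠] (t + a)) := by
  simpa using tendsto_sub_nhdsNE (-a) t

/-- Lattice points are isolated. -/
theorem eventually_notMem_lattice (hτ : 0 < τ.im) (t : ℂ) : ∀ᶠ s in 𝓝[≠] t, s ∉ lattice τ := by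
  -- `thetaProd` vanishes on the lattice. At a lattice point, translated to `0`, its non-zero
  -- derivative isolates the zero; elsewhere it is non-zero and continuity suffices.
  by_cases ht : t ∈ lattice τ
  · obtain ⟨d, hd, h⟩ := exists_hasDerivAt_thetaProd hτ
    have h1 : ∀ᶠ s in 𝓝[≠] (t - t), s ∉ lattice τ := by
      rw [sub_self]
      filter_upwards [h.eventually_ne hd (c := 0)] with s hs hs'
      exact hs (thetaProd_eq_zero hτ hs')
    filter_upwards [(tendsto_sub_nhdsNE t t).eventually h1] with s hs hs'
    exact hs (by simpa [sub_eq_add_neg] using add_mem_lattice hs' (neg_mem_lattice ht))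
  · have h1 := (differentiable_thetaProd hτ t).continuousAt.eventually_ne (thetaProd_ne_zero hτ ht)
    exact (h1.mono fun s hs hs' => hs (thetaProd_eq_zero hτ hs')).filter_mono nhdsWithin_le_nhds

/-! ### Quasi-periodic functions -/

variable {n : ℕ} {c : Conf n}

theorem add_mem_fibreRegular_iff {a : ℂ} (ha : a ∈ lattice c.2) (t : ℂ) :
    t + a ∈ fibreRegular c ↔ t ∈ fibreRegular c := by
  refine forall_congr' fun i => not_congr ?_
  rw [add_sub_right_comm, add_mem_lattice_iff ha]

theorem eventually_mem_fibreRegular (hτ : 0 < c.2.im) (t : ℂ) :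
    ∀ᶠ s in 𝓝[≠] t, s ∈ fibreRegular c :=
  eventually_all.2 fun i => (tendsto_sub_nhdsNE (c.1 i) t).eventually
    (eventually_notMem_lattice hτ (t - c.1 i))

theorem isOpen_fibreRegular (hτ : 0 < c.2.im) : IsOpen (fibreRegular c) := by
  rw [isOpen_iff_mem_nhds]
  intro t ht
  have h := eventually_nhdsWithin_iff.1 (eventually_mem_fibreRegular hτ t)
  filter_upwards [h] with s hs
  by_cases h : s = t
  · rwa [h]
  · exact hs h

/-- Meromorphic functions with multipliers `1` and `exp (2 π i w)`, regular away from the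
translates of the points of `c`, with poles of order at most `j` at these points. -/
structure QuasiPeriodic (c : Conf n) (w : ℂ) (j : ℕ) (f : ℂ → ℂ) : Prop where
  differentiableAt : ∀ t ∈ fibreRegular c, DifferentiableAt ℂ f t
  add_one : ∀ t ∈ fibreRegular c, f (t + 1) = f t
  add_self : ∀ t ∈ fibreRegular c, f (t + c.2) = expTwoPi w * f t
  tendsto : ∀ i, ∃ a, Tendsto (fun t => (t - c.1 i) ^ j * f t) (𝓝[≠] c.1 i) (𝓝 a)

namespace QuasiPeriodic

variable {w : ℂ} {j : ℕ} {f g : ℂ → ℂ}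

theorem add (hf : QuasiPeriodic c w j f) (hg : QuasiPeriodic c w j g) :
    QuasiPeriodic c w j (fun t => f t + g t) where
  differentiableAt t ht := (hf.differentiableAt t ht).add (hg.differentiableAt t ht)
  add_one t ht := by rw [hf.add_one t ht, hg.add_one t ht]
  add_self t ht := by rw [hf.add_self t ht, hg.add_self t ht, mul_add]
  tendsto i := by
    obtain ⟨a, ha⟩ := hf.tendsto i
    obtain ⟨b, hb⟩ := hg.tendsto i
    exact ⟨a + b, (ha.add hb).congr fun t => by ring⟩

theorem const_mul (k : ℂ) (hf : QuasiPeriodic c w j f) : QuasiPeriodic c w j (fun t => k * f t) where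
  differentiableAt t ht := (hf.differentiableAt t ht).const_mul k
  add_one t ht := by rw [hf.add_one t ht]
  add_self t ht := by rw [hf.add_self t ht]; ring
  tendsto i := by
    obtain ⟨a, ha⟩ := hf.tendsto i
    exact ⟨k * a, (ha.const_mul k).congr fun t => by ring⟩

theorem sub (hf : QuasiPeriodic c w j f) (hg : QuasiPeriodic c w j g) :
    QuasiPeriodic c w j (fun t => f t - g t) := by
  simpa [sub_eq_add_neg] using hf.add (hg.const_mul (-1))

theorem zero : QuasiPeriodic c w j (fun _ => 0) where
  differentiableAt _ _ := differentiableAt_const 0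
  add_one _ _ := rfl
  add_self _ _ := (mul_zero _).symm
  tendsto _ := ⟨0, by simp⟩

theorem sum {ι : Type*} (s : Finset ι) {f : ι → ℂ → ℂ}
    (hf : ∀ i ∈ s, QuasiPeriodic c w j (f i)) : QuasiPeriodic c w j (fun t => ∑ i ∈ s, f i t) := by
  classical
  induction s using Finset.induction_on with
  | empty => simpa using zero
  | insert a s ha ih =>
    simp only [Finset.sum_insert ha]
    exact (hf a (Finset.mem_insert_self a s)).add
      (ih fun i hi => hf i (Finset.mem_insert_of_mem hi))

theorem mono {k : ℕ} (hf : QuasiPeriodic c w j f) (h : j ≤ k) : QuasiPeriodic c w k f where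
  differentiableAt := hf.differentiableAt
  add_one := hf.add_one
  add_self := hf.add_self
  tendsto i := by
    obtain ⟨a, ha⟩ := hf.tendsto i
    obtain ⟨d, rfl⟩ := Nat.exists_eq_add_of_le h
    have h1 : Tendsto (fun t : ℂ => (t - c.1 i) ^ d) (𝓝[≠] c.1 i) (𝓝 ((c.1 i - c.1 i) ^ d)) :=
      (Continuous.tendsto (by fun_prop) _).mono_left nhdsWithin_le_nhds
    exact ⟨_, (h1.mul ha).congr fun t => by ring⟩

/-- If the leading coefficients vanish, the order of the poles is smaller. -/
theorem of_tendsto_zero (hτ : 0 < c.2.im) (hf : QuasiPeriodic c w (j + 1) f)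
    (h : ∀ i, Tendsto (fun t => (t - c.1 i) ^ (j + 1) * f t) (𝓝[≠] c.1 i) (𝓝 0)) :
    QuasiPeriodic c w j f where
  differentiableAt := hf.differentiableAt
  add_one := hf.add_one
  add_self := hf.add_self
  tendsto i := by
    refine exists_tendsto_of_sub_mul_tendsto_zero ?_ ((h i).congr fun t => by ring)
    filter_upwards [eventually_mem_fibreRegular hτ (c.1 i)] with t ht
    exact DifferentiableAt.mul (by fun_prop) (hf.differentiableAt t ht)

/-- Values off the regular set do not matter: that set is open, stable under the two translations,
and contains a punctured neighbourhood of every pole. -/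
theorem congr (hτ : 0 < c.2.im) (hf : QuasiPeriodic c w j f) (h : Set.EqOn g f (fibreRegular c)) :
    QuasiPeriodic c w j g where
  differentiableAt t ht := (hf.differentiableAt t ht).congr_of_eventuallyEq
    (h.eventuallyEq_of_mem ((isOpen_fibreRegular hτ).mem_nhds ht))
  add_one t ht := by
    rw [h ((add_mem_fibreRegular_iff (one_mem_lattice _) t).2 ht), h ht, hf.add_one t ht]
  add_self t ht := by
    rw [h ((add_mem_fibreRegular_iff (self_mem_lattice _) t).2 ht), h ht, hf.add_self t ht]
  tendsto i := by
    obtain ⟨a, ha⟩ := hf.tendsto i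
    refine ⟨a, ha.congr' ?_⟩
    filter_upwards [eventually_mem_fibreRegular hτ (c.1 i)] with t ht
    rw [h ht]

/-- Induction in both directions; going down requires dividing by the multiplier `μ`. -/
theorem add_int_mul {a μ : ℂ} (ha : a ∈ lattice c.2) (hμ : μ ≠ 0)
    (h : ∀ t ∈ fibreRegular c, f (t + a) = μ * f t) (s : ℤ) {t : ℂ} (ht : t ∈ fibreRegular c) :
    f (t + s * a) = μ ^ s * f t := by
  have hmem : ∀ s : ℤ, t + s * a ∈ fibreRegular c := by
    intro s
    obtain ⟨r, m, rfl⟩ := ha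
    exact (add_mem_fibreRegular_iff ⟨s * r, s * m, by push_cast; ring⟩ t).2 ht
  induction s using Int.induction_on with
  | zero => simp
  | succ i ih =>
    have h1 := h _ (hmem i)
    push_cast at ih h1 ⊢
    rw [add_mul, one_mul, ← add_assoc, h1, ih, zpow_add_one₀ hμ]
    ring
  | pred i ih =>
    have h1 := h _ (hmem (-(i : ℤ) - 1))
    have e : t + ((-(i : ℤ) - 1 : ℤ) : ℂ) * a + a = t + ((-(i : ℤ) : ℤ) : ℂ) * a := by
      push_cast; ring
    rw [e, ih] at h1
    rw [zpow_sub_one₀ hμ, mul_assoc, mul_comm μ⁻¹, ← mul_assoc, h1]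
    field_simp

theorem add_lattice (hf : QuasiPeriodic c w j f) (r s : ℤ) {t : ℂ} (ht : t ∈ fibreRegular c) :
    f (t + r + s * c.2) = expTwoPi w ^ s * f t := by
  rw [add_int_mul (self_mem_lattice _) (expTwoPi_ne_zero w) hf.add_self s
    ((add_mem_fibreRegular_iff (int_mem_lattice _ r) t).2 ht)]
  have := add_int_mul (f := f) (one_mem_lattice _) one_ne_zero
    (fun t ht => by rw [hf.add_one t ht, one_mul]) r ht
  rw [mul_one, one_zpow, one_mul] at this
  rw [this]

/-- The behaviour at all translates of the points of `c`. -/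
theorem tendsto_translate (hτ : 0 < c.2.im) (hf : QuasiPeriodic c w j f) (i : Fin n) (r s : ℤ) :
    ∃ a, Tendsto (fun t => (t - c.1 i - r - s * c.2) ^ j * f t) (𝓝[≠] (c.1 i + r + s * c.2))
      (𝓝 a) := by
  obtain ⟨a, ha⟩ := hf.tendsto i
  refine ⟨expTwoPi w ^ s * a, ?_⟩
  have h1 := tendsto_sub_nhdsNE (r + s * c.2) (c.1 i + r + s * c.2)
  rw [add_assoc, add_sub_cancel_right, ← add_assoc] at h1
  refine ((ha.comp h1).const_mul (expTwoPi w ^ s)).congr' ?_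
  filter_upwards [h1.eventually (eventually_mem_fibreRegular hτ (c.1 i))] with t ht
  have h2 := hf.add_lattice r s ht
  rw [show t - (r + s * c.2) + r + s * c.2 = t by ring] at h2
  rw [h2, Function.comp_apply]
  ring

/-- Quasi-periodic functions without poles extend to entire functions. -/
theorem exists_entire (hτ : 0 < c.2.im) (hf : QuasiPeriodic c w 0 f) :
    ∃ g : ℂ → ℂ, Differentiable ℂ g ∧ Set.EqOn f g (fibreRegular c) ∧ (∀ t, g (t + 1) = g t) ∧
      ∀ t, g (t + c.2) = expTwoPi w * g t := by
  -- The entire extension is the punctured limit at every point. Functional equations, known on the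
  -- dense regular set, then pass to it by uniqueness of limits.
  have hlim : ∀ t, Tendsto f (𝓝[≠] t) (𝓝 (limUnder (𝓝[≠] t) f)) := by
    intro t
    refine tendsto_nhds_limUnder ?_
    by_cases ht : t ∈ fibreRegular c
    · exact ⟨f t, (hf.differentiableAt t ht).continuousAt.tendsto.mono_left nhdsWithin_le_nhds⟩
    · obtain ⟨i, hi⟩ := not_forall.1 ht
      obtain ⟨r, s, hrs⟩ := not_not.1 hi
      obtain ⟨a, ha⟩ := hf.tendsto_translate hτ i r s
      rw [show t = c.1 i + r + s * c.2 by linear_combination hrs]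
      exact ⟨a, by simpa using ha⟩
  have heq : Set.EqOn f (fun t => limUnder (𝓝[≠] t) f) (fibreRegular c) := fun t ht =>
    tendsto_nhds_unique ((hf.differentiableAt t ht).continuousAt.tendsto.mono_left
      nhdsWithin_le_nhds) (hlim t)
  have hev : ∀ t, f =ᶠ[𝓝[≠] t] fun t => limUnder (𝓝[≠] t) f := fun t => by
    filter_upwards [eventually_mem_fibreRegular hτ t] with s hs using heq hs
  refine ⟨fun t => limUnder (𝓝[≠] t) f, fun t => ?_, heq, fun t => ?_, fun t => ?_⟩
  · refine (Complex.analyticAt_of_differentiable_on_punctured_nhds_of_continuousAt ?_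
      ?_).differentiableAt
    · filter_upwards [eventually_mem_fibreRegular hτ t] with s hs
      exact (hf.differentiableAt s hs).congr_of_eventuallyEq
        (heq.eventuallyEq_of_mem ((isOpen_fibreRegular hτ).mem_nhds hs)).symm
    · exact continuousAt_iff_punctured_nhds.2 ((hlim t).congr' (hev t))
  · refine tendsto_nhds_unique (((hlim (t + 1)).comp (tendsto_add_nhdsNE 1 t))) ((hlim t).congr' ?_)
    filter_upwards [eventually_mem_fibreRegular hτ t] with s hs using (hf.add_one s hs).symm
  · refine tendsto_nhds_unique (((hlim (t + c.2)).comp (tendsto_add_nhdsNE c.2 t)))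
      (((hlim t).const_mul (expTwoPi w)).congr' ?_)
    filter_upwards [eventually_mem_fibreRegular hτ t] with s hs using (hf.add_self s hs).symm

end QuasiPeriodic

/-! ### Liouville's theorem -/

/-- A continuous function with unimodular multipliers is bounded. -/
theorem exists_bound_of_norm_periodic (hτ : 0 < τ.im) {g : ℂ → ℂ} (hg : Continuous g)
    (h1 : ∀ t, ‖g (t + 1)‖ = ‖g t‖) (h2 : ∀ t, ‖g (t + τ)‖ = ‖g t‖) : ∃ M, ∀ t, ‖g t‖ ≤ M := by
  obtain ⟨M, hM⟩ := (isCompact_Icc (a := (0 : ℝ × ℝ)) (b := 1)).exists_bound_of_continuousOn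
    (f := fun p : ℝ × ℝ => g (p.1 + p.2 * τ)) (by fun_prop)
  refine ⟨M, fun t => ?_⟩
  have e1 : ∀ (r : ℤ) t, ‖g (t + r)‖ = ‖g t‖ := fun r t => by
    have := (show Function.Periodic (fun t => ‖g t‖) 1 from h1).int_mul r t
    simpa using this
  have e2 : ∀ (s : ℤ) t, ‖g (t + s * τ)‖ = ‖g t‖ := fun s t =>
    (show Function.Periodic (fun t => ‖g t‖) τ from h2).int_mul s t
  -- These are the real coordinates of `t` in the basis `1, τ`; their fractional parts give a
  -- representative in the compact parallelogram.
  set y : ℝ := t.im / τ.im with hy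
  set x : ℝ := t.re - y * τ.re with hx
  have ht : t = x + y * τ := by
    apply Complex.ext
    · simp [hx]
    · simp [hy, hτ.ne']
  have h3 := hM (Int.fract x, Int.fract y)
    ⟨⟨Int.fract_nonneg x, Int.fract_nonneg y⟩, ⟨(Int.fract_lt_one x).le, (Int.fract_lt_one y).le⟩⟩
  have h4 : t = (Int.fract x : ℝ) + (Int.fract y : ℝ) * τ + (⌊x⌋ : ℤ) + (⌊y⌋ : ℤ) * τ := by
    rw [ht, Int.fract, Int.fract]
    push_cast
    ring
  rw [h4, e2, e1]
  exact h3

/-- An entire elliptic function is constant. -/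
theorem eq_of_elliptic (hτ : 0 < τ.im) {g : ℂ → ℂ} (hg : Differentiable ℂ g)
    (h1 : ∀ t, g (t + 1) = g t) (h2 : ∀ t, g (t + τ) = g t) (s t : ℂ) : g s = g t := by
  obtain ⟨M, hM⟩ := exists_bound_of_norm_periodic hτ hg.continuous (fun t => by rw [h1])
    (fun t => by rw [h2])
  exact hg.apply_eq_apply_of_bounded
    (isBounded_iff_forall_norm_le.2 ⟨M, by rintro _ ⟨t, rfl⟩; exact hM t⟩) s t

/-- An entire function with multipliers `1` and `exp (2 π i w)` vanishes unless `w` is in the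
lattice. -/
theorem eq_zero_of_entire {w : ℂ} (hτ : 0 < τ.im) (hw : w ∉ lattice τ) {g : ℂ → ℂ}
    (hg : Differentiable ℂ g) (h1 : ∀ t, g (t + 1) = g t)
    (h2 : ∀ t, g (t + τ) = expTwoPi w * g t) (t : ℂ) : g t = 0 := by
  -- With this real `b`, both multipliers of `expTwoPi (-(b t)) * g t` have absolute value one, so
  -- that function is bounded and hence constant.
  set b : ℝ := w.im / τ.im with hb
  have hn : ‖expTwoPi (-(b * τ))‖ * ‖expTwoPi w‖ = 1 := by
    rw [norm_expTwoPi, norm_expTwoPi, ← Real.exp_add, Real.exp_eq_one_iff]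
    simp [hb, hτ.ne']
  have hb1 : ∀ t, expTwoPi (-(b * (t + 1))) * g (t + 1) =
      expTwoPi (-b) * (expTwoPi (-(b * t)) * g t) := fun t => by
    rw [h1, mul_add, neg_add, mul_one, expTwoPi_add]; ring
  have hb2 : ∀ t, expTwoPi (-(b * (t + τ))) * g (t + τ) =
      expTwoPi (-(b * τ)) * expTwoPi w * (expTwoPi (-(b * t)) * g t) := fun t => by
    rw [h2, mul_add, neg_add, expTwoPi_add]; ring
  have hd : Differentiable ℂ fun t => expTwoPi (-(b * t)) * g t :=
    (differentiable_expTwoPi.comp (f := fun t : ℂ => -((b : ℂ) * t)) (by fun_prop)).mul hg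
  obtain ⟨M, hM⟩ := exists_bound_of_norm_periodic hτ hd.continuous
    (fun t => by rw [hb1, norm_mul, norm_expTwoPi]; simp)
    (fun t => by rw [hb2, norm_mul, norm_mul, hn, one_mul])
  have hc := hd.apply_eq_apply_of_bounded
    (isBounded_iff_forall_norm_le.2 ⟨M, by rintro _ ⟨t, rfl⟩; exact hM t⟩)
  -- A non-zero constant forces both multipliers to be `1`. Then `b` is an integer and `w - b τ` is
  -- an integer, so `w` is in the lattice.
  by_contra ht
  have hne : expTwoPi (-(b * t)) * g t ≠ 0 := mul_ne_zero (expTwoPi_ne_zero _) ht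
  have e1 : expTwoPi (-b) = 1 := by
    have := hb1 t
    rw [hc (t + 1) t] at this
    exact (mul_eq_right₀ hne).1 this.symm
  have e2 : expTwoPi (-(b * τ) + w) = 1 := by
    have := hb2 t
    rw [hc (t + τ) t, ← expTwoPi_add] at this
    exact (mul_eq_right₀ hne).1 this.symm
  obtain ⟨k, hk⟩ := expTwoPi_eq_one_iff.1 e1
  obtain ⟨l, hl⟩ := expTwoPi_eq_one_iff.1 e2
  exact hw ⟨l, -k, by push_cast; linear_combination hl - τ * hk⟩

end

noncomputable section

open Complex (I)

/-! ### The theta function -/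

/-- Expanding the square `(m + 1/2) ^ 2` separates a factor independent of `m` and leaves the
two-variable theta series at `t + 1/2 + τ/2`. -/
theorem theta1_eq (t τ : ℂ) : theta1 t τ =
    -(Complex.exp (Real.pi * I * (t + 1 / 2 + τ / 4)) * jacobiTheta₂ (t + 1 / 2 + τ / 2) τ) := by
  rw [theta1, jacobiTheta₂, ← tsum_mul_left]
  refine congrArg _ (tsum_congr fun m => ?_)
  rw [jacobiTheta₂_term, ← Complex.exp_add]
  ring_nf

variable {τ : ℂ}

theorem theta1_add_one (t : ℂ) : theta1 (t + 1) τ = -theta1 t τ := by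
  rw [theta1_eq, theta1_eq, show t + 1 + 1 / 2 + τ / 2 = t + 1 / 2 + τ / 2 + 1 by ring,
    jacobiTheta₂_add_left, show (Real.pi * I * (t + 1 + 1 / 2 + τ / 4) : ℂ) =
      Real.pi * I * (t + 1 / 2 + τ / 4) + Real.pi * I by ring, Complex.exp_add, Complex.exp_pi_mul_I]
  ring

theorem theta1_add_self (t : ℂ) :
    theta1 (t + τ) τ = -(Complex.exp (-(Real.pi * I * τ)) * expTwoPi (-t)) * theta1 t τ := by
  have e : Complex.exp (Real.pi * I * (t + τ + 1 / 2 + τ / 4)) *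
      Complex.exp (-Real.pi * I * (τ + 2 * (t + 1 / 2 + τ / 2))) =
      -(Complex.exp (-(Real.pi * I * τ)) * expTwoPi (-t)) *
        Complex.exp (Real.pi * I * (t + 1 / 2 + τ / 4)) := by
    have h : Complex.exp (-(Real.pi * I)) = -1 := by
      rw [Complex.exp_neg, Complex.exp_pi_mul_I]; norm_num
    rw [show ∀ A B C : ℂ, -(A * B) * C = Complex.exp (-(Real.pi * I)) * A * B * C from
      fun A B C => by rw [h]; ring, expTwoPi]
    simp only [← Complex.exp_add]
    congr 1
    ring
  rw [theta1_eq, theta1_eq, show t + τ + 1 / 2 + τ / 2 = t + 1 / 2 + τ / 2 + τ by ring,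
    jacobiTheta₂_add_left', ← mul_assoc, e]
  ring

/-- The half period `1/2 + τ/2` goes to its negative under reflection and returns by the
translations `1` and `τ`, whose total factor is `-1`; so the theta series vanishes there. -/
theorem theta1_zero : theta1 0 τ = 0 := by
  have h := jacobiTheta₂_add_left' (-(1 / 2 + τ / 2) + 1) τ
  rw [jacobiTheta₂_add_left, jacobiTheta₂_neg_left,
    show -(1 / 2 + τ / 2) + 1 + τ = 1 / 2 + τ / 2 by ring,
    show -Real.pi * I * (τ + 2 * (-(1 / 2 + τ / 2) + 1)) = -(Real.pi * I) by ring,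
    Complex.exp_neg, Complex.exp_pi_mul_I] at h
  have h0 : jacobiTheta₂ (1 / 2 + τ / 2) τ = 0 := by linear_combination h / 2
  rw [theta1_eq, zero_add, h0]
  simp

theorem differentiableAt_theta1 {p : ℂ × ℂ} (hp : 0 < p.2.im) :
    DifferentiableAt ℂ (fun p : ℂ × ℂ => theta1 p.1 p.2) p := by
  simp only [theta1_eq]
  have h := (hasFDerivAt_jacobiTheta₂ (p.1 + 1 / 2 + p.2 / 2) hp).differentiableAt
  have h2 : DifferentiableAt ℂ (fun p : ℂ × ℂ => jacobiTheta₂ (p.1 + 1 / 2 + p.2 / 2) p.2) p :=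
    h.comp p (f := fun p : ℂ × ℂ => (p.1 + 1 / 2 + p.2 / 2, p.2)) (by fun_prop)
  fun_prop

theorem differentiable_theta1 (hτ : 0 < τ.im) : Differentiable ℂ fun t => theta1 t τ :=
  fun t => (differentiableAt_theta1 (p := (t, τ)) hτ).comp t (f := fun t : ℂ => (t, τ))
    (by fun_prop)

/-- The constant Fourier coefficient of the two-variable theta series on `[0, 1]` is `1`, by
termwise integration, so the series is not identically zero. -/
theorem exists_theta1_ne_zero (hτ : 0 < τ.im) : ∃ t, theta1 t τ ≠ 0 := by
  by_contra! h
  have h0 : ∀ z, jacobiTheta₂ z τ = 0 := fun z => by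
    have h1 := h (z - 1 / 2 - τ / 2)
    rw [theta1_eq, neg_eq_zero, mul_eq_zero] at h1
    have h2 := h1.resolve_left (Complex.exp_ne_zero _)
    rwa [show z - 1 / 2 - τ / 2 + 1 / 2 + τ / 2 = z by ring] at h2
  have hc : ∀ m : ℤ, Continuous fun x : ℝ => jacobiTheta₂_term m x τ := fun m => by
    unfold jacobiTheta₂_term; fun_prop
  have hs := intervalIntegral.hasSum_intervalIntegral_of_summable_norm (a := 0) (b := 1)
    (f := fun m : ℤ => (⟨fun x : ℝ => jacobiTheta₂_term m x τ, hc m⟩ : C(ℝ, ℂ))) (by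
      refine Summable.of_nonneg_of_le (fun m => norm_nonneg _) (fun m => ?_)
        ((summable_jacobiTheta₂_term_iff 0 τ).2 hτ).norm
      refine (ContinuousMap.norm_le _ (norm_nonneg _)).2 fun x => ?_
      simp [norm_jacobiTheta₂_term])
  have h1 : ∀ m : ℤ, ∫ x : ℝ in (0 : ℝ)..1, jacobiTheta₂_term m x τ = if m = 0 then 1 else 0 := by
    intro m
    split_ifs with hm
    · simp [hm, jacobiTheta₂_term]
    · have hk : (2 * Real.pi * I * m : ℂ) ≠ 0 :=
        mul_ne_zero Complex.two_pi_I_ne_zero (Int.cast_ne_zero.2 hm)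
      have h2 := integral_exp_mul_complex (a := 0) (b := 1) hk
      have h3 : Complex.exp (2 * Real.pi * I * m * (1 : ℝ)) = 1 := by
        have := expTwoPi_int m
        rw [expTwoPi] at this
        simpa using this
      rw [h3, Complex.ofReal_zero, mul_zero, Complex.exp_zero, sub_self, zero_div] at h2
      simp only [jacobiTheta₂_term, Complex.exp_add, intervalIntegral.integral_mul_const, h2,
        zero_mul]
  simp only [ContinuousMap.coe_mk, h1] at hs
  have h2 : ∀ x : ℝ, ∑' m : ℤ, jacobiTheta₂_term m x τ = 0 := fun x => h0 x
  simp only [h2, intervalIntegral.integral_zero] at hs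
  exact one_ne_zero ((hasSum_ite_eq (0 : ℤ) (1 : ℂ)).unique hs)

/-- Both sides have the multipliers `1` and `-expTwoPi (-t)`. The product has only lattice zeros,
and its simple zero at `0` is cancelled by that of `θ₁`, so the quotient extends to an entire
elliptic function and is constant. The value of the constant is not needed. -/
theorem theta1_eq_mul_thetaProd (hτ : 0 < τ.im) :
    ∃ C ≠ 0, ∀ t, Complex.exp (Real.pi * I * t) * theta1 t τ = C * thetaProd τ t := by
  -- A configuration with the single point `0` turns the quotient into an instance of
  -- `QuasiPeriodic`.
  set c : Conf 1 := (fun _ => 0, τ) with hc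
  have hreg : ∀ t, t ∈ fibreRegular c ↔ t ∉ lattice τ := fun t => by
    simp [fibreRegular, hc]
  set f : ℂ → ℂ := fun t => Complex.exp (Real.pi * I * t) * theta1 t τ / thetaProd τ t with hf
  have hnum : Differentiable ℂ fun t => Complex.exp (Real.pi * I * t) * theta1 t τ :=
    Differentiable.mul (by fun_prop) (differentiable_theta1 hτ)
  have hlim : Tendsto (fun t => (t - 0) ^ (0 + 1) * f t) (𝓝[≠] 0) (𝓝 0) := by
    obtain ⟨d, hd, hP⟩ := exists_hasDerivAt_thetaProd hτ
    have h1 := (hasDerivAt_iff_tendsto_slope.1 hP).inv₀ hd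
    have h2 : Tendsto (fun t => Complex.exp (Real.pi * I * t) * theta1 t τ) (𝓝[≠] 0) (𝓝 0) := by
      have := (hnum 0).continuousAt.tendsto
      rw [theta1_zero, mul_zero] at this
      exact this.mono_left nhdsWithin_le_nhds
    have h3 := h2.mul h1
    rw [zero_mul] at h3
    refine h3.congr fun t => ?_
    rw [slope_def_field, thetaProd_zero hτ, hf]
    simp only [sub_zero, inv_div]
    ring
  have hQ : QuasiPeriodic c 0 (0 + 1) f := by
    refine ⟨fun t ht => ?_, fun t ht => ?_, fun t ht => ?_, fun i => ⟨0, hlim⟩⟩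
    · exact (hnum t).div (differentiable_thetaProd hτ t) (thetaProd_ne_zero hτ ((hreg t).1 ht))
    · simp only [hf]
      rw [theta1_add_one, thetaProd_add_one, mul_add, Complex.exp_add, mul_one,
        Complex.exp_pi_mul_I]
      ring
    · simp only [hf, hc]
      rw [theta1_add_self, thetaProd_add_self hτ, mul_add, Complex.exp_add, expTwoPi_zero,
        Complex.exp_neg, one_mul]
      have h1 := Complex.exp_ne_zero (Real.pi * I * τ)
      have h2 := expTwoPi_ne_zero (-t)
      have h3 := thetaProd_ne_zero hτ ((hreg t).1 ht)
      field_simp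
  obtain ⟨g, hg, hfg, hg1, hg2⟩ := (hQ.of_tendsto_zero hτ fun i => hlim).exists_entire hτ
  have hconst := eq_of_elliptic hτ hg hg1 (by simpa [expTwoPi_zero] using hg2)
  have hoff : ∀ t, t ∉ lattice τ →
      Complex.exp (Real.pi * I * t) * theta1 t τ = g 0 * thetaProd τ t := fun t ht => by
    have h1 := hfg ((hreg t).2 ht)
    rw [hconst t 0, hf] at h1
    exact (div_eq_iff (thetaProd_ne_zero hτ ht)).1 h1
  have hall : ∀ t, Complex.exp (Real.pi * I * t) * theta1 t τ = g 0 * thetaProd τ t := fun t => by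
    refine tendsto_nhds_unique (l := 𝓝[≠] t)
      ((hnum t).continuousAt.tendsto.mono_left nhdsWithin_le_nhds)
      (Tendsto.congr' ?_ (((differentiable_thetaProd hτ t).continuousAt.tendsto.const_mul
        (g 0)).mono_left nhdsWithin_le_nhds))
    filter_upwards [eventually_notMem_lattice hτ t] with s hs using (hoff s hs).symm
  refine ⟨g 0, fun h0 => ?_, hall⟩
  obtain ⟨t, ht⟩ := exists_theta1_ne_zero hτ
  have h1 := hall t
  rw [h0, zero_mul, mul_eq_zero] at h1
  exact ht (h1.resolve_left (Complex.exp_ne_zero _))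

theorem theta1_eq_zero_iff (hτ : 0 < τ.im) {t : ℂ} : theta1 t τ = 0 ↔ t ∈ lattice τ := by
  obtain ⟨C, hC, h⟩ := theta1_eq_mul_thetaProd hτ
  have h1 := h t
  constructor
  · intro h0
    by_contra ht
    rw [h0, mul_zero] at h1
    exact mul_ne_zero hC (thetaProd_ne_zero hτ ht) h1.symm
  · intro ht
    rw [thetaProd_eq_zero hτ ht, mul_zero, mul_eq_zero] at h1
    exact h1.resolve_left (Complex.exp_ne_zero _)

theorem deriv_theta1_zero_ne_zero (hτ : 0 < τ.im) : deriv (fun t => theta1 t τ) 0 ≠ 0 := by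
  obtain ⟨C, hC, h⟩ := theta1_eq_mul_thetaProd hτ
  obtain ⟨d, hd, hP⟩ := exists_hasDerivAt_thetaProd hτ
  have h1 : HasDerivAt (fun t : ℂ => Complex.exp (Real.pi * I * t)) _ 0 :=
    ((hasDerivAt_id (0 : ℂ)).const_mul (Real.pi * I : ℂ)).cexp
  have h2 := h1.mul (differentiable_theta1 hτ 0).hasDerivAt
  have h3 := h2.unique ((hP.const_mul C).congr_of_eventuallyEq (Eventually.of_forall h))
  intro h0
  rw [h0, theta1_zero] at h3
  simp only [mul_zero, add_zero] at h3
  exact mul_ne_zero hC hd h3.symm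

end

noncomputable section

open Complex (I)

/-! ### Derivatives of a function with a simple pole -/

/-- The difference `φ t - t⁻¹` has a removable singularity at `0`. Differentiating `t⁻¹` plus an
analytic function `m` times gives the formula. -/
theorem exists_analyticAt_iteratedDeriv_eq {φ : ℂ → ℂ}
    (hd : ∀ᶠ t in 𝓝[≠] (0 : ℂ), DifferentiableAt ℂ φ t)
    (h : Tendsto (fun t => t * φ t) (𝓝[≠] 0) (𝓝 1)) (m : ℕ) :
    ∃ g : ℂ → ℂ, AnalyticAt ℂ g 0 ∧ ∀ᶠ t in 𝓝[≠] (0 : ℂ),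
      iteratedDeriv m φ t = (-1) ^ m * m.factorial * (t ^ (m + 1))⁻¹ + g t := by
  induction m with
  | zero =>
    have hd' : ∀ᶠ t in 𝓝[≠] (0 : ℂ), DifferentiableAt ℂ (fun t => φ t - t⁻¹) t := by
      filter_upwards [hd, self_mem_nhdsWithin] with t ht h0
      exact ht.sub (differentiableAt_inv h0)
    obtain ⟨a, ha⟩ := exists_tendsto_of_sub_mul_tendsto_zero hd' (by
      have h1 := h.sub_const 1
      rw [sub_self] at h1
      refine h1.congr' ?_
      filter_upwards [self_mem_nhdsWithin] with t ht
      have : t ≠ 0 := ht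
      field_simp
      ring)
    refine ⟨Function.update (fun t => φ t - t⁻¹) 0 a, ?_, ?_⟩
    · refine Complex.analyticAt_of_differentiable_on_punctured_nhds_of_continuousAt ?_
        (continuousAt_update_same.2 ha)
      filter_upwards [hd', self_mem_nhdsWithin] with t ht h0
      refine ht.congr_of_eventuallyEq ?_
      filter_upwards [isOpen_ne.mem_nhds h0] with s hs
      exact Function.update_of_ne hs _ _
    · filter_upwards [self_mem_nhdsWithin] with t ht
      rw [Function.update_of_ne ht]
      simp
  | succ m ih =>
    obtain ⟨g, hg, hev⟩ := ih
    refine ⟨deriv g, hg.deriv, ?_⟩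
    have h1 : ∀ᶠ t in 𝓝[≠] (0 : ℂ), AnalyticAt ℂ g t :=
      hg.eventually_analyticAt.filter_mono nhdsWithin_le_nhds
    filter_upwards [eventually_eventually_nhdsWithin.2 hev, h1, self_mem_nhdsWithin] with t ht htg h0
    have h0' : t ≠ 0 := h0
    have ht' : iteratedDeriv m φ =ᶠ[𝓝 t] fun t =>
        (-1) ^ m * m.factorial * (t ^ (m + 1))⁻¹ + g t := by
      rwa [isOpen_compl_singleton.nhdsWithin_eq h0] at ht
    rw [iteratedDeriv_succ, ht'.deriv_eq]
    have h2 : HasDerivAt (fun t : ℂ => (t ^ (m + 1))⁻¹) _ t :=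
      (hasDerivAt_pow (m + 1) t).fun_inv (pow_ne_zero _ h0')
    rw [((h2.const_mul _).fun_add htg.differentiableAt.hasDerivAt).deriv, Nat.factorial_succ]
    push_cast
    field_simp
    ring

theorem tendsto_pow_mul_iteratedDeriv {φ : ℂ → ℂ}
    (hd : ∀ᶠ t in 𝓝[≠] (0 : ℂ), DifferentiableAt ℂ φ t)
    (h : Tendsto (fun t => t * φ t) (𝓝[≠] 0) (𝓝 1)) (m : ℕ) :
    Tendsto (fun t => t ^ (m + 1) * iteratedDeriv m φ t) (𝓝[≠] 0)
      (𝓝 ((-1) ^ m * m.factorial)) := by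
  obtain ⟨g, hg, hev⟩ := exists_analyticAt_iteratedDeriv_eq hd h m
  have h1 : Tendsto (fun t => (-1) ^ m * m.factorial + t ^ (m + 1) * g t) (𝓝 0)
      (𝓝 ((-1) ^ m * m.factorial + 0 ^ (m + 1) * g 0)) :=
    ((continuousAt_id.pow (m + 1)).mul hg.continuousAt).const_add _
  rw [zero_pow (Nat.succ_ne_zero m), zero_mul, add_zero] at h1
  refine (h1.mono_left nhdsWithin_le_nhds).congr' ?_
  filter_upwards [hev, self_mem_nhdsWithin] with t ht h0
  have h0' : t ≠ 0 := h0
  rw [ht]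
  field_simp

/-! ### The kernels `σ_w` and `ρ` -/

open scoped Classical in
/-- The function `σ_w` for `w ∉ ℤ`, and `ρ` for `w ∈ ℤ`. -/
def kernelFun (τ w t : ℂ) : ℂ := if ∃ k : ℤ, w = k then rho τ t else sigma τ w t

theorem kernelFun_of_int {τ w : ℂ} (h : ∃ k : ℤ, w = k) : kernelFun τ w = rho τ := by
  funext t
  exact if_pos h

theorem kernelFun_of_not_int {τ w : ℂ} (h : ¬∃ k : ℤ, w = k) : kernelFun τ w = sigma τ w := by
  funext t
  exact if_neg h

open scoped Classical in
/-- The additive constant in `φ (t + τ) = exp (2 π i w) φ t + κ` for the kernel `φ`. -/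
def kernelShift (w : ℂ) : ℂ := if ∃ k : ℤ, w = k then -(2 * Real.pi * I) else 0

variable {τ w : ℂ}

theorem rho_eq (τ t : ℂ) : rho τ t = deriv (fun u => theta1 u τ) t / theta1 t τ := rfl

theorem deriv_theta1_add_one (t : ℂ) :
    deriv (fun u => theta1 u τ) (t + 1) = -deriv (fun u => theta1 u τ) t := by
  rw [← deriv_comp_add_const, ← deriv.fun_neg]
  simp only [theta1_add_one]

theorem deriv_theta1_add_self (hτ : 0 < τ.im) (t : ℂ) :
    deriv (fun u => theta1 u τ) (t + τ) = -(Complex.exp (-(Real.pi * I * τ)) * expTwoPi (-t)) *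
      (deriv (fun u => theta1 u τ) t - 2 * Real.pi * I * theta1 t τ) := by
  rw [← deriv_comp_add_const]
  simp only [theta1_add_self]
  have h1 : HasDerivAt (fun t => expTwoPi (-t)) (2 * Real.pi * I * expTwoPi (-t) * -1) t :=
    (hasDerivAt_expTwoPi (-t)).comp t (hasDerivAt_neg t)
  have h2 := ((h1.const_mul (Complex.exp (-(Real.pi * I * τ)))).fun_neg.fun_mul
    (differentiable_theta1 hτ t).hasDerivAt).deriv
  rw [h2]
  ring

theorem kernelFun_add_one (t : ℂ) : kernelFun τ w (t + 1) = kernelFun τ w t := by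
  by_cases h : ∃ k : ℤ, w = k
  · rw [kernelFun_of_int h, rho_eq, rho_eq, deriv_theta1_add_one, theta1_add_one, neg_div_neg_eq]
  · rw [kernelFun_of_not_int h, sigma, sigma, add_sub_right_comm, theta1_add_one, theta1_add_one,
      neg_mul, neg_mul, neg_div_neg_eq]

theorem kernelFun_add_self (hτ : 0 < τ.im) {t : ℂ} (ht : t ∉ lattice τ) :
    kernelFun τ w (t + τ) = expTwoPi w * kernelFun τ w t + kernelShift w := by
  have h0 := (theta1_eq_zero_iff hτ).not.2 ht
  have h1 : Complex.exp (-(Real.pi * I * τ)) ≠ 0 := Complex.exp_ne_zero _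
  have h2 := expTwoPi_ne_zero (-t)
  by_cases h : ∃ k : ℤ, w = k
  · rw [kernelFun_of_int h, rho_eq, rho_eq, deriv_theta1_add_self hτ, theta1_add_self,
      expTwoPi_eq_one_iff.2 h, kernelShift, if_pos h]
    field_simp
    ring
  · rw [kernelFun_of_not_int h, sigma, sigma, add_sub_right_comm, theta1_add_self, theta1_add_self,
      kernelShift, if_neg h, neg_sub, sub_eq_add_neg w t, expTwoPi_add]
    -- Without the strip condition a non-integral `w` may lie in the lattice; then `sigma` is zero
    -- by the convention for division.
    by_cases h3 : theta1 (-w) τ = 0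
    · simp [h3]
    · field_simp
      ring

theorem differentiableAt_deriv_theta1 (hτ : 0 < τ.im) (t : ℂ) :
    DifferentiableAt ℂ (deriv fun u => theta1 u τ) t :=
  ((differentiable_theta1 hτ).analyticAt t).deriv.differentiableAt

theorem differentiableAt_kernelFun (hτ : 0 < τ.im) {t : ℂ} (ht : t ∉ lattice τ) :
    DifferentiableAt ℂ (kernelFun τ w) t := by
  have h0 := (theta1_eq_zero_iff hτ).not.2 ht
  have hd := differentiable_theta1 hτ
  by_cases h : ∃ k : ℤ, w = k
  · rw [kernelFun_of_int h]
    exact (differentiableAt_deriv_theta1 hτ t).div (hd t) h0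
  · rw [kernelFun_of_not_int h]
    unfold sigma
    by_cases h3 : theta1 (-w) τ = 0
    · simp [h3]
    · have h4 : DifferentiableAt ℂ (fun t => theta1 (t - w) τ) t :=
        (hd (t - w)).comp t (f := fun t => t - w) (by fun_prop)
      exact (h4.mul_const _).div ((hd t).mul_const _) (mul_ne_zero h0 h3)

/-- The factor `θ₁'(0)` normalises the residue at `0` to one. The strip condition keeps a
non-integral `w` off the lattice, so that `θ₁(-w) ≠ 0`. -/
theorem tendsto_mul_kernelFun (hw : |w.im| < τ.im) :
    Tendsto (fun t => t * kernelFun τ w t) (𝓝[≠] 0) (𝓝 1) := by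
  have hτ : 0 < τ.im := (abs_nonneg _).trans_lt hw
  have hd := differentiable_theta1 hτ
  have h0 := deriv_theta1_zero_ne_zero hτ
  have h1 := (hasDerivAt_iff_tendsto_slope.1 (hd 0).hasDerivAt).inv₀ h0
  by_cases h : ∃ k : ℤ, w = k
  · rw [kernelFun_of_int h]
    have h2 := ((differentiableAt_deriv_theta1 hτ 0).continuousAt.tendsto.mono_left
      nhdsWithin_le_nhds).mul h1
    rw [mul_inv_cancel₀ h0] at h2
    refine h2.congr fun t => ?_
    rw [slope_def_field, theta1_zero, rho_eq, sub_zero, sub_zero, inv_div]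
    ring
  · rw [kernelFun_of_not_int h]
    have h3 : theta1 (-w) τ ≠ 0 := (theta1_eq_zero_iff hτ).not.2 fun h4 =>
      h (exists_int_eq_of_mem_lattice hw (neg_mem_lattice_iff.1 h4))
    have h4 : ContinuousAt (fun t => theta1 (t - w) τ * deriv (fun u => theta1 u τ) 0 /
        theta1 (-w) τ) 0 :=
      (((hd.continuous).comp (continuous_id.sub continuous_const)).mul
        continuous_const).continuousAt.div_const _
    have h5 := (h4.tendsto.mono_left nhdsWithin_le_nhds).mul h1
    rw [zero_sub, mul_div_assoc, ← mul_comm_div, div_self h3, one_mul, mul_inv_cancel₀ h0] at h5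
    refine h5.congr fun t => ?_
    rw [slope_def_field, theta1_zero, sigma, sub_zero, sub_zero, inv_div]
    ring

theorem analyticAt_iteratedDeriv_kernelFun (hτ : 0 < τ.im) (m : ℕ) {t : ℂ} (ht : t ∉ lattice τ) :
    AnalyticAt ℂ (iteratedDeriv m (kernelFun τ w)) t := by
  induction m with
  | zero =>
    rw [iteratedDeriv_zero]
    refine Complex.analyticAt_iff_eventually_differentiableAt.2 ?_
    have h := eventually_nhdsWithin_iff.1 (eventually_notMem_lattice hτ t)
    filter_upwards [h] with s hs
    by_cases hst : s = t
    · exact hst ▸ differentiableAt_kernelFun hτ ht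
    · exact differentiableAt_kernelFun hτ (hs hst)
  | succ m ih => rw [iteratedDeriv_succ]; exact ih.deriv

theorem eventually_nhds_notMem_lattice (hτ : 0 < τ.im) {t : ℂ} (ht : t ∉ lattice τ) :
    ∀ᶠ s in 𝓝 t, s ∉ lattice τ := by
  filter_upwards [eventually_nhdsWithin_iff.1 (eventually_notMem_lattice hτ t)] with s hs
  by_cases hst : s = t
  · rwa [hst]
  · exact hs hst

theorem iteratedDeriv_kernelFun_add_one (m : ℕ) (t : ℂ) :
    iteratedDeriv m (kernelFun τ w) (t + 1) = iteratedDeriv m (kernelFun τ w) t := by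
  rw [← congrFun (iteratedDeriv_comp_add_const m (kernelFun τ w) 1) t]
  simp only [kernelFun_add_one]

/-- One differentiation kills the additive constant `kernelShift w`, so the multiplier is exact from
order one on. -/
theorem iteratedDeriv_kernelFun_add_self (hτ : 0 < τ.im) (m : ℕ) {t : ℂ} (ht : t ∉ lattice τ) :
    iteratedDeriv (m + 1) (kernelFun τ w) (t + τ) =
      expTwoPi w * iteratedDeriv (m + 1) (kernelFun τ w) t := by
  induction m generalizing t with
  | zero =>
    rw [zero_add, iteratedDeriv_one, ← deriv_comp_add_const]
    have h : (fun s => kernelFun τ w (s + τ)) =ᶠ[𝓝 t]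
        fun s => expTwoPi w * kernelFun τ w s + kernelShift w := by
      filter_upwards [eventually_nhds_notMem_lattice hτ ht] with s hs
      exact kernelFun_add_self hτ hs
    rw [h.deriv_eq, deriv_add_const, deriv_const_mul_field]
  | succ m ih =>
    rw [iteratedDeriv_succ, ← deriv_comp_add_const]
    have h : (fun s => iteratedDeriv (m + 1) (kernelFun τ w) (s + τ)) =ᶠ[𝓝 t]
        fun s => expTwoPi w * iteratedDeriv (m + 1) (kernelFun τ w) s := by
      filter_upwards [eventually_nhds_notMem_lattice hτ ht] with s hs
      exact ih hs
    rw [h.deriv_eq, deriv_const_mul_field]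

end

noncomputable section

open Complex (I)

/-! ### The explicit functions at one point -/

variable {n : ℕ} [NeZero n] {c : Conf n} {w : ℂ}

theorem basisFun_succ (m : ℕ) (l : Fin n) (t : ℂ) :
    basisFun c w (m + 1) l t = iteratedDeriv (m + 1) (kernelFun c.2 w) (t - c.1 l) := by
  by_cases h : ∃ k : ℤ, w = k
  · simp [basisFun, h, kernelFun_of_int h]
  · simp [basisFun, h, kernelFun_of_not_int h, genericFun]

theorem basisFun_zero {l : Fin n} (hl : l ≠ 0) (t : ℂ) :
    basisFun c w 0 l t = kernelFun c.2 w (t - c.1 l) - kernelFun c.2 w (t - c.1 0) := by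
  by_cases h : ∃ k : ℤ, w = k
  · simp [basisFun, h, kernelFun_of_int h, hl]
  · simp [basisFun, h, kernelFun_of_not_int h, genericFun, hl]

theorem basisFun_zero_zero_of_int (h : ∃ k : ℤ, w = k) (t : ℂ) :
    basisFun c w 0 0 t = -(2 * Real.pi * I) := by
  simp [basisFun, h]

theorem basisFun_zero_zero_of_not_int (h : ¬∃ k : ℤ, w = k) (t : ℂ) :
    basisFun c w 0 0 t = (expTwoPi w - 1) * kernelFun c.2 w (t - c.1 0) := by
  simp [basisFun, h, kernelFun_of_not_int h, genericFun, expTwoPi]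

/-- At `z_l` this is the leading term of a simple pole differentiated `m` times. At another `z_i`
the kernel is regular, since `z_i - z_l` is not in the lattice, and the power tends to zero. -/
theorem tendsto_pow_mul_iteratedDeriv_kernelFun (hc : c ∈ ellipticConf n) (hw : |w.im| < c.2.im)
    (m : ℕ) (i l : Fin n) :
    Tendsto (fun t => (t - c.1 i) ^ (m + 1) * iteratedDeriv m (kernelFun c.2 w) (t - c.1 l))
      (𝓝[≠] c.1 i) (𝓝 (if i = l then (-1) ^ m * m.factorial else 0)) := by
  have hτ := hc.1
  split_ifs with h
  · subst h
    have h1 := tendsto_sub_nhdsNE (c.1 i) (c.1 i)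
    rw [sub_self] at h1
    refine (tendsto_pow_mul_iteratedDeriv ?_ (tendsto_mul_kernelFun hw) m).comp h1
    filter_upwards [eventually_notMem_lattice hτ 0] with t ht using differentiableAt_kernelFun hτ ht
  · have h1 : ContinuousAt (fun t => (t - c.1 i) ^ (m + 1) *
        iteratedDeriv m (kernelFun c.2 w) (t - c.1 l)) (c.1 i) :=
      ContinuousAt.mul (by fun_prop) ((analyticAt_iteratedDeriv_kernelFun hτ m
        (hc.2 i l h)).continuousAt.comp (f := fun t => t - c.1 l) (by fun_prop))
    have h2 := h1.tendsto
    rw [sub_self, zero_pow (Nat.succ_ne_zero m), zero_mul] at h2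
    exact h2.mono_left nhdsWithin_le_nhds

/-- The leading coefficient of `basisFun c w m l` at the `i`-th point. -/
theorem tendsto_pow_mul_basisFun_succ (hc : c ∈ ellipticConf n) (hw : |w.im| < c.2.im)
    (m : ℕ) (i l : Fin n) :
    Tendsto (fun t => (t - c.1 i) ^ (m + 2) * basisFun c w (m + 1) l t) (𝓝[≠] c.1 i)
      (𝓝 (if i = l then (-1) ^ (m + 1) * (m + 1).factorial else 0)) := by
  simp only [basisFun_succ]
  exact tendsto_pow_mul_iteratedDeriv_kernelFun hc hw (m + 1) i l

theorem tendsto_mul_basisFun_zero (hc : c ∈ ellipticConf n) (hw : |w.im| < c.2.im)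
    (i : Fin n) {l : Fin n} (hl : l ≠ 0) :
    Tendsto (fun t => (t - c.1 i) ^ 1 * basisFun c w 0 l t) (𝓝[≠] c.1 i)
      (𝓝 ((if i = l then 1 else 0) - if i = 0 then 1 else 0)) := by
  simp only [basisFun_zero hl]
  have h1 := tendsto_pow_mul_iteratedDeriv_kernelFun hc hw 0 i l
  have h2 := tendsto_pow_mul_iteratedDeriv_kernelFun hc hw 0 i 0
  simp only [iteratedDeriv_zero, zero_add, pow_zero, Nat.factorial_zero, Nat.cast_one,
    mul_one] at h1 h2
  exact (h1.sub h2).congr fun t => by ring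

/-- One formula covers both cases: for integral `w` the function is constant, and `expTwoPi w - 1`
vanishes too. -/
theorem tendsto_mul_basisFun_zero_zero (hc : c ∈ ellipticConf n) (hw : |w.im| < c.2.im)
    (i : Fin n) :
    Tendsto (fun t => (t - c.1 i) ^ 1 * basisFun c w 0 0 t) (𝓝[≠] c.1 i)
      (𝓝 (if i = 0 then expTwoPi w - 1 else 0)) := by
  by_cases h : ∃ k : ℤ, w = k
  · have h1 : Tendsto (fun t => (t - c.1 i) ^ 1 * -(2 * Real.pi * I)) (𝓝 (c.1 i))
        (𝓝 ((c.1 i - c.1 i) ^ 1 * -(2 * Real.pi * I))) := Continuous.tendsto (by fun_prop) _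
    simp only [basisFun_zero_zero_of_int h, expTwoPi_eq_one_iff.2 h]
    simpa using h1.mono_left nhdsWithin_le_nhds
  · simp only [basisFun_zero_zero_of_not_int h]
    have h2 := (tendsto_pow_mul_iteratedDeriv_kernelFun hc hw 0 i 0).const_mul (expTwoPi w - 1)
    simp only [iteratedDeriv_zero, zero_add, pow_zero, Nat.factorial_zero, Nat.cast_one,
      mul_one, mul_ite, mul_zero] at h2
    exact h2.congr fun t => by ring

/-- The constant `kernelShift w` is the only obstruction for the kernels. It disappears by
differentiation for `m ≥ 1` and in the difference for `l ≠ 0`. For `m = 0`, `l = 0` it is zero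
unless `w` is an integer, where the function is a constant instead. -/
theorem quasiPeriodic_basisFun (hc : c ∈ ellipticConf n) (hw : |w.im| < c.2.im)
    (m : ℕ) (l : Fin n) : QuasiPeriodic c w (m + 1) (basisFun c w m l) := by
  have hτ := hc.1
  have hk : ∀ (l : Fin n) (m : ℕ), ∀ t ∈ fibreRegular c,
      DifferentiableAt ℂ (fun t => iteratedDeriv m (kernelFun c.2 w) (t - c.1 l)) t := fun l m t ht =>
    ((analyticAt_iteratedDeriv_kernelFun hτ m (ht l)).differentiableAt).comp t
      (f := fun t => t - c.1 l) (by fun_prop)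
  have h1 : ∀ (l : Fin n) t, t + 1 - c.1 l = t - c.1 l + 1 := fun l t => by ring
  have h2 : ∀ (l : Fin n) t, t + c.2 - c.1 l = t - c.1 l + c.2 := fun l t => by ring
  cases m with
  | succ m =>
    refine ⟨fun t ht => ?_, fun t ht => ?_, fun t ht => ?_,
      fun i => ⟨_, tendsto_pow_mul_basisFun_succ hc hw m i l⟩⟩
    · rw [show basisFun c w (m + 1) l = _ from funext (basisFun_succ m l)]
      exact hk l (m + 1) t ht
    · rw [basisFun_succ, basisFun_succ, h1, iteratedDeriv_kernelFun_add_one]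
    · rw [basisFun_succ, basisFun_succ, h2, iteratedDeriv_kernelFun_add_self hτ m (ht l)]
  | zero =>
    by_cases hl : l = 0
    · subst hl
      refine ⟨fun t ht => ?_, fun t ht => ?_, fun t ht => ?_,
        fun i => ⟨_, tendsto_mul_basisFun_zero_zero hc hw i⟩⟩
      all_goals by_cases h : ∃ k : ℤ, w = k
      · rw [show basisFun c w 0 0 = _ from funext (basisFun_zero_zero_of_int h)]
        exact differentiableAt_const _
      · rw [show basisFun c w 0 0 = _ from funext (basisFun_zero_zero_of_not_int h)]
        exact (hk 0 0 t ht).const_mul _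
      · simp only [basisFun_zero_zero_of_int h]
      · simp only [basisFun_zero_zero_of_not_int h, h1, kernelFun_add_one]
      · simp only [basisFun_zero_zero_of_int h, expTwoPi_eq_one_iff.2 h, one_mul]
      · rw [basisFun_zero_zero_of_not_int h, basisFun_zero_zero_of_not_int h, h2,
          kernelFun_add_self hτ (ht 0), kernelShift, if_neg h]
        ring
    · refine ⟨fun t ht => ?_, fun t ht => ?_, fun t ht => ?_,
        fun i => ⟨_, tendsto_mul_basisFun_zero hc hw i hl⟩⟩
      · rw [show basisFun c w 0 l = _ from funext (basisFun_zero hl)]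
        exact (hk l 0 t ht).sub (hk 0 0 t ht)
      · simp only [basisFun_zero hl, h1, kernelFun_add_one]
      · rw [basisFun_zero hl, basisFun_zero hl, h2, h2, kernelFun_add_self hτ (ht l),
          kernelFun_add_self hτ (ht 0)]
        ring

theorem exists_basisFun_zero_zero_ne_zero (hc : c ∈ ellipticConf n) (hw : |w.im| < c.2.im) :
    ∃ t ∈ fibreRegular c, basisFun c w 0 0 t ≠ 0 := by
  have hev := eventually_mem_fibreRegular hc.1 (c.1 0)
  by_cases h : ∃ k : ℤ, w = k
  · obtain ⟨t, ht⟩ := hev.exists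
    exact ⟨t, ht, by simp [basisFun_zero_zero_of_int h, Real.pi_ne_zero]⟩
  · have h1 := tendsto_mul_basisFun_zero_zero hc hw 0
    rw [if_pos rfl] at h1
    have h2 : expTwoPi w - 1 ≠ 0 := sub_ne_zero.2 fun h3 => h (expTwoPi_eq_one_iff.1 h3)
    obtain ⟨t, ht, ht'⟩ := (hev.and (h1.eventually_ne h2)).exists
    exact ⟨t, ht, right_ne_zero_of_mul ht'⟩

/-- A function with at most one simple pole is a multiple of `basisFun c w 0 0`. -/
theorem exists_eq_mul_basisFun_zero_zero (hc : c ∈ ellipticConf n) (hw : |w.im| < c.2.im)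
    {g : ℂ → ℂ} (hg : QuasiPeriodic c w 1 g)
    (h : ∀ i ≠ 0, Tendsto (fun t => (t - c.1 i) ^ 1 * g t) (𝓝[≠] c.1 i) (𝓝 0)) :
    ∃ a, ∀ t ∈ fibreRegular c, g t = a * basisFun c w 0 0 t := by
  have hτ := hc.1
  obtain ⟨R, hR⟩ := hg.tendsto 0
  -- Subtracting the kernel with the residue `R` removes the only pole, at the price of the additive
  -- constant `R * kernelShift w`.
  set u : ℂ → ℂ := fun t => g t - R * kernelFun c.2 w (t - c.1 0) with hu
  have hud : ∀ t ∈ fibreRegular c, DifferentiableAt ℂ u t := fun t ht =>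
    (hg.differentiableAt t ht).sub (((differentiableAt_kernelFun hτ (ht 0)).comp t
      (f := fun t => t - c.1 0) (by fun_prop)).const_mul R)
  have hu1 : ∀ t ∈ fibreRegular c, u (t + 1) = u t := fun t ht => by
    simp only [hu]
    rw [hg.add_one t ht, add_sub_right_comm, kernelFun_add_one]
  have huτ : ∀ t ∈ fibreRegular c, u (t + c.2) = expTwoPi w * u t - R * kernelShift w :=
    fun t ht => by
      simp only [hu]
      rw [hg.add_self t ht, add_sub_right_comm, kernelFun_add_self hτ (ht 0)]
      ring
  have hures : ∀ i, Tendsto (fun t => (t - c.1 i) ^ (0 + 1) * u t) (𝓝[≠] c.1 i) (𝓝 0) := fun i => by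
    have h2 := (tendsto_pow_mul_iteratedDeriv_kernelFun hc hw 0 i 0).const_mul R
    simp only [iteratedDeriv_zero, zero_add, pow_zero, Nat.factorial_zero, Nat.cast_one,
      mul_one, mul_ite, mul_zero] at h2
    by_cases hi : i = 0
    · subst hi
      rw [if_pos rfl] at h2
      have h3 := hR.sub h2
      rw [sub_self] at h3
      exact h3.congr fun t => by simp only [hu]; ring
    · rw [if_neg hi] at h2
      have h3 := (h i hi).sub h2
      rw [sub_self] at h3
      exact h3.congr fun t => by simp only [hu]; ring
  by_cases hint : ∃ k : ℤ, w = k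
  · have hw1 := expTwoPi_eq_one_iff.2 hint
    have hR0 : R = 0 := by
      by_contra hne
      have hulim : ∀ i, ∃ a, Tendsto u (𝓝[≠] c.1 i) (𝓝 a) := fun i =>
        exists_tendsto_of_sub_mul_tendsto_zero
          ((eventually_mem_fibreRegular hτ (c.1 i)).mono hud) ((hures i).congr fun t => by ring)
      -- This replaces the residue theorem. If `R ≠ 0`, then `u` has no poles and grows by `2 π i R`
      -- under `τ`, so `exp (u / (2 R))` has multiplier `-1`. Such an entire function must vanish,
      -- which an exponential does not.
      have hE : QuasiPeriodic c (1 / 2) 0 fun t => Complex.exp (u t / (2 * R)) := by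
        refine ⟨fun t ht => ((hud t ht).div_const _).cexp, fun t ht => by rw [hu1 t ht],
          fun t ht => ?_, fun i => ?_⟩
        · rw [huτ t ht, kernelShift, if_pos hint, hw1, expTwoPi, ← Complex.exp_add]
          congr 1
          field_simp
          ring
        · obtain ⟨a, ha⟩ := hulim i
          refine ⟨Complex.exp (a / (2 * R)), ?_⟩
          simp only [pow_zero, one_mul]
          exact (Complex.continuous_exp.tendsto _).comp (ha.div_const _)
      have hhalf : (1 / 2 : ℂ) ∉ lattice c.2 := fun hmem => by
        obtain ⟨k, hk⟩ := exists_int_eq_of_mem_lattice (by simpa using hτ) hmem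
        have h2 : (2 * k : ℂ) = 1 := by rw [← hk]; norm_num
        have h3 : 2 * k = 1 := by exact_mod_cast h2
        omega
      obtain ⟨G, hG, hEG, hG1, hG2⟩ := hE.exists_entire hτ
      obtain ⟨t, ht⟩ := (eventually_mem_fibreRegular (c := c) hτ 0).exists
      have h4 := hEG ht
      rw [eq_zero_of_entire hτ hhalf hG hG1 hG2] at h4
      exact Complex.exp_ne_zero _ h4
    have hgu : u = g := by
      funext t
      simp [hu, hR0]
    rw [hgu] at hures
    obtain ⟨G, hG, hgG, hG1, hG2⟩ := (hg.of_tendsto_zero hτ hures).exists_entire hτ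
    have hconst := eq_of_elliptic hτ hG hG1 (by simpa [hw1] using hG2)
    refine ⟨G 0 / -(2 * Real.pi * I), fun t ht => ?_⟩
    rw [hgG ht, hconst t 0, basisFun_zero_zero_of_int hint,
      div_mul_cancel₀ _ (neg_ne_zero.2 Complex.two_pi_I_ne_zero)]
  -- For non-integral `w` there is no additive constant, so `u` extends to an entire function whose
  -- `w` is off the lattice, and `u` vanishes.
  · have huQ : QuasiPeriodic c w (0 + 1) u := by
      refine ⟨hud, hu1, fun t ht => ?_, fun i => ⟨0, hures i⟩⟩
      rw [huτ t ht, kernelShift, if_neg hint, mul_zero, sub_zero]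
    obtain ⟨G, hG, huG, hG1, hG2⟩ := (huQ.of_tendsto_zero hτ hures).exists_entire hτ
    have hwl : w ∉ lattice c.2 := fun hmem => hint (exists_int_eq_of_mem_lattice hw hmem)
    have h2 : expTwoPi w - 1 ≠ 0 := sub_ne_zero.2 fun h3 => hint (expTwoPi_eq_one_iff.1 h3)
    refine ⟨R / (expTwoPi w - 1), fun t ht => ?_⟩
    have h3 := huG ht
    rw [eq_zero_of_entire hτ hwl hG hG1 hG2] at h3
    rw [basisFun_zero_zero_of_not_int hint, ← mul_assoc, div_mul_cancel₀ _ h2]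
    exact sub_eq_zero.1 h3

/-- Quasi-periodic functions are combinations of the explicit functions. -/
theorem exists_eq_sum_basisFun (hc : c ∈ ellipticConf n) (hw : |w.im| < c.2.im) (j : ℕ)
    {f : ℂ → ℂ} (hf : QuasiPeriodic c w (j + 1) f) : ∃ a : ℕ → Fin n → ℂ, ∀ t ∈ fibreRegular c,
      f t = ∑ m ∈ Finset.range (j + 1), ∑ l, a m l * basisFun c w m l t := by
  have hτ := hc.1
  induction j generalizing f with
  | zero =>
    choose A hA using hf.tendsto
    -- The residue at the first point is left alone: for `l ≠ 0` the explicit functions alter it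
    -- anyway, and `exists_eq_mul_basisFun_zero_zero` deals with it.
    set a : Fin n → ℂ := fun l => if l = 0 then 0 else A l with ha
    have hg : QuasiPeriodic c w 1 fun t => f t - ∑ l, a l * basisFun c w 0 l t :=
      hf.sub (QuasiPeriodic.sum _ fun l _ => (quasiPeriodic_basisFun hc hw 0 l).const_mul (a l))
    obtain ⟨b, hb⟩ := exists_eq_mul_basisFun_zero_zero hc hw hg fun i hi => by
      have h1 : Tendsto (fun t => ∑ l, a l * ((t - c.1 i) ^ 1 * basisFun c w 0 l t)) (𝓝[≠] c.1 i)
          (𝓝 (∑ l, if i = l then A i else 0)) := by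
        refine tendsto_finsetSum _ fun l _ => ?_
        by_cases hl : l = 0
        · simp [ha, hl, hi]
        · have h2 := (tendsto_mul_basisFun_zero hc hw i hl).const_mul (a l)
          rw [if_neg hi, sub_zero] at h2
          convert h2 using 2
          split_ifs with hil
          · simp [ha, hl, hil]
          · simp
      have h2 := (hA i).sub h1
      simp only [Finset.sum_ite_eq, Finset.mem_univ, if_true, sub_self] at h2
      refine h2.congr fun t => ?_
      rw [zero_add, mul_sub, Finset.mul_sum]
      exact congrArg _ (Finset.sum_congr rfl fun l _ => by ring)
    refine ⟨fun _ l => a l + if l = 0 then b else 0, fun t ht => ?_⟩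
    simp only [zero_add, Finset.range_one, Finset.sum_singleton, add_mul, Finset.sum_add_distrib,
      ite_mul, zero_mul, Finset.sum_ite_eq', Finset.mem_univ, if_true, ← hb t ht]
    ring
  | succ j ih =>
    choose A hA using hf.tendsto
    -- Leading coefficient of the explicit function of order `j + 1` at its pole; dividing by it
    -- cancels the top order of `f` at every point.
    set k : ℂ := (-1) ^ (j + 1) * (j + 1).factorial with hk
    have hk0 : k ≠ 0 := mul_ne_zero (pow_ne_zero _ (by norm_num))
      (Nat.cast_ne_zero.2 (Nat.factorial_ne_zero _))
    have hg : QuasiPeriodic c w (j + 1 + 1)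
        fun t => f t - ∑ l, A l / k * basisFun c w (j + 1) l t :=
      hf.sub (QuasiPeriodic.sum _ fun l _ => (quasiPeriodic_basisFun hc hw (j + 1) l).const_mul _)
    obtain ⟨a, ha⟩ := ih (hg.of_tendsto_zero hτ fun i => by
      have h1 : Tendsto (fun t => ∑ l, A l / k * ((t - c.1 i) ^ (j + 1 + 1) *
          basisFun c w (j + 1) l t)) (𝓝[≠] c.1 i) (𝓝 (∑ l, if i = l then A i else 0)) := by
        refine tendsto_finsetSum _ fun l _ => ?_
        convert (tendsto_pow_mul_basisFun_succ hc hw j i l).const_mul (A l / k) using 2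
        split_ifs with hil
        · rw [hil, ← hk, div_mul_cancel₀ _ hk0]
        · simp
      have h2 := (hA i).sub h1
      simp only [Finset.sum_ite_eq, Finset.mem_univ, if_true, sub_self] at h2
      refine h2.congr fun t => ?_
      rw [mul_sub, Finset.mul_sum]
      exact congrArg _ (Finset.sum_congr rfl fun l _ => by ring))
    refine ⟨fun m l => if m = j + 1 then A l / k else a m l, fun t ht => ?_⟩
    rw [Finset.sum_range_succ, Finset.sum_congr rfl (g := fun m => ∑ l, a m l * basisFun c w m l t)
      fun m hm => by simp [(Finset.mem_range.1 hm).ne], ← ha t ht]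
    simp

/-- The explicit functions are linearly independent. -/
theorem eq_zero_of_sum_basisFun (hc : c ∈ ellipticConf n) (hw : |w.im| < c.2.im) (j : ℕ)
    {a : ℕ → Fin n → ℂ} (h : ∀ t ∈ fibreRegular c,
      ∑ m ∈ Finset.range j, ∑ l, a m l * basisFun c w m l t = 0) :
    ∀ m < j, ∀ l, a m l = 0 := by
  have hτ := hc.1
  have hzero : ∀ (i : Fin n) (k : ℕ), Tendsto (fun t => (t - c.1 i) ^ k *
      ∑ m ∈ Finset.range j, ∑ l, a m l * basisFun c w m l t) (𝓝[≠] c.1 i) (𝓝 0) := fun i k => by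
    refine tendsto_const_nhds.congr' ?_
    filter_upwards [eventually_mem_fibreRegular hτ (c.1 i)] with t ht
    rw [h t ht, mul_zero]
  induction j with
  | zero => intro m hm; exact absurd hm (Nat.not_lt_zero m)
  | succ j ih =>
    -- It is enough to kill the coefficients of highest index: the truncated sum then satisfies the
    -- same hypotheses.
    suffices hj : ∀ l, a j l = 0 by
      have h' : ∀ t ∈ fibreRegular c,
          ∑ m ∈ Finset.range j, ∑ l, a m l * basisFun c w m l t = 0 := fun t ht => by
        have := h t ht
        rw [Finset.sum_range_succ] at this
        simpa [hj] using this
      intro m hm l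
      rcases Nat.lt_succ_iff_lt_or_eq.1 hm with hm | rfl
      · refine ih h' (fun i k => ?_) m hm l
        refine tendsto_const_nhds.congr' ?_
        filter_upwards [eventually_mem_fibreRegular hτ (c.1 i)] with t ht
        rw [h' t ht, mul_zero]
      · exact hj l
    cases j with
    | zero =>
      -- Residues determine all coefficients but the first. The function `basisFun c w 0 0` may have
      -- no pole at all, so its coefficient is found by evaluation at a point where it is non-zero.
      have h1 : ∀ i ≠ 0, a 0 i = 0 := fun i hi => by
        have h2 : Tendsto (fun t => ∑ l, a 0 l * ((t - c.1 i) ^ 1 * basisFun c w 0 l t))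
            (𝓝[≠] c.1 i) (𝓝 (∑ l, if i = l then a 0 i else 0)) := by
          refine tendsto_finsetSum _ fun l _ => ?_
          by_cases hl : l = 0
          · have h3 := (tendsto_mul_basisFun_zero_zero hc hw i).const_mul (a 0 l)
            rw [if_neg hi, mul_zero] at h3
            subst hl
            rwa [if_neg hi]
          · have h3 := (tendsto_mul_basisFun_zero hc hw i hl).const_mul (a 0 l)
            rw [if_neg hi, sub_zero] at h3
            convert h3 using 2
            split_ifs with hil
            · simp [hil]
            · simp
        have h3 := tendsto_nhds_unique h2 ((hzero i 1).congr fun t => by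
          rw [zero_add, Finset.range_one, Finset.sum_singleton, Finset.mul_sum]
          exact Finset.sum_congr rfl fun l _ => by ring)
        simpa using h3
      obtain ⟨t, ht, hne⟩ := exists_basisFun_zero_zero_ne_zero hc hw
      have h2 := h t ht
      rw [zero_add, Finset.range_one, Finset.sum_singleton, Finset.sum_eq_single 0
        (fun l _ hl => by rw [h1 l hl, zero_mul]) (by simp)] at h2
      intro l
      by_cases hl : l = 0
      · rw [hl]; exact (mul_eq_zero.1 h2).resolve_right hne
      · exact h1 l hl
    | succ j =>
      intro i
      set k : ℂ := (-1) ^ (j + 1) * (j + 1).factorial with hk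
      have hk0 : k ≠ 0 := mul_ne_zero (pow_ne_zero _ (by norm_num))
        (Nat.cast_ne_zero.2 (Nat.factorial_ne_zero _))
      have h1 : Tendsto (fun t => ∑ l, a (j + 1) l * ((t - c.1 i) ^ (j + 1 + 1) *
          basisFun c w (j + 1) l t)) (𝓝[≠] c.1 i) (𝓝 (∑ l, if i = l then a (j + 1) i * k else 0)) := by
        refine tendsto_finsetSum _ fun l _ => ?_
        convert (tendsto_pow_mul_basisFun_succ hc hw j i l).const_mul (a (j + 1) l) using 2
        split_ifs with hil
        · rw [hil, ← hk]
        · simp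
      -- Terms of lower index have poles of smaller order and drop out after multiplication by the
      -- top power.
      have h2 : Tendsto (fun t => ∑ m ∈ Finset.range (j + 1), ∑ l, a m l *
          ((t - c.1 i) ^ (j + 1 + 1) * basisFun c w m l t)) (𝓝[≠] c.1 i) (𝓝 0) := by
        rw [show (0 : ℂ) = ∑ m ∈ Finset.range (j + 1), ∑ l : Fin n, 0 by simp]
        refine tendsto_finsetSum _ fun m hm => tendsto_finsetSum _ fun l _ => ?_
        obtain ⟨d, hd⟩ := Nat.exists_eq_add_of_lt (Finset.mem_range.1 hm)
        obtain ⟨b, hb⟩ := (quasiPeriodic_basisFun hc hw m l).tendsto i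
        have h3 : Tendsto (fun t : ℂ => (t - c.1 i) ^ (d + 1)) (𝓝[≠] c.1 i)
            (𝓝 ((c.1 i - c.1 i) ^ (d + 1))) :=
          (Continuous.tendsto (by fun_prop) _).mono_left nhdsWithin_le_nhds
        have h4 := (h3.mul hb).const_mul (a m l)
        rw [sub_self, zero_pow (Nat.succ_ne_zero d), zero_mul, mul_zero] at h4
        refine h4.congr fun t => ?_
        rw [hd]
        ring
      have h3 := tendsto_nhds_unique (h2.add h1) ((hzero i (j + 1 + 1)).congr fun t => by
        rw [Finset.sum_range_succ, mul_add, Finset.mul_sum, Finset.mul_sum]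
        simp only [Finset.mul_sum]
        congr 1
        · exact Finset.sum_congr rfl fun m _ => Finset.sum_congr rfl fun l _ => by ring
        · exact Finset.sum_congr rfl fun l _ => by ring)
      simp only [Finset.sum_ite_eq, Finset.mem_univ, if_true, zero_add] at h3
      exact (mul_eq_zero.1 h3).resolve_right hk0

end

noncomputable section

open Complex (I)

/-! ### Joint holomorphy of the explicit functions -/

variable {τ w : ℂ}

theorem eventually_notMem_lattice_prod {p : ℂ × ℂ} (hτ : 0 < p.2.im) (h : p.1 ∉ lattice p.2) :
    ∀ᶠ q : ℂ × ℂ in 𝓝 p, 0 < q.2.im ∧ q.1 ∉ lattice q.2 := by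
  have h1 : ∀ᶠ q : ℂ × ℂ in 𝓝 p, 0 < q.2.im :=
    ContinuousAt.eventually_lt continuousAt_const (by fun_prop) hτ
  filter_upwards [h1, (differentiableAt_theta1 hτ).continuousAt.eventually_ne
    ((theta1_eq_zero_iff hτ).not.2 h)] with q hq1 hq2
  exact ⟨hq1, (theta1_eq_zero_iff hq1).not.1 hq2⟩

/-- Lattice points are isolated, locally uniformly in the lattice. -/
theorem eventually_eq_zero_of_mem_lattice (hτ : 0 < τ.im) :
    ∀ᶠ q : ℂ × ℂ in 𝓝 (0, τ), q.1 ∈ lattice q.2 → q.1 = 0 := by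
  have h1 : ∀ᶠ q : ℂ × ℂ in 𝓝 (0, τ), |q.1.im| < q.2.im :=
    ContinuousAt.eventually_lt (by fun_prop) (by fun_prop) (by simpa using hτ)
  have h2 : ∀ᶠ q : ℂ × ℂ in 𝓝 (0, τ), ‖q.1‖ < 1 :=
    ContinuousAt.eventually_lt (by fun_prop) (by fun_prop) (by simp)
  filter_upwards [h1, h2] with q hq1 hq2 hq
  obtain ⟨k, hk⟩ := exists_int_eq_of_mem_lattice hq1 hq
  rw [hk, Complex.norm_intCast] at hq2
  have h3 : |k| < 1 := by exact_mod_cast hq2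
  rw [hk, Int.abs_lt_one_iff.1 h3, Int.cast_zero]

/-- Numerator and denominator change sign together under `w ↦ w + 1`. This reduces all integral
singularities to `w = 0`. -/
theorem sigma_add_int (k : ℤ) (t : ℂ) : sigma τ (w + k) t = sigma τ w t := by
  have h : Function.Periodic (fun w => sigma τ w t) 1 := fun w => by
    have e1 : theta1 (t - (w + 1)) τ = -theta1 (t - w) τ := by
      rw [← neg_neg (theta1 (t - (w + 1)) τ), ← theta1_add_one]; ring_nf
    have e2 : theta1 (-(w + 1)) τ = -theta1 (-w) τ := by
      rw [← neg_neg (theta1 (-(w + 1)) τ), ← theta1_add_one]; ring_nf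
    simp only [sigma]
    rw [e1, e2, neg_mul, mul_neg, neg_div_neg_eq]
  have h1 := h.int_mul k w
  rwa [mul_one] at h1

theorem exists_int_eq_add_int_iff (k : ℤ) : (∃ l : ℤ, w + k = l) ↔ ∃ l : ℤ, w = l :=
  ⟨fun ⟨l, hl⟩ => ⟨l - k, by push_cast; linear_combination hl⟩,
    fun ⟨l, hl⟩ => ⟨l + k, by push_cast; linear_combination hl⟩⟩

theorem kernelFun_add_int (k : ℤ) (t : ℂ) : kernelFun τ (w + k) t = kernelFun τ w t := by
  by_cases h : ∃ l : ℤ, w = l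
  · rw [kernelFun_of_int h, kernelFun_of_int ((exists_int_eq_add_int_iff k).2 h)]
  · rw [kernelFun_of_not_int h, kernelFun_of_not_int fun h' => h ((exists_int_eq_add_int_iff k).1 h'),
      sigma_add_int]

/-- `(exp (2 π i w) - 1) σ_w (t)`, with the value `-2 π i` for `w ∈ ℤ`. -/
def edgeFun (τ w t : ℂ) : ℂ :=
  open scoped Classical in
  if ∃ k : ℤ, w = k then -(2 * Real.pi * I) else (expTwoPi w - 1) * sigma τ w t

theorem edgeFun_add_int (k : ℤ) (t : ℂ) : edgeFun τ (w + k) t = edgeFun τ w t := by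
  by_cases h : ∃ l : ℤ, w = l
  · rw [edgeFun, edgeFun, if_pos h, if_pos ((exists_int_eq_add_int_iff k).2 h)]
  · rw [edgeFun, edgeFun, if_neg h, if_neg fun h' => h ((exists_int_eq_add_int_iff k).1 h'),
      sigma_add_int, expTwoPi_add, expTwoPi_int, mul_one]

theorem eventually_not_int : ∀ᶠ w : ℂ in 𝓝[≠] 0, ¬∃ k : ℤ, w = k := by
  have h2 : ∀ᶠ w : ℂ in 𝓝[≠] 0, ‖w‖ < 1 := by
    refine Eventually.filter_mono nhdsWithin_le_nhds ?_
    exact ContinuousAt.eventually_lt (by fun_prop) (by fun_prop) (by simp)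
  filter_upwards [h2, self_mem_nhdsWithin] with w hw h0
  rintro ⟨k, rfl⟩
  rw [Complex.norm_intCast] at hw
  have h3 : |k| < 1 := by exact_mod_cast hw
  exact h0 (by rw [Int.abs_lt_one_iff.1 h3, Int.cast_zero]; rfl)

theorem hasDerivAt_theta1_sub (hτ : 0 < τ.im) (t : ℂ) :
    HasDerivAt (fun w => theta1 (t - w) τ) (-deriv (fun u => theta1 u τ) t) 0 := by
  have h := (differentiable_theta1 hτ (t - 0)).hasDerivAt.comp (0 : ℂ)
    ((hasDerivAt_id (0 : ℂ)).const_sub t)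
  rw [mul_neg, mul_one, sub_zero] at h
  exact h

theorem tendsto_slope_theta1_neg (hτ : 0 < τ.im) : Tendsto (fun w => theta1 (-w) τ / w) (𝓝[≠] 0)
    (𝓝 (-deriv (fun u => theta1 u τ) 0)) := by
  refine (hasDerivAt_iff_tendsto_slope.1 (hasDerivAt_theta1_sub hτ 0)).congr fun w => ?_
  rw [slope_def_field, sub_zero, sub_zero, theta1_zero, sub_zero, zero_sub]

/-- At `w = 0` the quotient `θ₁(t - w) / θ₁(t)` is `1`, so in the difference for `t` and `s` these
values cancel and the numerator is of first order, with derivative `ρ(s) - ρ(t)`. The denominator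
`θ₁(-w)` has derivative `-θ₁'(0)`. -/
theorem tendsto_sub_kernelFun (hτ : 0 < τ.im) {t s : ℂ} (ht : t ∉ lattice τ) (hs : s ∉ lattice τ) :
    Tendsto (fun w => kernelFun τ w t - kernelFun τ w s) (𝓝[≠] 0)
      (𝓝 (kernelFun τ 0 t - kernelFun τ 0 s)) := by
  have ht0 := (theta1_eq_zero_iff hτ).not.2 ht
  have hs0 := (theta1_eq_zero_iff hτ).not.2 hs
  have hd0 := deriv_theta1_zero_ne_zero hτ
  have h1 := ((hasDerivAt_theta1_sub hτ t).div_const (theta1 t τ)).sub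
    ((hasDerivAt_theta1_sub hτ s).div_const (theta1 s τ))
  have h2 := ((hasDerivAt_iff_tendsto_slope.1 h1).div (tendsto_slope_theta1_neg hτ)
    (neg_ne_zero.2 hd0)).mul_const (deriv (fun u => theta1 u τ) 0)
  have hint : ∃ k : ℤ, (0 : ℂ) = k := ⟨0, by simp⟩
  have e : (-deriv (fun u => theta1 u τ) t / theta1 t τ -
      -deriv (fun u => theta1 u τ) s / theta1 s τ) / -deriv (fun u => theta1 u τ) 0 *
        deriv (fun u => theta1 u τ) 0 = kernelFun τ 0 t - kernelFun τ 0 s := by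
    rw [kernelFun_of_int hint, rho_eq, rho_eq]
    field_simp
    ring
  rw [e] at h2
  refine h2.congr' ?_
  filter_upwards [eventually_not_int, self_mem_nhdsWithin] with w hw h0
  have h0' : w ≠ 0 := h0
  rw [Pi.div_apply, slope_def_field, kernelFun_of_not_int hw, sigma, sigma]
  simp only [Pi.sub_apply, sub_zero, div_self ht0, div_self hs0, sub_self]
  -- Both sides are then zero by the convention for division, so the neighbourhood need not be
  -- shrunk.
  by_cases hw0 : theta1 (-w) τ = 0
  · simp [hw0]
  · field_simp

/-- The zero `2 π i w + …` of `expTwoPi w - 1` cancels the pole of `σ_w` in `w`, whose denominator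
behaves like `-θ₁'(0) w`. -/
theorem tendsto_edgeFun (hτ : 0 < τ.im) {t : ℂ} (ht : t ∉ lattice τ) :
    Tendsto (fun w => edgeFun τ w t) (𝓝[≠] 0) (𝓝 (edgeFun τ 0 t)) := by
  have ht0 := (theta1_eq_zero_iff hτ).not.2 ht
  have hd0 := deriv_theta1_zero_ne_zero hτ
  have h1 := ((hasDerivAt_iff_tendsto_slope.1 (hasDerivAt_expTwoPi 0)).div
    (tendsto_slope_theta1_neg hτ) (neg_ne_zero.2 hd0)).mul_const (deriv (fun u => theta1 u τ) 0)
  have h2 := h1.mul ((((hasDerivAt_theta1_sub hτ t).continuousAt.tendsto).mono_left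
    (nhdsWithin_le_nhds (s := {0}ᶜ))).div_const (theta1 t τ))
  have hint : ∃ k : ℤ, (0 : ℂ) = k := ⟨0, by simp⟩
  have e : 2 * Real.pi * I * expTwoPi 0 / -deriv (fun u => theta1 u τ) 0 *
      deriv (fun u => theta1 u τ) 0 * (theta1 (t - 0) τ / theta1 t τ) = edgeFun τ 0 t := by
    rw [edgeFun, if_pos hint, expTwoPi_zero, sub_zero]
    field_simp
  rw [e] at h2
  refine h2.congr' ?_
  filter_upwards [eventually_not_int, self_mem_nhdsWithin] with w hw h0
  have h0' : w ≠ 0 := h0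
  rw [Pi.div_apply, edgeFun, if_neg hw, slope_def_field, sigma, expTwoPi_zero, sub_zero]
  by_cases hw0 : theta1 (-w) τ = 0
  · simp [hw0]
  · field_simp

/-- `σ_w (t)` is holomorphic in `(w, t, τ)`. -/
theorem differentiableAt_sigma {q : ℂ × ℂ × ℂ} (hτ : 0 < q.2.2.im) (ht : q.2.1 ∉ lattice q.2.2)
    (hw : q.1 ∉ lattice q.2.2) :
    DifferentiableAt ℂ (fun q : ℂ × ℂ × ℂ => sigma q.2.2 q.1 q.2.1) q := by
  have hθ : ∀ g : ℂ × ℂ × ℂ → ℂ, DifferentiableAt ℂ g q →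
      DifferentiableAt ℂ (fun q => theta1 (g q) q.2.2) q := fun g hg =>
    (differentiableAt_theta1 (p := (g q, q.2.2)) hτ).comp q
      (f := fun q : ℂ × ℂ × ℂ => (g q, q.2.2)) (by fun_prop)
  have hd : DifferentiableAt ℂ (fun p : ℂ × ℂ => deriv (fun t => theta1 t p.2) p.1)
      (0, q.2.2) := by
    refine differentiableAt_deriv_fst (f := fun p : ℂ × ℂ => theta1 p.1 p.2) ?_
    have h1 : ∀ᶠ p : ℂ × ℂ in 𝓝 (0, q.2.2), 0 < p.2.im :=
      ContinuousAt.eventually_lt continuousAt_const (by fun_prop) hτ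
    exact h1.mono fun p hp => differentiableAt_theta1 hp
  have hd' : DifferentiableAt ℂ (fun q : ℂ × ℂ × ℂ => deriv (fun t => theta1 t q.2.2) 0) q :=
    hd.comp q (f := fun q : ℂ × ℂ × ℂ => ((0 : ℂ), q.2.2)) (by fun_prop)
  unfold sigma
  have h1 := (hθ (fun q => q.2.1 - q.1) (by fun_prop)).fun_mul hd'
  have h2 := (hθ (fun q => q.2.1) (by fun_prop)).fun_mul (hθ (fun q => -q.1) (by fun_prop))
  have h3 : theta1 q.2.1 q.2.2 * theta1 (-q.1) q.2.2 ≠ 0 :=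
    mul_ne_zero ((theta1_eq_zero_iff hτ).not.2 ht)
      ((theta1_eq_zero_iff hτ).not.2 (by rwa [neg_mem_lattice_iff]))
  simp only [div_eq_mul_inv]
  exact h1.fun_mul (h2.fun_inv h3)

/-- A criterion for functions with removable singularities at `w ∈ ℤ`. -/
theorem differentiableAt_of_periodic_of_tendsto {F : Type*} [NormedAddCommGroup F]
    [NormedSpace ℂ F] [FiniteDimensional ℂ F] {f : ℂ × F → ℂ} {S : Set (ℂ × F)} (hS : IsOpen S)
    (hf : ∀ q ∈ S, (¬∃ k : ℤ, q.1 = k) → DifferentiableAt ℂ f q)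
    (hper : ∀ (k : ℤ) w y, f (w + k, y) = f (w, y))
    (hSper : ∀ (k : ℤ) w y, (w, y) ∈ S → (w + k, y) ∈ S)
    (hlim : ∀ y, (0, y) ∈ S → Tendsto (fun w => f (w, y)) (𝓝[≠] 0) (𝓝 (f (0, y))))
    {q : ℂ × F} (hq : q ∈ S) : DifferentiableAt ℂ f q := by
  by_cases h : ∃ k : ℤ, q.1 = k
  · obtain ⟨k, hk⟩ := h
    obtain ⟨w, y⟩ := q
    simp only at hk
    have h0 : ((0 : ℂ), y) ∈ S := by
      have := hSper (-k) w y hq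
      rwa [hk, Int.cast_neg, add_neg_cancel] at this
    -- Other integers have norm at least one, so near `(0, y)` the only singular locus is the graph
    -- `w = 0`, where the limits equal the values. Periodicity transports the result to `w = k`.
    have h1 : DifferentiableAt ℂ f (0, y) := by
      refine differentiableAt_of_tendsto_fst (h := fun _ => 0)
        (Eventually.of_forall fun y => continuousAt_const) ?_ ?_
      · have h3 : ∀ᶠ q : ℂ × F in 𝓝 (0, y), ‖q.1‖ < 1 :=
          ContinuousAt.eventually_lt (by fun_prop) (by fun_prop) (by simp)
        filter_upwards [hS.mem_nhds h0, h3] with q hq hq1 hq0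
        refine hf q hq ?_
        rintro ⟨l, hl⟩
        rw [hl, Complex.norm_intCast] at hq1
        have h4 : |l| < 1 := by exact_mod_cast hq1
        exact hq0 (by rw [hl, Int.abs_lt_one_iff.1 h4, Int.cast_zero])
      · have h3 : ∀ᶠ y' in 𝓝 y, ((0 : ℂ), y') ∈ S :=
          (by fun_prop : Continuous fun y' : F => ((0 : ℂ), y')).continuousAt.eventually
            (hS.mem_nhds h0)
        exact h3.mono fun y' hy' => hlim y' hy'
    have h2 : f = fun q => f (q.1 + (-k : ℤ), q.2) := by
      funext q
      rw [hper]
    rw [h2]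
    have h3 : ((w, y).1 + ((-k : ℤ) : ℂ), (w, y).2) = ((0 : ℂ), y) := by simp [hk]
    have h4 : DifferentiableAt ℂ f ((w, y).1 + ((-k : ℤ) : ℂ), (w, y).2) := by rwa [h3]
    exact h4.comp (w, y) (f := fun q : ℂ × F => (q.1 + ((-k : ℤ) : ℂ), q.2)) (by fun_prop)
  · exact hf q hq h

theorem isOpen_setOf_notMem_lattice :
    IsOpen {q : ℂ × ℂ × ℂ | |q.1.im| < q.2.2.im ∧ q.2.1 ∉ lattice q.2.2} := by
  rw [isOpen_iff_mem_nhds]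
  rintro q ⟨h1, h2⟩
  have hτ : 0 < q.2.2.im := (abs_nonneg _).trans_lt h1
  have h3 : ∀ᶠ q : ℂ × ℂ × ℂ in 𝓝 q, |q.1.im| < q.2.2.im :=
    ContinuousAt.eventually_lt (by fun_prop) (by fun_prop) h1
  filter_upwards [h3, continuous_snd.continuousAt.eventually
    (eventually_notMem_lattice_prod hτ h2)] with q hq hq'
  exact ⟨hq, hq'.2⟩

theorem differentiableAt_edgeFun {q : ℂ × ℂ × ℂ} (hw : |q.1.im| < q.2.2.im)
    (ht : q.2.1 ∉ lattice q.2.2) :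
    DifferentiableAt ℂ (fun q : ℂ × ℂ × ℂ => edgeFun q.2.2 q.1 q.2.1) q := by
  refine differentiableAt_of_periodic_of_tendsto
    (f := fun q : ℂ × ℂ × ℂ => edgeFun q.2.2 q.1 q.2.1) isOpen_setOf_notMem_lattice ?_
    (fun k w y => edgeFun_add_int k _) ?_ ?_ (q := q) ⟨hw, ht⟩
  · rintro q ⟨h1, h2⟩ hint
    have hτ : 0 < q.2.2.im := (abs_nonneg _).trans_lt h1
    have h3 : q.1 ∉ lattice q.2.2 := fun h => hint (exists_int_eq_of_mem_lattice h1 h)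
    have h4 : DifferentiableAt ℂ (fun q : ℂ × ℂ × ℂ =>
        (expTwoPi q.1 - 1) * sigma q.2.2 q.1 q.2.1) q :=
      (((differentiable_expTwoPi q.1).comp q differentiableAt_fst).sub_const 1).mul
        (differentiableAt_sigma hτ h2 h3)
    refine h4.congr_of_eventuallyEq ?_
    filter_upwards [isOpen_setOf_notMem_lattice.mem_nhds ⟨h1, h2⟩,
      (by fun_prop : Continuous fun q : ℂ × ℂ × ℂ => (q.1, q.2.2)).continuousAt.eventually
        (eventually_notMem_lattice_prod (p := (q.1, q.2.2)) hτ h3)] with p hp hp'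
    exact if_neg fun ⟨k, hk⟩ => hp'.2 (by rw [hk]; exact int_mem_lattice _ k)
  · rintro k w y ⟨h1, h2⟩
    have h3 : |(w + k).im| < y.2.im := by simpa using h1
    exact ⟨h3, h2⟩
  · rintro y ⟨h1, h2⟩
    have hτ : 0 < y.2.im := (abs_nonneg _).trans_lt h1
    have h3 : y.1 ∉ lattice y.2 := h2
    have h4 := tendsto_edgeFun hτ h3
    simpa only using h4

theorem differentiableAt_sub_kernelFun {q : ℂ × ℂ × ℂ × ℂ} (hw : |q.1.im| < q.2.2.2.im)
    (ht : q.2.1 ∉ lattice q.2.2.2) (hs : q.2.2.1 ∉ lattice q.2.2.2) :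
    DifferentiableAt ℂ (fun q : ℂ × ℂ × ℂ × ℂ =>
      kernelFun q.2.2.2 q.1 q.2.1 - kernelFun q.2.2.2 q.1 q.2.2.1) q := by
  have c1 : Continuous fun q : ℂ × ℂ × ℂ × ℂ => (q.1, q.2.1, q.2.2.2) := by fun_prop
  have c2 : Continuous fun q : ℂ × ℂ × ℂ × ℂ => (q.1, q.2.2.1, q.2.2.2) := by fun_prop
  have hS : IsOpen {q : ℂ × ℂ × ℂ × ℂ | |q.1.im| < q.2.2.2.im ∧ q.2.1 ∉ lattice q.2.2.2 ∧
      q.2.2.1 ∉ lattice q.2.2.2} := by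
    convert (isOpen_setOf_notMem_lattice.preimage c1).inter
      (isOpen_setOf_notMem_lattice.preimage c2) using 1
    ext q
    exact ⟨fun h => ⟨⟨h.1, h.2.1⟩, h.1, h.2.2⟩, fun h => ⟨h.1.1, h.1.2, h.2.2⟩⟩
  refine differentiableAt_of_periodic_of_tendsto (f := fun q : ℂ × ℂ × ℂ × ℂ =>
    kernelFun q.2.2.2 q.1 q.2.1 - kernelFun q.2.2.2 q.1 q.2.2.1) hS ?_
    (fun k w y => by simp only [kernelFun_add_int]) ?_ ?_ (q := q) ⟨hw, ht, hs⟩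
  · rintro q ⟨h1, h2, h2'⟩ hint
    have hτ : 0 < q.2.2.2.im := (abs_nonneg _).trans_lt h1
    have h3 : q.1 ∉ lattice q.2.2.2 := fun h => hint (exists_int_eq_of_mem_lattice h1 h)
    have h4 : DifferentiableAt ℂ (fun q : ℂ × ℂ × ℂ × ℂ => sigma q.2.2.2 q.1 q.2.1) q :=
      (differentiableAt_sigma (q := (q.1, q.2.1, q.2.2.2)) hτ h2 h3).comp q
        (f := fun q : ℂ × ℂ × ℂ × ℂ => (q.1, q.2.1, q.2.2.2)) (by fun_prop)
    have h5 : DifferentiableAt ℂ (fun q : ℂ × ℂ × ℂ × ℂ => sigma q.2.2.2 q.1 q.2.2.1) q :=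
      (differentiableAt_sigma (q := (q.1, q.2.2.1, q.2.2.2)) hτ h2' h3).comp q
        (f := fun q : ℂ × ℂ × ℂ × ℂ => (q.1, q.2.2.1, q.2.2.2)) (by fun_prop)
    refine (h4.sub h5).congr_of_eventuallyEq ?_
    filter_upwards [(by fun_prop : Continuous fun q : ℂ × ℂ × ℂ × ℂ =>
      (q.1, q.2.2.2)).continuousAt.eventually
        (eventually_notMem_lattice_prod (p := (q.1, q.2.2.2)) hτ h3)] with p hp
    have h6 : ¬∃ k : ℤ, p.1 = k := fun ⟨k, hk⟩ =>
      hp.2 (by rw [hk]; exact int_mem_lattice _ k)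
    simp only [kernelFun_of_not_int h6, Pi.sub_apply]
  · rintro k w y ⟨h1, h2, h2'⟩
    have h3 : |(w + k).im| < y.2.2.im := by simpa using h1
    exact ⟨h3, h2, h2'⟩
  · rintro y ⟨h1, h2, h2'⟩
    have hτ : 0 < y.2.2.im := (abs_nonneg _).trans_lt h1
    have h3 : y.1 ∉ lattice y.2.2 := h2
    have h4 : y.2.1 ∉ lattice y.2.2 := h2'
    have h5 := tendsto_sub_kernelFun hτ h3 h4
    simpa only using h5

theorem iteratedDeriv_succ_sub_const (f : ℂ → ℂ) (a : ℂ) (m : ℕ) :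
    iteratedDeriv (m + 1) (fun t => f t - a) = iteratedDeriv (m + 1) f := by
  rw [iteratedDeriv_succ', iteratedDeriv_succ']
  congr 1
  funext t
  exact deriv_sub_const _

variable {n : ℕ} [NeZero n]

/-- The explicit functions are holomorphic in all variables. -/
theorem differentiableAt_basisFun (m : ℕ) (l : Fin n) {q : ℂ × Conf n × ℂ}
    (hw : |q.2.2.im| < q.2.1.2.im) (ht : q.1 ∈ fibreRegular q.2.1) :
    DifferentiableAt ℂ (fun q : ℂ × Conf n × ℂ => basisFun q.2.1 q.2.2 m l q.1) q := by
  have hz : ∀ i, DifferentiableAt ℂ (fun q : ℂ × Conf n × ℂ => q.1 - q.2.1.1 i) q := fun i =>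
    have h : DifferentiableAt ℂ (fun q : ℂ × Conf n × ℂ => q.2.1.1) q := by fun_prop
    differentiableAt_fst.sub (differentiableAt_pi.1 h i)
  have hτ : DifferentiableAt ℂ (fun q : ℂ × Conf n × ℂ => q.2.1.2) q := by fun_prop
  have hwd : DifferentiableAt ℂ (fun q : ℂ × Conf n × ℂ => q.2.2) q := by fun_prop
  cases m with
  | zero =>
    by_cases hl : l = 0
    · subst hl
      have e : ∀ q : ℂ × Conf n × ℂ, basisFun q.2.1 q.2.2 0 0 q.1 =
          edgeFun q.2.1.2 q.2.2 (q.1 - q.2.1.1 0) := fun q => by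
        by_cases h : ∃ k : ℤ, q.2.2 = k
        · rw [basisFun_zero_zero_of_int h, edgeFun, if_pos h]
        · rw [basisFun_zero_zero_of_not_int h, edgeFun, if_neg h, kernelFun_of_not_int h]
      simp only [e]
      exact (differentiableAt_edgeFun (q := (q.2.2, q.1 - q.2.1.1 0, q.2.1.2)) hw (ht 0)).comp q
        (f := fun q : ℂ × Conf n × ℂ => (q.2.2, q.1 - q.2.1.1 0, q.2.1.2))
        (hwd.prodMk ((hz 0).prodMk hτ))
    · simp only [basisFun_zero hl]
      exact (differentiableAt_sub_kernelFun (q := (q.2.2, q.1 - q.2.1.1 l, q.1 - q.2.1.1 0,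
        q.2.1.2)) hw (ht l) (ht 0)).comp q
        (f := fun q : ℂ × Conf n × ℂ => (q.2.2, q.1 - q.2.1.1 l, q.1 - q.2.1.1 0, q.2.1.2))
        (hwd.prodMk ((hz l).prodMk ((hz 0).prodMk hτ)))
  | succ m =>
    set s : ℂ := q.1 - q.2.1.1 l with hs
    -- The kernel itself has a pole in `w` at the integers. Subtracting its value at the frozen
    -- point `s` makes it jointly holomorphic, and derivatives in `t` of positive order do not see
    -- the subtracted term.
    set f : ℂ × ℂ × ℂ → ℂ := fun p => kernelFun p.2.2 p.2.1 p.1 - kernelFun p.2.2 p.2.1 s with hf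
    have hev : ∀ᶠ p in 𝓝 (s, q.2.2, q.2.1.2), DifferentiableAt ℂ f p := by
      have c1 : Continuous fun p : ℂ × ℂ × ℂ => (p.2.1, p.1, p.2.2) := by fun_prop
      have c2 : Continuous fun p : ℂ × ℂ × ℂ => (p.2.1, s, p.2.2) := by fun_prop
      have hS : ((q.2.2, s, q.2.1.2) : ℂ × ℂ × ℂ) ∈
          {q : ℂ × ℂ × ℂ | |q.1.im| < q.2.2.im ∧ q.2.1 ∉ lattice q.2.2} := ⟨hw, ht l⟩
      have h1 := (c1.tendsto (s, q.2.2, q.2.1.2)).eventually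
        (isOpen_setOf_notMem_lattice.mem_nhds hS)
      have h2 := (c2.tendsto (s, q.2.2, q.2.1.2)).eventually
        (isOpen_setOf_notMem_lattice.mem_nhds hS)
      filter_upwards [h1, h2] with p hp1 hp2
      exact (differentiableAt_sub_kernelFun (q := (p.2.1, p.1, s, p.2.2)) hp1.1 hp1.2 hp2.2).comp p
        (f := fun p : ℂ × ℂ × ℂ => (p.2.1, p.1, s, p.2.2)) (by fun_prop)
    have h1 := differentiableAt_iteratedDeriv_fst (m + 1) hev
    simp only [hf, iteratedDeriv_succ_sub_const (kernelFun _ _)] at h1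
    simp only [basisFun_succ]
    exact h1.comp q (f := fun q : ℂ × Conf n × ℂ => (q.1 - q.2.1.1 l, q.2.2, q.2.1.2))
      ((hz l).prodMk (hwd.prodMk hτ))

/-- The explicit functions are the limits of the generic formulas. -/
theorem tendsto_genericFun {c : Conf n} (hw : |w.im| < c.2.im) (m : ℕ) (l : Fin n) {t : ℂ}
    (ht : t ∈ fibreRegular c) :
    Tendsto (fun w' => genericFun c w' m l t) (𝓝[≠] w) (𝓝 (basisFun c w m l t)) := by
  -- Joint holomorphy already contains the limit statement, because the generic and completed
  -- formulas agree on a punctured neighbourhood of `w`.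
  have h1 : ContinuousAt (fun w' => basisFun c w' m l t) w :=
    (differentiableAt_basisFun (q := (t, c, w)) m l hw ht).continuousAt.comp
      (f := fun w' : ℂ => (t, c, w')) (by fun_prop)
  have h2 : ∀ᶠ w' : ℂ in 𝓝[≠] w, ¬∃ k : ℤ, w' = k := by
    by_cases h : ∃ k : ℤ, w = k
    · obtain ⟨k, rfl⟩ := h
      have h3 := tendsto_sub_nhdsNE (k : ℂ) k
      rw [sub_self] at h3
      filter_upwards [h3.eventually eventually_not_int] with w' hw'
      rintro ⟨l, rfl⟩
      exact hw' ⟨l - k, by push_cast; rfl⟩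
    · have hτ : 0 < c.2.im := (abs_nonneg _).trans_lt hw
      have h3 : w ∉ lattice c.2 := fun hmem => h (exists_int_eq_of_mem_lattice hw hmem)
      filter_upwards [nhdsWithin_le_nhds (eventually_nhds_notMem_lattice hτ h3)] with w' hw'
      rintro ⟨k, rfl⟩
      exact hw' (int_mem_lattice _ k)
  refine (h1.tendsto.mono_left nhdsWithin_le_nhds).congr' ?_
  filter_upwards [h2] with w' hw'
  simp only [basisFun, if_neg hw']

end

noncomputable section

/-! ### Scalar sections -/

variable {E : Type*} [NormedAddCommGroup E] [NormedSpace ℂ E] {n : ℕ} {κ : E → Conf n}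
  {w : E → ℂ} {U V : Opens E} {j : ℕ} {f : ℂ × E → ℂ}

theorem isOpen_regularSet (hκ : Continuous κ) (hU : ∀ x ∈ U, κ x ∈ ellipticConf n) :
    IsOpen (regularSet κ U) := by
  rw [isOpen_iff_mem_nhds]
  rintro ⟨t, x⟩ ⟨hx, ht⟩
  have h1 : ∀ᶠ p : ℂ × E in 𝓝 (t, x), p.2 ∈ U :=
    continuous_snd.continuousAt.eventually (U.isOpen.mem_nhds hx)
  have h2 : ∀ᶠ p : ℂ × E in 𝓝 (t, x), ∀ i, p.1 - (κ p.2).1 i ∉ lattice (κ p.2).2 := by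
    refine eventually_all.2 fun i => ?_
    have hc : Continuous fun p : ℂ × E => (p.1 - (κ p.2).1 i, (κ p.2).2) := by fun_prop
    exact ((hc.tendsto (t, x)).eventually
      (eventually_notMem_lattice_prod (hU x hx).1 (ht i))).mono fun p hp => hp.2
  filter_upwards [h1, h2] with p hp1 hp2
  exact ⟨hp1, hp2⟩

variable (κ w U j f) in
/-- Holomorphic functions of `(t, x)`, which are quasi-periodic in `t` for each `x ∈ U`. -/
structure ScalarSection : Prop where
  differentiableAt : ∀ p ∈ regularSet κ U, DifferentiableAt ℂ f p
  quasiPeriodic : ∀ x ∈ U, QuasiPeriodic (κ x) (w x) j (fun t => f (t, x))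

/-- The pole bound in each fibre becomes a joint one by removing the singularities of `(t - z_i - r
- s τ) ^ j f` along the graph of the moving pole. -/
theorem ScalarSection.hasPolesLE [FiniteDimensional ℂ E] (hκ : Differentiable ℂ κ)
    (hU : ∀ x ∈ U, κ x ∈ ellipticConf n) (hf : ScalarSection κ w U j f) :
    HasPolesLE κ U j f := by
  refine ⟨fun p hp => (hf.differentiableAt p hp).differentiableWithinAt, fun x hx i r s => ?_⟩
  have hz : ∀ l, Differentiable ℂ fun y => (κ y).1 l := fun l =>
    differentiable_pi.1 hκ.fst l
  have hzc := fun l => (hz l).continuous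
  have hτ : Differentiable ℂ fun y => (κ y).2 := hκ.snd
  have hκc := hκ.continuous
  set h : E → ℂ := fun y => (κ y).1 i + r + s * (κ y).2 with hh
  have hhd : Differentiable ℂ h := ((hz i).add_const _).add (hτ.const_mul _)
  have hlat : ∀ y, (r + s * (κ y).2 : ℂ) ∈ lattice (κ y).2 := fun y => ⟨r, s, rfl⟩
  have e1 : ∀ᶠ p : ℂ × E in 𝓝 (h x, x), p.2 ∈ U :=
    continuous_snd.continuousAt.eventually (U.isOpen.mem_nhds hx)
  -- Near `(h x, x)` the singular locus is the graph of `h` alone: this line excludes other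
  -- translates of `z_i`, the next one the translates of the other points.
  have e2 : ∀ᶠ p : ℂ × E in 𝓝 (h x, x), p.1 - h p.2 ∈ lattice (κ p.2).2 → p.1 - h p.2 = 0 := by
    have hc : Continuous fun p : ℂ × E => (p.1 - h p.2, (κ p.2).2) := by fun_prop
    have h1 := hc.tendsto (h x, x)
    simp only [sub_self] at h1
    exact h1.eventually (eventually_eq_zero_of_mem_lattice (hU x hx).1)
  have e3 : ∀ᶠ p : ℂ × E in 𝓝 (h x, x), ∀ l, l ≠ i → p.1 - (κ p.2).1 l ∉ lattice (κ p.2).2 := by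
    refine eventually_all.2 fun l => ?_
    by_cases hl : l = i
    · exact Eventually.of_forall fun p h => absurd hl h
    have hc : Continuous fun p : ℂ × E => (p.1 - (κ p.2).1 l, (κ p.2).2) := by fun_prop
    have h2 : h x - (κ x).1 l ∉ lattice (κ x).2 := by
      have h3 := (add_mem_lattice_iff (hlat x)).not.2 ((hU x hx).2 i l (Ne.symm hl))
      have e : h x - (κ x).1 l = (κ x).1 i - (κ x).1 l + (r + s * (κ x).2) := by
        simp only [hh]; ring
      rwa [e]
    exact ((hc.tendsto (h x, x)).eventually
      (eventually_notMem_lattice_prod (hU x hx).1 h2)).mono fun p hp _ => hp.2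
  have hreg : ∀ᶠ p : ℂ × E in 𝓝 (h x, x), p.1 ≠ h p.2 → p ∈ regularSet κ U := by
    filter_upwards [e1, e2, e3] with p h1 h2 h3 hne
    refine ⟨h1, fun l => ?_⟩
    by_cases hl : l = i
    · subst hl
      intro h4
      rw [← add_mem_lattice_iff (neg_mem_lattice (hlat p.2))] at h4
      refine hne (sub_eq_zero.1 (h2 ?_))
      convert h4 using 1
      simp only [hh]; ring
    · exact h3 l hl
  have hd : Differentiable ℂ fun p : ℂ × E =>
      (p.1 - (κ p.2).1 i - r - s * (κ p.2).2) ^ j := by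
    have h1 : Differentiable ℂ fun p : ℂ × E => (κ p.2).1 i := (hz i).comp differentiable_snd
    have h2 : Differentiable ℂ fun p : ℂ × E => (κ p.2).2 := hτ.comp differentiable_snd
    fun_prop
  obtain ⟨G, hG⟩ := exists_differentiableAt_of_tendsto
    (f := fun p : ℂ × E => (p.1 - (κ p.2).1 i - r - s * (κ p.2).2) ^ j * f p) (h := h) (y₀ := x)
    (Eventually.of_forall fun y => hhd.continuous.continuousAt)
    (by
      filter_upwards [hreg] with p hp hne
      exact (hd p).fun_mul (hf.differentiableAt p (hp hne)))
    (by
      filter_upwards [U.isOpen.mem_nhds hx] with y hy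
      exact (hf.quasiPeriodic y hy).tendsto_translate (hU y hy).1 i r s)
  refine ⟨G, hG.mono fun p hp => ⟨hp.1, fun hreg => hp.2.1 fun hne => hreg.2 i ?_⟩⟩
  rw [hne]
  convert hlat p.2 using 1
  simp only [hh]; ring

/-- Restriction of the local extension to a fibre gives the limit; the translates with `r = s = 0`
are enough. -/
theorem ScalarSection.of_hasPolesLE (hκ : Continuous κ) (hU : ∀ x ∈ U, κ x ∈ ellipticConf n)
    (hf : HasPolesLE κ U j f)
    (hf1 : ∀ t x, (t, x) ∈ regularSet κ U → f (t + 1, x) = f (t, x))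
    (hf2 : ∀ t x, (t, x) ∈ regularSet κ U → f (t + (κ x).2, x) = expTwoPi (w x) * f (t, x)) :
    ScalarSection κ w U j f := by
  have hd : ∀ p ∈ regularSet κ U, DifferentiableAt ℂ f p := fun p hp =>
    (hf.1 p hp).differentiableAt ((isOpen_regularSet hκ hU).mem_nhds hp)
  refine ⟨hd, fun x hx => ⟨fun t ht => ?_, fun t ht => hf1 t x ⟨hx, ht⟩,
    fun t ht => hf2 t x ⟨hx, ht⟩, fun i => ?_⟩⟩
  · exact (hd (t, x) ⟨hx, ht⟩).comp t (f := fun t : ℂ => (t, x)) (by fun_prop)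
  · obtain ⟨G, hG⟩ := hf.2 x hx i 0 0
    simp only [Int.cast_zero, zero_mul, add_zero, sub_zero] at hG
    have hc : Continuous fun t : ℂ => (t, x) := by fun_prop
    refine ⟨G ((κ x).1 i, x), ?_⟩
    have h1 : Tendsto (fun t => G (t, x)) (𝓝[≠] (κ x).1 i) (𝓝 (G ((κ x).1 i, x))) :=
      ((hG.self_of_nhds.1.continuousAt.tendsto.comp
        (hc.tendsto ((κ x).1 i))).mono_left nhdsWithin_le_nhds)
    refine h1.congr' ?_
    filter_upwards [nhdsWithin_le_nhds ((hc.tendsto ((κ x).1 i)).eventually hG),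
      eventually_mem_fibreRegular (hU x hx).1 ((κ x).1 i)] with t ht ht'
    exact (ht.2 ⟨hx, ht'⟩).symm

theorem ScalarSection.zero : ScalarSection κ w U j (fun _ => 0) :=
  ⟨fun _ _ => differentiableAt_const 0, fun _ _ => QuasiPeriodic.zero⟩

theorem ScalarSection.mul_sum {K : Type*} [Fintype K] {a : K → E → ℂ} {g : K → ℂ × E → ℂ}
    (ha : ∀ k, DifferentiableOn ℂ (a k) U) (hg : ∀ k, ScalarSection κ w U j (g k)) :
    ScalarSection κ w U j (fun p => ∑ k, a k p.2 * g k p) := by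
  refine ⟨fun p hp => ?_, fun x hx => ?_⟩
  · refine DifferentiableAt.fun_sum fun k _ => DifferentiableAt.fun_mul ?_
      ((hg k).differentiableAt p hp)
    exact ((ha k).differentiableAt (U.isOpen.mem_nhds hp.1)).comp p differentiableAt_snd
  · exact QuasiPeriodic.sum _ fun k _ => ((hg k).quasiPeriodic x hx).const_mul (a k x)

variable (κ w V j) in
/-- A finite basis of the module of scalar sections, uniformly in the fibres. -/
structure IsScalarBasis {K : Type*} [Fintype K] (g : K → ℂ × E → ℂ) : Prop where
  scalarSection : ∀ k, ScalarSection κ w V j (g k)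
  eq_zero : ∀ x ∈ V, ∀ a : K → ℂ, (∀ t ∈ fibreRegular (κ x), ∑ k, a k * g k (t, x) = 0) → a = 0
  exists_eq_sum : ∀ f, ScalarSection κ w V j f → ∃ a : K → E → ℂ,
    (∀ k, DifferentiableOn ℂ (a k) V) ∧ ∀ p ∈ regularSet κ V, f p = ∑ k, a k p.2 * g k p

/-! ### Choosing evaluation points -/

/-- Finitely many linearly independent functions have a non-zero evaluation determinant. -/
theorem exists_det_ne_zero {K T : Type*} [Fintype K] [DecidableEq K] (v : K → T → ℂ)
    (hv : ∀ a : K → ℂ, (∀ t, ∑ k, a k * v k t = 0) → a = 0) :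
    ∃ t : K → T, (Matrix.of fun i k => v k (t i)).det ≠ 0 := by
  set ev : T → K → ℂ := fun t k => v k t with hev
  -- A functional killing all evaluation vectors would be a linear relation between the functions. A
  -- basis extracted from these vectors provides the evaluation points.
  have htop : Submodule.span ℂ (Set.range ev) = ⊤ := by
    by_contra hne
    obtain ⟨φ, hφ, hle⟩ := Submodule.exists_le_ker_of_lt_top _ (lt_top_iff_ne_top.2 hne)
    refine hφ ?_
    have h1 := hv (fun k => φ (Pi.single k 1)) fun t => by
      have h2 : φ (ev t) = 0 := hle (Submodule.subset_span ⟨t, rfl⟩)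
      rw [LinearMap.pi_apply_eq_sum_univ φ] at h2
      rw [← h2]
      refine Finset.sum_congr rfl fun k _ => ?_
      rw [smul_eq_mul, mul_comm]
      congr 2
      funext l
      simp [Pi.single_apply, eq_comm]
    refine LinearMap.pi_ext' fun k => LinearMap.ext_ring ?_
    simpa using congrFun h1 k
  obtain ⟨b, hb, hspan, hli⟩ := exists_linearIndependent ℂ (Set.range ev)
  have hB : ⊤ ≤ Submodule.span ℂ (Set.range (Subtype.val : b → K → ℂ)) := by
    rw [Subtype.range_coe, hspan, htop]
  set B := Basis.mk hli hB with hBdef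
  let e : K ≃ b := (Pi.basisFun ℂ K).indexEquiv B
  choose t ht using fun i : K => hb (e i).2
  refine ⟨t, ?_⟩
  have h1 : LinearIndependent ℂ (Matrix.of fun i k => v k (t i)).row := by
    have h2 := hli.comp e e.injective
    have h3 : (Matrix.of fun i k => v k (t i)).row = Subtype.val ∘ e := funext ht
    rwa [h3]
  exact ((Matrix.isUnit_iff_isUnit_det _).1 (Matrix.linearIndependent_rows_iff_isUnit.1 h1)).ne_zero

theorem differentiableAt_det {K : Type*} [Fintype K] [DecidableEq K] {M : E → Matrix K K ℂ} {x : E}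
    (hM : ∀ i k, DifferentiableAt ℂ (fun x => M x i k) x) :
    DifferentiableAt ℂ (fun x => (M x).det) x := by
  simp only [Matrix.det_apply]
  refine DifferentiableAt.fun_sum fun σ _ => DifferentiableAt.fun_const_smul ?_ _
  exact (HasFDerivAt.finsetProd fun i _ => (hM (σ i) i).hasFDerivAt).differentiableAt

/-- The coefficients of a scalar section in a family of scalar sections are holomorphic, as soon as
the family is pointwise linearly independent. -/
theorem differentiableOn_of_eq_sum {K : Type*} [Fintype K] (hκ : Continuous κ)
    (hV : ∀ x ∈ V, κ x ∈ ellipticConf n) {g : K → ℂ × E → ℂ} {a : K → E → ℂ}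
    (hg : ∀ k, ∀ p ∈ regularSet κ V, DifferentiableAt ℂ (g k) p)
    (hzero : ∀ x ∈ V, ∀ a : K → ℂ, (∀ t ∈ fibreRegular (κ x), ∑ k, a k * g k (t, x) = 0) → a = 0)
    (hf : ∀ p ∈ regularSet κ V, DifferentiableAt ℂ f p)
    (ha : ∀ p ∈ regularSet κ V, f p = ∑ k, a k p.2 * g k p) (k : K) :
    DifferentiableOn ℂ (a k) V := by
  classical
  intro x hx
  refine DifferentiableAt.differentiableWithinAt ?_
  -- The evaluation points are chosen at `x` and then frozen; for `y` near `x` they remain regular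
  -- and the determinant stays non-zero.
  obtain ⟨t, ht⟩ := exists_det_ne_zero (T := fibreRegular (κ x)) (fun k t => g k (t, x))
    fun a ha => hzero x hx a fun t ht => ha ⟨t, ht⟩
  have hc : ∀ i, Continuous fun y : E => (((t i : ℂ), y) : ℂ × E) := fun i => by fun_prop
  have hpt : ∀ h : ℂ × E → ℂ, (∀ p ∈ regularSet κ V, DifferentiableAt ℂ h p) → ∀ i,
      DifferentiableAt ℂ (fun y => h ((t i : ℂ), y)) x := fun h hh i =>
    (hh ((t i : ℂ), x) ⟨hx, (t i).2⟩).comp x (f := fun y : E => (((t i : ℂ), y) : ℂ × E))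
      (by fun_prop)
  set M : E → Matrix K K ℂ := fun y => Matrix.of fun i k => g k ((t i : ℂ), y) with hM
  have hMd : ∀ i k, DifferentiableAt ℂ (fun y => M y i k) x := fun i k => hpt _ (hg k) i
  have hdet := differentiableAt_det hMd
  have hnum : DifferentiableAt ℂ
      (fun y => ((M y).updateCol k fun i => f ((t i : ℂ), y)).det) x := by
    refine differentiableAt_det fun i l => ?_
    by_cases hl : l = k
    · subst hl
      simpa only [Matrix.updateCol_self] using hpt f hf i
    · simpa only [Matrix.updateCol_ne hl] using hMd i l
  have hreg : ∀ᶠ y in 𝓝 x, ∀ i, ((t i : ℂ), y) ∈ regularSet κ V :=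
    eventually_all.2 fun i => ((hc i).tendsto x).eventually
      ((isOpen_regularSet hκ hV).mem_nhds ⟨hx, (t i).2⟩)
  refine (hnum.fun_mul (hdet.fun_inv ht)).congr_of_eventuallyEq ?_
  filter_upwards [hreg, hdet.continuousAt.eventually_ne ht] with y hy hne
  have h1 : (fun i => f ((t i : ℂ), y)) = (M y).mulVec fun k => a k y := by
    funext i
    rw [ha _ (hy i)]
    exact Finset.sum_congr rfl fun k _ => mul_comm _ _
  -- Cramer's rule: near `x` the coefficient is a quotient of two determinants with holomorphic
  -- entries.
  rw [← Matrix.cramer_apply, h1, Matrix.cramer_eq_adjugate_mulVec, Matrix.mulVec_mulVec,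
    Matrix.adjugate_mul, Matrix.smul_mulVec, Matrix.one_mulVec, Pi.smul_apply, smul_eq_mul]
  field_simp

end

noncomputable section

/-! ### Bases of the modules of scalar sections -/

/-- The explicit functions, transported by a translation `w ↦ w - s τ`. -/
def shiftedBasisFun {n : ℕ} [NeZero n] (s : ℤ) (c : Conf n) (w : ℂ) (m : ℕ) (l : Fin n) (t : ℂ) :
    ℂ :=
  expTwoPi (s * t) * basisFun c (w - s * c.2) m l t

theorem shiftedBasisFun_zero {n : ℕ} [NeZero n] (c : Conf n) (w : ℂ) (m : ℕ) (l : Fin n) (t : ℂ) :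
    shiftedBasisFun 0 c w m l t = basisFun c w m l t := by
  simp [shiftedBasisFun, expTwoPi_zero]

/-- The exponential `expTwoPi (s * t)` has multipliers `1` and `expTwoPi (s * τ)` and neither zeros
nor poles. It serves to bring `w` into the strip. -/
theorem QuasiPeriodic.expTwoPi_mul {n : ℕ} {c : Conf n} {w : ℂ} {j : ℕ} {f : ℂ → ℂ}
    (hf : QuasiPeriodic c w j f) (s : ℤ) :
    QuasiPeriodic c (w + s * c.2) j (fun t => expTwoPi (s * t) * f t) where
  differentiableAt t ht := ((differentiable_expTwoPi _).comp t (f := fun t : ℂ => (s * t : ℂ))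
    (by fun_prop)).fun_mul (hf.differentiableAt t ht)
  add_one t ht := by
    rw [hf.add_one t ht, mul_add, mul_one, expTwoPi_add, expTwoPi_int, mul_one]
  add_self t ht := by
    rw [hf.add_self t ht, mul_add, expTwoPi_add, expTwoPi_add]
    ring
  tendsto i := by
    obtain ⟨a, ha⟩ := hf.tendsto i
    have h1 : Continuous fun t : ℂ => expTwoPi (s * t) :=
      differentiable_expTwoPi.continuous.comp (by fun_prop)
    exact ⟨_, (((h1.tendsto (c.1 i)).mono_left nhdsWithin_le_nhds).mul ha).congr fun t => by ring⟩

section Fibre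

variable {n : ℕ} [NeZero n] {c : Conf n} {w : ℂ} {j : ℕ} {s : ℤ}

theorem quasiPeriodic_shiftedBasisFun (hc : c ∈ ellipticConf n)
    (hs : |(w - s * c.2).im| < c.2.im) {m : ℕ} (hm : m < j) (l : Fin n) :
    QuasiPeriodic c w j (shiftedBasisFun s c w m l) := by
  have h := ((quasiPeriodic_basisFun hc hs m l).mono hm).expTwoPi_mul s
  rwa [sub_add_cancel] at h

theorem exists_eq_sum_shiftedBasisFun (hc : c ∈ ellipticConf n)
    (hs : |(w - s * c.2).im| < c.2.im) (hj : 1 ≤ j) {f : ℂ → ℂ} (hf : QuasiPeriodic c w j f) :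
    ∃ a : Fin j × Fin n → ℂ, ∀ t ∈ fibreRegular c,
      f t = ∑ k, a k * shiftedBasisFun s c w k.1 k.2 t := by
  obtain ⟨j, rfl⟩ := Nat.exists_eq_add_of_le' hj
  -- Untwist into the strip, expand there, and twist back.
  have h := hf.expTwoPi_mul (-s)
  rw [Int.cast_neg, neg_mul, ← sub_eq_add_neg] at h
  obtain ⟨a, ha⟩ := exists_eq_sum_basisFun hc hs j h
  refine ⟨fun k => a k.1 k.2, fun t ht => ?_⟩
  have h1 := ha t ht
  rw [neg_mul, expTwoPi_neg, inv_mul_eq_iff_eq_mul₀ (expTwoPi_ne_zero _)] at h1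
  rw [h1, Fintype.sum_prod_type, Finset.sum_range, Finset.mul_sum]
  refine Finset.sum_congr rfl fun m _ => ?_
  rw [Finset.mul_sum]
  refine Finset.sum_congr rfl fun l _ => ?_
  simp only [shiftedBasisFun]
  ring

theorem eq_zero_of_sum_shiftedBasisFun (hc : c ∈ ellipticConf n)
    (hs : |(w - s * c.2).im| < c.2.im) {a : Fin j × Fin n → ℂ}
    (h : ∀ t ∈ fibreRegular c, ∑ k, a k * shiftedBasisFun s c w k.1 k.2 t = 0) : a = 0 := by
  have h1 := eq_zero_of_sum_basisFun hc hs j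
    (a := fun m l => if hm : m < j then a (⟨m, hm⟩, l) else 0) fun t ht => by
      have h2 := h t ht
      rw [Fintype.sum_prod_type] at h2
      rw [Finset.sum_range]
      refine (mul_eq_zero.1 ?_).resolve_left (expTwoPi_ne_zero (s * t))
      rw [← h2, Finset.mul_sum]
      refine Finset.sum_congr rfl fun m _ => ?_
      rw [Finset.mul_sum]
      refine Finset.sum_congr rfl fun l _ => ?_
      simp only [shiftedBasisFun, Fin.is_lt, dif_pos, Fin.eta]
      ring
  funext k
  have h2 := h1 k.1 k.1.2 k.2
  simpa using h2

end Fibre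

variable {E : Type*} [NormedAddCommGroup E] [NormedSpace ℂ E] {n : ℕ} {κ : E → Conf n}
  {w : E → ℂ} {V : Opens E} {j : ℕ} {f g : ℂ × E → ℂ}

theorem ScalarSection.congr (hκ : Continuous κ) (hV : ∀ x ∈ V, κ x ∈ ellipticConf n)
    (hf : ScalarSection κ w V j f) (h : Set.EqOn g f (regularSet κ V)) :
    ScalarSection κ w V j g :=
  ⟨fun p hp => (hf.differentiableAt p hp).congr_of_eventuallyEq
    (h.eventuallyEq_of_mem ((isOpen_regularSet hκ hV).mem_nhds hp)),
  fun x hx => (hf.quasiPeriodic x hx).congr (hV x hx).1 fun t ht => h (x := (t, x)) ⟨hx, ht⟩⟩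

/-- Coefficients exist in each fibre by the classical argument. They are holomorphic because the
family is jointly holomorphic and independent in every fibre. -/
theorem isScalarBasis_shiftedBasisFun [NeZero n] (hκ : Differentiable ℂ κ)
    (hw : Differentiable ℂ w) (hV : ∀ x ∈ V, κ x ∈ ellipticConf n) (s : ℤ)
    (hs : ∀ x ∈ V, |(w x - s * (κ x).2).im| < (κ x).2.im) (hj : 1 ≤ j) :
    IsScalarBasis κ w V j (K := Fin j × Fin n)
      (fun k p => shiftedBasisFun s (κ p.2) (w p.2) k.1 k.2 p.1) := by
  have hτ : Differentiable ℂ fun y => (κ y).2 := hκ.snd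
  have hsec : ∀ k : Fin j × Fin n, ScalarSection κ w V j
      (fun p => shiftedBasisFun s (κ p.2) (w p.2) k.1 k.2 p.1) := by
    intro k
    refine ⟨fun p hp => ?_, fun x hx =>
      quasiPeriodic_shiftedBasisFun (hV x hx) (hs x hx) k.1.2 k.2⟩
    have h1 : DifferentiableAt ℂ (fun p : ℂ × E => (p.1, κ p.2, w p.2 - s * (κ p.2).2)) p := by
      refine differentiableAt_fst.prodMk (DifferentiableAt.prodMk ?_ (DifferentiableAt.fun_sub ?_
        (DifferentiableAt.fun_mul (differentiableAt_const _) ?_)))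
      · exact (hκ p.2).comp p differentiableAt_snd
      · exact (hw p.2).comp p differentiableAt_snd
      · exact (hτ p.2).comp p differentiableAt_snd
    refine ((differentiable_expTwoPi _).comp p (f := fun p : ℂ × E => (s * p.1 : ℂ))
      (by fun_prop)).fun_mul ?_
    exact (differentiableAt_basisFun (q := (p.1, κ p.2, w p.2 - s * (κ p.2).2)) k.1 k.2
      (hs _ hp.1) hp.2).comp p (f := fun p : ℂ × E => (p.1, κ p.2, w p.2 - s * (κ p.2).2)) h1
  have hzero : ∀ x ∈ V, ∀ a : Fin j × Fin n → ℂ, (∀ t ∈ fibreRegular (κ x),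
      ∑ k, a k * shiftedBasisFun s (κ x) (w x) k.1 k.2 t = 0) → a = 0 := fun x hx a ha =>
    eq_zero_of_sum_shiftedBasisFun (hV x hx) (hs x hx) ha
  refine ⟨hsec, hzero, fun f hf => ?_⟩
  choose! a ha using fun x hx =>
    exists_eq_sum_shiftedBasisFun (hV x hx) (hs x hx) hj (hf.quasiPeriodic x hx)
  have ha' : ∀ p ∈ regularSet κ V, f p =
      ∑ k, a p.2 k * shiftedBasisFun s (κ p.2) (w p.2) k.1 k.2 p.1 :=
    fun p hp => ha p.2 hp.1 p.1 hp.2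
  exact ⟨fun k x => a x k, differentiableOn_of_eq_sum hκ.continuous hV
    (fun k => (hsec k).differentiableAt) hzero hf.differentiableAt ha', ha'⟩

theorem exists_mem_fibreRegular {c : Conf n} (hτ : 0 < c.2.im) : ∃ t, t ∈ fibreRegular c :=
  (eventually_mem_fibreRegular hτ 0).exists

/-- For `w = 0`, sections without poles are constant in `t` by Liouville's theorem. -/
theorem isScalarBasis_one (hκ : Continuous κ) (hV : ∀ x ∈ V, κ x ∈ ellipticConf n)
    (hw : ∀ x, w x = 0) : IsScalarBasis κ w V 0 (K := Fin 1) (fun _ _ => 1) := by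
  have hd : ∀ k : Fin 1, ∀ p ∈ regularSet κ V, DifferentiableAt ℂ (fun _ : ℂ × E => (1 : ℂ)) p :=
    fun _ _ _ => differentiableAt_const 1
  have hzero : ∀ x ∈ V, ∀ a : Fin 1 → ℂ, (∀ t ∈ fibreRegular (κ x), ∑ k, a k * 1 = 0) →
      a = 0 := by
    intro x hx a ha
    obtain ⟨t, ht⟩ := exists_mem_fibreRegular (hV x hx).1
    have h := ha t ht
    rw [Fin.sum_univ_one, mul_one] at h
    funext k
    rw [Subsingleton.elim k 0, h, Pi.zero_apply]
  refine ⟨fun k => ⟨hd k, fun x hx => ⟨fun _ _ => differentiableAt_const 1, fun _ _ => rfl,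
    fun _ _ => by rw [hw, expTwoPi_zero, mul_one], fun i => ⟨1, by simp⟩⟩⟩, hzero,
    fun f hf => ?_⟩
  have hex : ∀ x ∈ V, ∃ a, ∀ t ∈ fibreRegular (κ x), f (t, x) = a := by
    intro x hx
    obtain ⟨g, hg, hfg, h1, h2⟩ := (hf.quasiPeriodic x hx).exists_entire (hV x hx).1
    refine ⟨g 0, fun t ht => ?_⟩
    refine (hfg ht).trans ?_
    refine eq_of_elliptic (hV x hx).1 hg h1 (fun t => ?_) _ _
    rw [h2, hw, expTwoPi_zero, one_mul]
  choose! a ha using hex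
  have ha' : ∀ p ∈ regularSet κ V, f p = ∑ _k : Fin 1, a p.2 * 1 := fun p hp => by
    rw [Fin.sum_univ_one, mul_one]
    exact ha p.2 hp.1 p.1 hp.2
  exact ⟨fun _ => a, differentiableOn_of_eq_sum hκ hV hd hzero hf.differentiableAt ha', ha'⟩

/-- A section without poles vanishes in the fibres with `w x` off the lattice. These are dense, so
it vanishes everywhere by continuity, even where the fibre itself contains non-zero functions
without poles. -/
theorem isScalarBasis_empty (hκ : Continuous κ) (hV : ∀ x ∈ V, κ x ∈ ellipticConf n)
    (hw : ∀ W : Opens E, W ≤ V → (W : Set E).Nonempty → ∃ x ∈ W, w x ∉ lattice (κ x).2)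
    (g : Fin 0 → ℂ × E → ℂ) : IsScalarBasis κ w V 0 g := by
  refine ⟨fun k => k.elim0, fun _ _ _ _ => Subsingleton.elim _ _, fun f hf =>
    ⟨fun k => k.elim0, fun k => k.elim0, fun p hp => ?_⟩⟩
  rw [Finset.univ_eq_empty, Finset.sum_empty]
  by_contra hne
  have hc : Continuous fun y : E => (p.1, y) := by fun_prop
  have h0 : ∀ᶠ q in 𝓝 p, q ∈ regularSet κ V := (isOpen_regularSet hκ hV).mem_nhds hp
  have h1 := (hc.tendsto p.2).eventually
    (h0.and ((hf.differentiableAt p hp).continuousAt.eventually_ne hne))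
  obtain ⟨W, hW, hWo, hpW⟩ := eventually_nhds_iff.1 h1
  obtain ⟨x, hx, hlat⟩ := hw ⟨W, hWo⟩ (fun y hy => (hW y hy).1.1) ⟨p.2, hpW⟩
  obtain ⟨⟨hxV, hreg⟩, hne'⟩ := hW x hx
  obtain ⟨g, hg, hfg, h1, h2⟩ := (hf.quasiPeriodic x hxV).exists_entire (hV x hxV).1
  exact hne' ((hfg hreg).trans (eq_zero_of_entire (hV x hxV).1 hlat hg h1 h2 p.1))

theorem IsScalarBasis.reindex {K K' : Type*} [Fintype K] [Fintype K'] {g : K → ℂ × E → ℂ}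
    (hg : IsScalarBasis κ w V j g) (e : K' ≃ K) : IsScalarBasis κ w V j (g ∘ e) := by
  refine ⟨fun k => hg.scalarSection (e k), fun x hx a ha => ?_, fun f hf => ?_⟩
  · have h := hg.eq_zero x hx (a ∘ e.symm) fun t ht => by
      rw [← ha t ht, ← e.sum_comp]
      simp
    funext k
    simpa using congrFun h (e k)
  · obtain ⟨a, ha, hfa⟩ := hg.exists_eq_sum f hf
    refine ⟨a ∘ e, fun k => ha (e k), fun p hp => ?_⟩
    rw [hfa p hp, ← e.sum_comp]
    rfl

variable (κ w j) in
/-- Local freeness of the sheaf of scalar sections. -/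
def IsLocallyScalarFree (S : Set E) (r : ℕ) : Prop :=
  ∀ x ∈ S, ∃ U : Opens E, x ∈ U ∧ (U : Set E) ⊆ S ∧ ∃ g : Fin r → ℂ × E → ℂ,
    ∀ V ≤ U, IsScalarBasis κ w V j g

variable {S : Set E}

/-- Near every point one can translate `w` by a multiple of `τ` into the strip
`|Im w| < Im τ`. -/
theorem exists_shift (hκ : Continuous κ) (hw : Continuous w) (hSo : IsOpen S)
    (hS : ∀ x ∈ S, κ x ∈ ellipticConf n) {x : E} (hx : x ∈ S) :
    ∃ (s : ℤ) (U : Opens E), x ∈ U ∧ (U : Set E) ⊆ S ∧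
      ∀ y ∈ U, |(w y - s * (κ y).2).im| < (κ y).2.im := by
  have hτ := (hS x hx).1
  -- Rounding leaves `|Im (w - s τ)| ≤ Im τ / 2` at `x`, and the strict bound by `Im τ` is an open
  -- condition.
  set s := round ((w x).im / (κ x).2.im) with hs
  have h1 : |(w x - s * (κ x).2).im| < (κ x).2.im := by
    have h2 := abs_sub_round ((w x).im / (κ x).2.im)
    have e : (w x - s * (κ x).2).im = ((w x).im / (κ x).2.im - s) * (κ x).2.im := by
      simp only [Complex.sub_im, Complex.mul_im, Complex.intCast_re, Complex.intCast_im]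
      field_simp
      ring
    rw [e, abs_mul, abs_of_pos hτ]
    nlinarith
  have hopen : IsOpen {y | |(w y - s * (κ y).2).im| < (κ y).2.im} :=
    isOpen_lt (by fun_prop) (by fun_prop)
  exact ⟨s, ⟨S ∩ _, hSo.inter hopen⟩, ⟨hx, h1⟩, Set.inter_subset_left, fun y hy => hy.2⟩

/-- The shift `s` depends on the point, but the number of functions `j * n` does not. -/
theorem isLocallyScalarFree_of_pos [NeZero n] (hκ : Differentiable ℂ κ) (hw : Differentiable ℂ w)
    (hSo : IsOpen S) (hS : ∀ x ∈ S, κ x ∈ ellipticConf n) (hj : 1 ≤ j) :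
    IsLocallyScalarFree κ w j S (j * n) := by
  intro x hx
  obtain ⟨s, U, hxU, hUS, hU⟩ := exists_shift hκ.continuous hw.continuous hSo hS hx
  exact ⟨U, hxU, hUS, _, fun V hV => (isScalarBasis_shiftedBasisFun hκ hw
    (fun y hy => hS y (hUS (hV hy))) s (fun y hy => hU y (hV hy)) hj).reindex
      finProdFinEquiv.symm⟩

theorem isLocallyScalarFree_zero (hκ : Continuous κ) (hSo : IsOpen S)
    (hS : ∀ x ∈ S, κ x ∈ ellipticConf n)
    (hw : (∀ x, w x = 0) ∨
      ∀ W : Opens E, (W : Set E) ⊆ S → (W : Set E).Nonempty → ∃ x ∈ W, w x ∉ lattice (κ x).2) :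
    ∃ r, IsLocallyScalarFree κ w 0 S r := by
  rcases hw with hw | hw
  · exact ⟨1, fun x hx => ⟨⟨S, hSo⟩, hx, subset_rfl, _, fun V hV =>
      isScalarBasis_one hκ (fun y hy => hS y (hV hy)) hw⟩⟩
  · exact ⟨0, fun x hx => ⟨⟨S, hSo⟩, hx, subset_rfl, fun k => k.elim0, fun V hV =>
      isScalarBasis_empty hκ (fun y hy => hS y (hV hy))
        (fun W hW => hw W fun y hy => hV (hW hy)) _⟩⟩

end

noncomputable section

/-! ### Vector-valued sections -/

section HasPolesLE

variable {E : Type*} [NormedAddCommGroup E] [NormedSpace ℂ E] {n : ℕ} {κ : E → Conf n}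
  {U : Opens E} {j : ℕ} {f g : ℂ × E → ℂ}

theorem HasPolesLE.zero : HasPolesLE κ U j (fun _ => 0) :=
  ⟨differentiableOn_const 0, fun _ _ _ _ _ =>
    ⟨fun _ => 0, Eventually.of_forall fun _ => ⟨differentiableAt_const _, fun _ => by simp⟩⟩⟩

theorem HasPolesLE.add (hf : HasPolesLE κ U j f) (hg : HasPolesLE κ U j g) :
    HasPolesLE κ U j (fun p => f p + g p) := by
  refine ⟨hf.1.add hg.1, fun x hx i r s => ?_⟩
  obtain ⟨F, hF⟩ := hf.2 x hx i r s
  obtain ⟨G, hG⟩ := hg.2 x hx i r s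
  refine ⟨fun p => F p + G p, ?_⟩
  filter_upwards [hF, hG] with p hp hp'
  exact ⟨hp.1.fun_add hp'.1, fun h => by rw [mul_add, hp.2 h, hp'.2 h]⟩

theorem HasPolesLE.mul_const (hf : HasPolesLE κ U j f) (a : ℂ) :
    HasPolesLE κ U j (fun p => f p * a) := by
  refine ⟨hf.1.mul_const a, fun x hx i r s => ?_⟩
  obtain ⟨F, hF⟩ := hf.2 x hx i r s
  refine ⟨fun p => F p * a, ?_⟩
  filter_upwards [hF] with p hp
  exact ⟨hp.1.mul_const a, fun h => by rw [← mul_assoc, hp.2 h]⟩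

theorem HasPolesLE.sum {I : Type*} (s : Finset I) {f : I → ℂ × E → ℂ}
    (hf : ∀ i ∈ s, HasPolesLE κ U j (f i)) : HasPolesLE κ U j (fun p => ∑ i ∈ s, f i p) := by
  classical
  induction s using Finset.induction_on with
  | empty => simpa using HasPolesLE.zero
  | insert a s ha ih =>
    simp only [Finset.sum_insert ha]
    exact (hf a (Finset.mem_insert_self a s)).add
      (ih fun i hi => hf i (Finset.mem_insert_of_mem hi))

end HasPolesLE

variable {𝔤 : Type*} [LieRing 𝔤] [LieAlgebra ℂ 𝔤] [FiniteDimensional ℂ 𝔤]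
  {I : Type*} [Fintype I] (b : Basis I ℂ 𝔤)

theorem repr_apply_of_apply_eq_smul {A : Module.End ℂ 𝔤} {μ : I → ℂ}
    (hA : ∀ i, A (b i) = μ i • b i) (v : 𝔤) (i : I) : b.repr (A v) i = μ i * b.repr v i := by
  have h : (b.coord i) ∘ₗ A = μ i • b.coord i := by
    refine b.ext fun k => ?_
    rw [LinearMap.comp_apply, hA, map_smul, LinearMap.smul_apply]
    by_cases hk : k = i
    · rw [hk]
    · rw [b.coord_apply, b.repr_self, Finsupp.single_eq_of_ne (Ne.symm hk), smul_zero, smul_zero]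
  exact LinearMap.congr_fun h v

section Sections

variable {E : Type*} [NormedAddCommGroup E] [NormedSpace ℂ E] {n : ℕ} {κ : E → Conf n}
  {w : I → E → ℂ} {Λ : E → 𝔤} {U V : Opens E} {j : ℕ} {S : Set E}

theorem extend_apply_of_mem (X : regularSet κ V → 𝔤) {p : ℂ × E} (hp : p ∈ regularSet κ V) :
    Function.extend Subtype.val X 0 p = X ⟨p, hp⟩ :=
  Subtype.val_injective.extend_apply X 0 ⟨p, hp⟩

/-- In a basis of eigenvectors of the twist the conditions on a section decouple into its
coordinates. -/
theorem mem_sections_iff [FiniteDimensional ℂ E] (hκ : Differentiable ℂ κ)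
    (hV : ∀ x ∈ V, κ x ∈ ellipticConf n)
    (hΛ : ∀ x i, twist (Λ x) (b i) = expTwoPi (w i x) • b i) {X : regularSet κ V → 𝔤} :
    X ∈ sections κ Λ V j ↔ ∀ i, ScalarSection κ (w i) V j
      (fun p => b.repr (Function.extend Subtype.val X 0 p) i) := by
  constructor
  · rintro ⟨h1, h2⟩ i
    refine ScalarSection.of_hasPolesLE hκ.continuous hV (h1 (b.coord i)) (fun t x hx => ?_)
      fun t x hx => ?_
    · rw [(h2 t x hx).1]
    · rw [(h2 t x hx).2, repr_apply_of_apply_eq_smul b (hΛ x)]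
  · intro h
    refine ⟨fun φ => ?_, fun t x hx => ⟨b.repr.injective ?_, b.repr.injective ?_⟩⟩
    · have e : (fun p => φ (Function.extend Subtype.val X 0 p)) =
          fun p => ∑ i, b.repr (Function.extend Subtype.val X 0 p) i * φ (b i) := by
        funext p
        conv_lhs => rw [← b.sum_repr (Function.extend Subtype.val X 0 p)]
        simp only [map_sum, map_smul, smul_eq_mul]
      rw [e]
      exact HasPolesLE.sum _ fun i _ => ((h i).hasPolesLE hκ hV).mul_const _
    · ext i
      exact ((h i).quasiPeriodic x hx.1).add_one t hx.2
    · ext i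
      rw [repr_apply_of_apply_eq_smul b (hΛ x)]
      exact ((h i).quasiPeriodic x hx.1).add_self t hx.2

theorem sum_smul_mem_sections [FiniteDimensional ℂ E] (hκ : Differentiable ℂ κ)
    (hV : ∀ x ∈ V, κ x ∈ ellipticConf n)
    (hΛ : ∀ x i, twist (Λ x) (b i) = expTwoPi (w i x) • b i) {f : I → ℂ × E → ℂ}
    (hf : ∀ i, ScalarSection κ (w i) V j (f i)) :
    (fun p : regularSet κ V => ∑ i, f i p • b i) ∈ sections κ Λ V j := by
  rw [mem_sections_iff b hκ hV hΛ]
  refine fun i => (hf i).congr hκ.continuous hV fun p hp => ?_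
  rw [extend_apply_of_mem _ hp, b.repr_sum_self]

/-- A function on an open set that is the restriction of a holomorphic function. -/
theorem restrict_mem_holo {a : E → ℂ} (ha : DifferentiableOn ℂ a V) :
    (fun x : V => a x) ∈ holo V :=
  ha.congr fun x hx => Subtype.val_injective.extend_apply (fun x : V => a x) 0 (⟨x, hx⟩ : V)

instance sectionsSMul : SMul (holo V) (sections κ Λ V j) :=
  (inferInstance : Module (holo V) (sections κ Λ V j)).toDistribMulAction.toMulAction.toSMul

theorem exists_basis_of_bijective {R M ι : Type*} [Semiring R] [AddCommMonoid M] [Module R M]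
    [Fintype ι] (e : ι → M) (hinj : ∀ a a' : ι → R, ∑ q, a q • e q = ∑ q, a' q • e q → a = a')
    (hsurj : ∀ x, ∃ a : ι → R, ∑ q, a q • e q = x) : ∃ B : Basis ι R M, ∀ q, B q = e q := by
  classical
  let Φ : (ι → R) ≃ₗ[R] M := LinearEquiv.ofBijective (Fintype.linearCombination R e)
    ⟨fun a a' h => hinj a a' h, hsurj⟩
  refine ⟨Basis.ofEquivFun Φ.symm, fun q => ?_⟩
  rw [Basis.coe_ofEquivFun, LinearEquiv.symm_symm]
  exact (Fintype.linearCombination_apply_single R e q 1).trans (one_smul R _)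

/-- Scalar bases for the coordinates are put together; uniqueness of the coefficients is checked in
each fibre separately. -/
theorem exists_basis_sections [FiniteDimensional ℂ E] (hκ : Differentiable ℂ κ)
    (hV : ∀ x ∈ V, κ x ∈ ellipticConf n)
    (hΛ : ∀ x i, twist (Λ x) (b i) = expTwoPi (w i x) • b i) {K : I → Type*}
    [∀ i, Fintype (K i)] {g : ∀ i, K i → ℂ × E → ℂ}
    (hg : ∀ i, IsScalarBasis κ (w i) V j (g i)) :
    ∃ B : Basis (Σ i, K i) (holo V) (sections κ Λ V j),
      ∀ i k p, (B ⟨i, k⟩ : regularSet κ V → 𝔤) p = g i k p • b i := by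
  classical
  have hmem : ∀ q : Σ i, K i, (fun p : regularSet κ V => g q.1 q.2 p • b q.1) ∈
      sections κ Λ V j := by
    intro q
    have h := sum_smul_mem_sections b hκ hV hΛ
      (f := fun i p => if h : i = q.1 then g i (h ▸ q.2) p else 0) fun i => by
        by_cases h : i = q.1
        · simpa only [dif_pos h] using (hg i).scalarSection _
        · simpa only [dif_neg h] using ScalarSection.zero
    convert h using 1
    funext p
    rw [Finset.sum_eq_single q.1 (fun i _ hi => by rw [dif_neg hi, zero_smul]) (by simp)]
    rw [dif_pos rfl]
  set e : (Σ i, K i) → sections κ Λ V j := fun q => ⟨_, hmem q⟩ with he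
  have hsum : ∀ (a : (Σ i, K i) → holo V) (p : regularSet κ V),
      ((∑ q, a q • e q : sections κ Λ V j) : regularSet κ V → 𝔤) p =
        ∑ i, (∑ k, (a ⟨i, k⟩ : V → ℂ) ⟨p.1.2, p.2.1⟩ * g i k p) • b i := by
    intro a p
    rw [Submodule.coe_sum, Finset.sum_apply, Fintype.sum_sigma]
    refine Finset.sum_congr rfl fun i _ => ?_
    rw [Finset.sum_smul]
    refine Finset.sum_congr rfl fun k _ => ?_
    rw [Submodule.coe_smul, functionModule_smul_apply, mul_smul]
  suffices h : ∃ B : Basis (Σ i, K i) (holo V) (sections κ Λ V j), ∀ q, B q = e q by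
    obtain ⟨B, hB⟩ := h
    exact ⟨B, fun i k p => by rw [hB]⟩
  refine exists_basis_of_bijective (R := holo V) e (fun a a' ha => ?_) fun X => ?_
  · funext ⟨i, k⟩
    refine Subtype.ext (funext fun x => ?_)
    have h1 := (hg i).eq_zero x x.2
      (fun k => (a ⟨i, k⟩ : V → ℂ) x - (a' ⟨i, k⟩ : V → ℂ) x) fun t ht => by
        have h3 := congrArg (fun v => b.repr v i)
          ((hsum a ⟨(t, x), x.2, ht⟩).symm.trans
            ((congrArg (fun Y : sections κ Λ V j => (Y : regularSet κ V → 𝔤) ⟨(t, x), x.2, ht⟩)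
              ha).trans (hsum a' ⟨(t, x), x.2, ht⟩)))
        simp only [b.repr_sum_self] at h3
        simp only [sub_mul, Finset.sum_sub_distrib]
        exact sub_eq_zero.2 h3
    exact sub_eq_zero.1 (congrFun h1 k)
  · have hX := (mem_sections_iff b hκ hV hΛ).1 X.2
    choose a ha hXa using fun i => (hg i).exists_eq_sum _ (hX i)
    refine ⟨fun q => ⟨_, restrict_mem_holo (ha q.1 q.2)⟩, Subtype.ext (funext fun p => ?_)⟩
    refine (hsum _ p).trans ?_
    simp only
    rw [← b.sum_repr ((X : regularSet κ V → 𝔤) p)]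
    refine Finset.sum_congr rfl fun i _ => ?_
    have h := hXa i p p.2
    rw [extend_apply_of_mem _ p.2] at h
    rw [h]

/-- The finitely many neighbourhoods for the coordinates are intersected, and the rank is the sum of
the scalar ranks. -/
theorem isLocallyFreeOfRank [FiniteDimensional ℂ E] (hκ : Differentiable ℂ κ) (hSo : IsOpen S)
    (hS : ∀ x ∈ S, κ x ∈ ellipticConf n)
    (hΛ : ∀ x i, twist (Λ x) (b i) = expTwoPi (w i x) • b i) {r : I → ℕ}
    (hr : ∀ i, IsLocallyScalarFree κ (w i) j S (r i)) :
    IsLocallyFreeOfRank κ Λ S j (Fintype.card (Σ i, Fin (r i))) := by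
  intro x hx
  choose U hxU hUS g hg using fun i => hr i x hx
  set W : Opens E := ⟨S ∩ ⋂ i, U i, hSo.inter (isOpen_iInter_of_finite fun i => (U i).isOpen)⟩
    with hW
  have hWU : ∀ i, W ≤ U i := fun i y hy => Set.mem_iInter.1 hy.2 i
  have hB : ∀ V ≤ W, ∃ B : Basis (Σ i, Fin (r i)) (holo V) (sections κ Λ V j),
      ∀ i k p, (B ⟨i, k⟩ : regularSet κ V → 𝔤) p = g i k p • b i := fun V hV =>
    exists_basis_sections b hκ (fun y hy => hS y (hV hy).1) hΛ
      fun i => hg i V (hV.trans (hWU i))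
  set ε := Fintype.equivFin (Σ i, Fin (r i))
  obtain ⟨B, hBeq⟩ := hB W le_rfl
  refine ⟨W, ⟨hx, Set.mem_iInter.2 hxU⟩, fun y hy => hy.1, fun k => B (ε.symm k), fun V hV => ?_⟩
  obtain ⟨B', hBeq'⟩ := hB V hV
  refine ⟨B'.reindex ε, fun k p => ?_⟩
  rw [Basis.reindex_apply]
  beta_reduce
  generalize ε.symm k = q
  obtain ⟨i, l⟩ := q
  rw [hBeq, hBeq']

end Sections

end

noncomputable section

/-! ### The fibres -/

section Meromorphic

variable {n : ℕ} {c : Conf n} {w : ℂ} {j : ℕ} {f : ℂ → ℂ}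

/-- The product with the power has a removable singularity, and dividing its analytic extension by
the power gives `f` back. -/
theorem meromorphicAt_of_tendsto {a t : ℂ} (hd : ∀ᶠ u in 𝓝[≠] t, DifferentiableAt ℂ f u)
    (h : Tendsto (fun u => (u - t) ^ j * f u) (𝓝[≠] t) (𝓝 a)) : MeromorphicAt f t := by
  classical
  have h1 : AnalyticAt ℂ (Function.update (fun u => (u - t) ^ j * f u) t a) t := by
    refine Complex.analyticAt_of_differentiable_on_punctured_nhds_of_continuousAt ?_
      (continuousAt_update_same.2 h)
    filter_upwards [hd, self_mem_nhdsWithin] with u hu hne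
    have h2 : DifferentiableAt ℂ (fun u => (u - t) ^ j * f u) u :=
      DifferentiableAt.fun_mul (by fun_prop) hu
    refine h2.congr_of_eventuallyEq ?_
    filter_upwards [isOpen_ne.mem_nhds hne] with v hv
    exact Function.update_of_ne hv _ _
  have h3 : MeromorphicAt (fun u => ((u - t) ^ j)⁻¹ *
      Function.update (fun u => (u - t) ^ j * f u) t a u) t :=
    MeromorphicAt.mul (MeromorphicAt.inv (by fun_prop)) h1.meromorphicAt
  refine h3.congr ?_
  filter_upwards [self_mem_nhdsWithin] with u hu
  rw [Function.update_of_ne hu, inv_mul_cancel_left₀ (pow_ne_zero _ (sub_ne_zero.2 hu))]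

theorem QuasiPeriodic.meromorphicAt (hτ : 0 < c.2.im) (hf : QuasiPeriodic c w j f) (t : ℂ) :
    MeromorphicAt f t := by
  have hd : ∀ᶠ u in 𝓝[≠] t, DifferentiableAt ℂ f u :=
    (eventually_mem_fibreRegular hτ t).mono fun u hu => hf.differentiableAt u hu
  by_cases ht : t ∈ fibreRegular c
  · refine meromorphicAt_of_tendsto (j := 0) (a := f t) hd ?_
    simpa using (hf.differentiableAt t ht).continuousAt.tendsto.mono_left nhdsWithin_le_nhds
  · simp only [fibreRegular, Set.mem_ofPred_eq, not_forall, not_not] at ht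
    obtain ⟨i, r, s, hrs⟩ := ht
    obtain ⟨a, ha⟩ := hf.tendsto_translate hτ i r s
    have e : t = c.1 i + r + s * c.2 := by linear_combination hrs
    rw [← e] at ha
    refine meromorphicAt_of_tendsto (j := j) (a := a) hd (ha.congr fun u => ?_)
    rw [e]
    ring

theorem exists_tendsto_of_meromorphicAt {t : ℂ} (h : MeromorphicAt f t) :
    ∃ k : ℕ, ∃ a, Tendsto (fun u => (u - t) ^ k * f u) (𝓝[≠] t) (𝓝 a) := by
  obtain ⟨k, hk⟩ := h
  exact ⟨k, _, hk.continuousAt.tendsto.mono_left nhdsWithin_le_nhds⟩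

/-- There are only finitely many marked points, so the maximum of the local orders bounds all poles.
-/
theorem exists_quasiPeriodic (hd : ∀ t ∈ fibreRegular c, DifferentiableAt ℂ f t)
    (h1 : ∀ t ∈ fibreRegular c, f (t + 1) = f t)
    (h2 : ∀ t ∈ fibreRegular c, f (t + c.2) = expTwoPi w * f t) (hm : ∀ t, MeromorphicAt f t) :
    ∃ j, QuasiPeriodic c w j f := by
  choose k a hk using fun i => exists_tendsto_of_meromorphicAt (hm (c.1 i))
  refine ⟨Finset.univ.sup k, hd, h1, h2, fun i => ?_⟩
  obtain ⟨d, hd⟩ := Nat.exists_eq_add_of_le (Finset.le_sup (f := k) (Finset.mem_univ i))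
  have h3 : Tendsto (fun t => (t - c.1 i) ^ d) (𝓝[≠] c.1 i) (𝓝 ((c.1 i - c.1 i) ^ d)) :=
    (Continuous.tendsto (by fun_prop) _).mono_left nhdsWithin_le_nhds
  refine ⟨_, (h3.mul (hk i)).congr fun t => ?_⟩
  rw [hd, pow_add]
  ring

end Meromorphic

section Fibre

variable {𝔤 : Type*} [LieRing 𝔤] [LieAlgebra ℂ 𝔤] [FiniteDimensional ℂ 𝔤]
  {I : Type*} [Fintype I] (b : Basis I ℂ 𝔤) {n : ℕ} {c : Conf n} {μ : I → ℂ} {h : 𝔤}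

theorem extend_apply_of_mem_fibreRegular (X : fibreRegular c → 𝔤) {t : ℂ}
    (ht : t ∈ fibreRegular c) : Function.extend Subtype.val X 0 t = X ⟨t, ht⟩ :=
  Subtype.val_injective.extend_apply X 0 ⟨t, ht⟩

theorem mem_fibre_iff (hτ : 0 < c.2.im) (hb : ∀ i, twist h (b i) = expTwoPi (μ i) • b i)
    {X : fibreRegular c → 𝔤} : X ∈ fibre c h ↔ ∀ i, ∃ j, QuasiPeriodic c (μ i) j
      (fun t => b.repr (Function.extend Subtype.val X 0 t) i) := by
  have hopen := isOpen_fibreRegular hτ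
  constructor
  · rintro ⟨h1, h2⟩ i
    refine exists_quasiPeriodic
      (fun t ht => ((h1 (b.coord i)).1 t ht).differentiableAt (hopen.mem_nhds ht))
      (fun t ht => ?_) (fun t ht => ?_) (h1 (b.coord i)).2
    · rw [(h2 t ht).1]
    · rw [(h2 t ht).2, repr_apply_of_apply_eq_smul b hb]
  · intro hX
    choose j hj using hX
    refine ⟨fun φ => ?_, fun t ht => ⟨b.repr.injective ?_, b.repr.injective ?_⟩⟩
    · have e : (fun t => φ (Function.extend Subtype.val X 0 t)) =
          fun t => ∑ i, b.repr (Function.extend Subtype.val X 0 t) i * φ (b i) := by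
        funext t
        conv_lhs => rw [← b.sum_repr (Function.extend Subtype.val X 0 t)]
        simp only [map_sum, map_smul, smul_eq_mul]
      rw [e]
      refine ⟨fun t ht => DifferentiableWithinAt.fun_sum fun i _ =>
        (((hj i).differentiableAt t ht).mul_const _).differentiableWithinAt, fun t => ?_⟩
      exact MeromorphicAt.fun_sum fun i _ =>
        ((hj i).meromorphicAt hτ t).fun_mul (MeromorphicAt.const _ t)
    · ext i
      exact (hj i).add_one t ht
    · ext i
      rw [repr_apply_of_apply_eq_smul b hb]
      exact (hj i).add_self t ht

variable [NeZero n]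

theorem exists_basis_fibre (hc : c ∈ ellipticConf n) (hμ : ∀ i, |(μ i).im| < c.2.im)
    (hb : ∀ i, twist h (b i) = expTwoPi (μ i) • b i) :
    ∃ B : Basis (I × ℕ × Fin n) ℂ (fibre c h), ∀ i m l t,
      (B (i, m, l) : fibreRegular c → 𝔤) t = basisFun c (μ i) m l t • b i := by
  classical
  have hmem : ∀ q : I × ℕ × Fin n, (fun t : fibreRegular c =>
      basisFun c (μ q.1) q.2.1 q.2.2 t • b q.1) ∈ fibre c h := by
    intro q
    rw [mem_fibre_iff b hc.1 hb]
    intro i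
    by_cases hi : i = q.1
    · subst hi
      refine ⟨_, (quasiPeriodic_basisFun hc (hμ q.1) q.2.1 q.2.2).congr hc.1 fun t ht => ?_⟩
      simp only [extend_apply_of_mem_fibreRegular _ ht, map_smul, Finsupp.smul_apply, b.repr_self,
        Finsupp.single_eq_same, smul_eq_mul, mul_one]
    · refine ⟨0, QuasiPeriodic.zero.congr hc.1 fun t ht => ?_⟩
      simp only [extend_apply_of_mem_fibreRegular _ ht, map_smul, Finsupp.smul_apply, b.repr_self,
        Finsupp.single_eq_of_ne hi, smul_eq_mul, mul_zero]
  set e : I × ℕ × Fin n → fibre c h := fun q => ⟨_, hmem q⟩ with he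
  have hsum : ∀ (J : ℕ) (a : I × ℕ × Fin n → ℂ) (t : fibreRegular c),
      ((∑ q ∈ Finset.univ ×ˢ Finset.range J ×ˢ Finset.univ, a q • e q : fibre c h) :
        fibreRegular c → 𝔤) t =
      ∑ i, (∑ m ∈ Finset.range J, ∑ l, a (i, m, l) * basisFun c (μ i) m l t) • b i := by
    intro J a t
    rw [Submodule.coe_sum, Finset.sum_apply, Finset.sum_product]
    refine Finset.sum_congr rfl fun i _ => ?_
    rw [Finset.sum_smul, Finset.sum_product]
    refine Finset.sum_congr rfl fun m _ => ?_
    rw [Finset.sum_smul]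
    refine Finset.sum_congr rfl fun l _ => ?_
    rw [Submodule.coe_smul, Pi.smul_apply, mul_smul]
  have hli : LinearIndependent ℂ e := by
    rw [linearIndependent_iff']
    intro s a ha q hq
    -- All orders `m` occurring in the finite set `s` are below `J`; coefficients outside `s` are
    -- padded by zero, which gives a sum over a full box.
    set J := s.sup (fun q => q.2.1) + 1 with hJ
    have hsJ : s ⊆ Finset.univ ×ˢ Finset.range J ×ˢ Finset.univ := fun q hq => by
      simp only [Finset.mem_product, Finset.mem_univ, Finset.mem_range, true_and, and_true]
      exact Nat.lt_succ_of_le (Finset.le_sup (f := fun q : I × ℕ × Fin n => q.2.1) hq)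
    have h1 : ∑ q ∈ Finset.univ ×ˢ Finset.range J ×ˢ Finset.univ,
        (if q ∈ s then a q else 0) • e q = 0 := by
      rw [← ha, ← Finset.sum_subset hsJ fun q _ hq => by rw [if_neg hq, zero_smul]]
      exact Finset.sum_congr rfl fun q hq => by rw [if_pos hq]
    have h2 := eq_zero_of_sum_basisFun hc (hμ q.1) J
      (a := fun m l => if (q.1, m, l) ∈ s then a (q.1, m, l) else 0) fun t ht => by
        have h3 := hsum J (fun q => if q ∈ s then a q else 0) ⟨t, ht⟩
        rw [h1] at h3
        exact Fintype.linearIndependent_iff.1 b.linearIndependent _ h3.symm q.1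
    have h3 := h2 q.2.1 (Nat.lt_succ_of_le
      (Finset.le_sup (f := fun q : I × ℕ × Fin n => q.2.1) hq)) q.2.2
    simpa [hq] using h3
  have hspan : ⊤ ≤ Submodule.span ℂ (Set.range e) := by
    rintro X -
    choose j hj using (mem_fibre_iff b hc.1 hb).1 X.2
    set J := Finset.univ.sup j with hJ
    choose a ha using fun i => exists_eq_sum_basisFun hc (hμ i) J ((hj i).mono
      ((Finset.le_sup (f := j) (Finset.mem_univ i)).trans (Nat.le_succ _)))
    have h1 : X = ∑ q ∈ Finset.univ ×ˢ Finset.range (J + 1) ×ˢ Finset.univ,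
        a q.1 q.2.1 q.2.2 • e q := by
      refine Subtype.ext (funext fun t => ?_)
      rw [hsum (J + 1) (fun q => a q.1 q.2.1 q.2.2), ← b.sum_repr ((X : fibreRegular c → 𝔤) t)]
      refine Finset.sum_congr rfl fun i _ => ?_
      have h := ha i t t.2
      rw [extend_apply_of_mem_fibreRegular _ t.2] at h
      rw [h]
    rw [h1]
    exact Submodule.sum_mem _ fun q _ =>
      Submodule.smul_mem _ _ (Submodule.subset_span ⟨q, rfl⟩)
  refine ⟨Basis.mk hli hspan, fun i m l t => ?_⟩
  rw [Basis.mk_apply]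

/-- The coefficients of the fibre element at `x`, in functions shifted into the strip near `x`, are
kept constant in a neighbourhood. The bound `J` is at least one, as the explicit bases require. -/
theorem fibresExtend {E : Type*} [NormedAddCommGroup E] [NormedSpace ℂ E] [FiniteDimensional ℂ E]
    {κ : E → Conf n} {w : I → E → ℂ} {Λ : E → 𝔤} {S : Set E} (hκ : Differentiable ℂ κ)
    (hw : ∀ i, Differentiable ℂ (w i)) (hSo : IsOpen S) (hS : ∀ x ∈ S, κ x ∈ ellipticConf n)
    (hΛ : ∀ x i, twist (Λ x) (b i) = expTwoPi (w i x) • b i) : FibresExtend κ Λ S := by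
  intro x hx X
  choose j hj using (mem_fibre_iff b (hS x hx).1 (hΛ x)).1 X.2
  set J := Finset.univ.sup j + 1 with hJ
  choose s U hxU hUS hU using fun i => exists_shift hκ.continuous (hw i).continuous hSo hS hx
  choose a ha using fun i => exists_eq_sum_shiftedBasisFun (hS x hx) (hU i x (hxU i))
    (Nat.le_add_left 1 (Finset.univ.sup j))
    ((hj i).mono ((Finset.le_sup (f := j) (Finset.mem_univ i)).trans (Nat.le_succ _)))
  set W : Opens E := ⟨S ∩ ⋂ i, U i, hSo.inter (isOpen_iInter_of_finite fun i => (U i).isOpen)⟩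
    with hW
  have hWU : ∀ i, W ≤ U i := fun i y hy => Set.mem_iInter.1 hy.2 i
  have hWS : ∀ y ∈ W, κ y ∈ ellipticConf n := fun y hy => hS y hy.1
  have hsec := fun i => ScalarSection.mul_sum (a := fun k _ => a i k)
    (fun k => differentiableOn_const (a i k)) (isScalarBasis_shiftedBasisFun hκ (hw i) hWS (s i)
      (fun y hy => hU i y (hWU i hy)) (Nat.le_add_left 1 (Finset.univ.sup j))).scalarSection
  refine ⟨J, W, ⟨hx, Set.mem_iInter.2 hxU⟩, fun y hy => hy.1,
    ⟨_, sum_smul_mem_sections b hκ hWS hΛ hsec⟩, fun t => ?_⟩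
  rw [← b.sum_repr ((X : fibreRegular (κ x) → 𝔤) t)]
  refine Finset.sum_congr rfl fun i _ => ?_
  have h := ha i t t.2
  rw [extend_apply_of_mem_fibreRegular _ t.2] at h
  rw [h]

end Fibre

/-! ### The twist on weight vectors -/

/-- The exponential series may be applied to `v` term by term, since evaluation at `v` is
continuous. -/
theorem exp_mulVec_of_mulVec_eq_smul {m : Type*} [Fintype m] [DecidableEq m] {M : Matrix m m ℂ}
    {v : m → ℂ} {μ : ℂ} (h : M.mulVec v = μ • v) :
    (NormedSpace.exp M).mulVec v = Complex.exp μ • v := by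
  let _ := Matrix.linftyOpNormedRing (n := m) (α := ℂ)
  let _ := Matrix.linftyOpNormedAlgebra (R := ℂ) (n := m) (α := ℂ)
  have hpow : ∀ k : ℕ, (M ^ k).mulVec v = μ ^ k • v := by
    intro k
    induction k with
    | zero => simp
    | succ k ih => rw [pow_succ, ← Matrix.mulVec_mulVec, h, Matrix.mulVec_smul, ih, smul_smul,
        pow_succ']
  have h1 := NormedSpace.exp_series_hasSum_exp' (𝕂 := ℂ) M
  have h2 := (h1.map ((Matrix.mulVecBilin ℂ ℂ).flip v).toAddMonoidHom
    (LinearMap.continuous_of_finiteDimensional ((Matrix.mulVecBilin ℂ ℂ).flip v)))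
  have h3 := (NormedSpace.exp_series_hasSum_exp' (𝕂 := ℂ) μ).smul_const v
  rw [← Complex.exp_eq_exp_ℂ] at h3
  refine h2.unique ?_
  convert h3 using 1
  funext k
  change ((k.factorial : ℂ)⁻¹ • M ^ k).mulVec v = _
  rw [Matrix.smul_mulVec, hpow, smul_smul, smul_eq_mul]

theorem expEnd_apply_of_apply_eq_smul {V : Type*} [AddCommGroup V] [Module ℂ V]
    [FiniteDimensional ℂ V] {A : Module.End ℂ V} {v : V} {μ : ℂ} (h : A v = μ • v) :
    expEnd A v = Complex.exp μ • v := by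
  set B := finBasis ℂ V
  have h1 : (LinearMap.toMatrix B B A).mulVec (B.repr v) = μ • ⇑(B.repr v) := by
    rw [LinearMap.toMatrix_mulVec_repr, h, map_smul, Finsupp.coe_smul]
  refine B.repr.injective (DFunLike.coe_injective ?_)
  rw [map_smul, Finsupp.coe_smul, ← exp_mulVec_of_mulVec_eq_smul h1]
  have h2 := LinearMap.toMatrix_mulVec_repr B B (expEnd A) v
  rw [← h2, expEnd, LinearMap.toMatrix_toLin]

theorem twist_apply_of_lie_eq_smul {𝔤 : Type*} [LieRing 𝔤] [LieAlgebra ℂ 𝔤]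
    [FiniteDimensional ℂ 𝔤] {h v : 𝔤} {μ : ℂ} (hv : ⁅h, v⁆ = μ • v) :
    twist h v = expTwoPi μ • v := by
  refine expEnd_apply_of_apply_eq_smul ?_
  rw [LinearMap.smul_apply, LieAlgebra.ad_apply, hv, smul_smul]

end

noncomputable section

/-! ### The root space decomposition -/

theorem isOpen_ellipticConf (n : ℕ) : IsOpen (ellipticConf n) := by
  rw [isOpen_iff_mem_nhds]
  rintro c ⟨hτ, hc⟩
  have h1 : ∀ᶠ y : Conf n in 𝓝 c, 0 < y.2.im :=
    ContinuousAt.eventually_lt continuousAt_const (by fun_prop) hτ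
  have h2 : ∀ᶠ y : Conf n in 𝓝 c, ∀ i j, i ≠ j → y.1 i - y.1 j ∉ lattice y.2 := by
    refine eventually_all.2 fun i => eventually_all.2 fun j => ?_
    by_cases hij : i = j
    · exact Eventually.of_forall fun y h => absurd hij h
    have hcont : Continuous fun y : Conf n => (y.1 i - y.1 j, y.2) := by fun_prop
    exact ((hcont.tendsto c).eventually (eventually_notMem_lattice_prod hτ (hc i j hij))).mono
      fun y hy _ => hy.2
  filter_upwards [h1, h2] with y hy1 hy2
  exact ⟨hy1, hy2⟩

/-- Reassociation of the index of the explicit bases. -/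
def sigmaAssocEquiv {A K : Type*} {ι : A → Type*} : (Σ α, ι α) × K ≃ Σ α, ι α × K where
  toFun q := ⟨q.1.1, q.1.2, q.2⟩
  invFun q := (⟨q.1, q.2.1⟩, q.2.2)
  left_inv _ := rfl
  right_inv _ := rfl

theorem exists_rank_of_pos_of_zero {P : ℕ → ℕ → Prop} (h : ∀ j, 1 ≤ j → ∃ N, P j N)
    (h0 : ∃ N, P 0 N) : ∃ N : ℕ → ℕ, ∀ j, P j (N j) := by
  refine Classical.skolem.1 fun j => ?_
  rcases j.eq_zero_or_pos with rfl | hj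
  exacts [h0, h j hj]

variable {𝔤 : Type*} [LieRing 𝔤] [LieAlgebra ℂ 𝔤] [FiniteDimensional ℂ 𝔤]
  {H : LieSubalgebra ℂ 𝔤} [H.IsCartanSubalgebra]

open scoped Classical in
theorem isInternal_rootSpace : DirectSum.IsInternal fun α : LieModule.Weight ℂ H 𝔤 =>
    (LieAlgebra.rootSpace H (α : H → ℂ)).toSubmodule := by
  exact DirectSum.isInternal_submodule_of_iSupIndep_of_iSup_eq_top
    (LieSubmodule.iSupIndep_toSubmodule.mpr <| LieModule.iSupIndep_genWeightSpace' ℂ H 𝔤)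
    (LieSubmodule.iSup_toSubmodule_eq_top.mpr <| LieModule.iSup_genWeightSpace_eq_top' ℂ H 𝔤)

section Basis

variable {ι : LieModule.Weight ℂ H 𝔤 → Type*}
  (b : ∀ α : LieModule.Weight ℂ H 𝔤, Basis (ι α) ℂ (LieAlgebra.rootSpace H (α : H → ℂ)))

open scoped Classical in
/-- The basis of the Lie algebra composed of bases of the root spaces. -/
def rootBasis : Basis (Σ α, ι α) ℂ 𝔤 :=
  isInternal_rootSpace.collectedBasis b

theorem rootBasis_apply (q : Σ α, ι α) : rootBasis b q = (b q.1 q.2 : 𝔤) := by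
  classical
  rw [rootBasis, DirectSum.IsInternal.collectedBasis_coe]

theorem finite_index {ι : LieModule.Weight ℂ H 𝔤 → Type*}
    (b : ∀ α : LieModule.Weight ℂ H 𝔤, Basis (ι α) ℂ (LieAlgebra.rootSpace H (α : H → ℂ))) :
    Finite (Σ α, ι α) :=
  Module.Finite.finite_basis (rootBasis b)

/-- Root spaces are a priori generalised weight spaces; non-degeneracy of the Killing form makes the
Cartan subalgebra act on them by scalars. -/
theorem twist_rootBasis [LieAlgebra.IsKilling ℂ 𝔤] (h : H) (q : Σ α, ι α) :
    twist (h : 𝔤) (rootBasis b q) = expTwoPi (q.1 h) • rootBasis b q := by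
  refine twist_apply_of_lie_eq_smul ?_
  rw [rootBasis_apply]
  exact LieAlgebra.IsKilling.lie_eq_smul_of_mem_rootSpace (b q.1 q.2).2 h

theorem twist_zero_rootBasis (q : Σ α, ι α) :
    twist (0 : 𝔤) (rootBasis b q) = expTwoPi 0 • rootBasis b q :=
  twist_apply_of_lie_eq_smul (by rw [zero_lie, zero_smul])

end Basis

theorem differentiable_weight (α : LieModule.Weight ℂ H 𝔤) : Differentiable ℂ fun h : H => α h :=
  (LinearMap.toContinuousLinearMap (LieModule.Weight.toLinear ℂ H 𝔤 α)).differentiable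

/-- If `α h ≠ 0`, moving along `k + ε h` with `(z, τ)` fixed sends `α` through a punctured
neighbourhood of `α k`, where lattice points are absent. -/
theorem weight_eq_zero_or_dense (n : ℕ) (α : LieModule.Weight ℂ H 𝔤) :
    (∀ x : Conf n × H, α x.2 = 0) ∨ ∀ W : Opens (Conf n × H),
      (W : Set (Conf n × H)) ⊆ ellipticConfTimes n H → (W : Set (Conf n × H)).Nonempty →
        ∃ x ∈ W, α x.2 ∉ lattice x.1.2 := by
  by_cases hα : ∃ h : H, α h ≠ 0
  · obtain ⟨h, hh⟩ := hα
    right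
    rintro W hW ⟨⟨c, k⟩, hx⟩
    have hc : Continuous fun ε : ℂ => (c, k + ε • h) := by fun_prop
    have h1 : ∀ᶠ ε : ℂ in 𝓝[≠] 0, (c, k + ε • h) ∈ W :=
      nhdsWithin_le_nhds ((hc.tendsto 0).eventually (W.isOpen.mem_nhds (by simpa using hx)))
    have h2 : ∀ᶠ ε : ℂ in 𝓝[≠] 0, α (k + ε • h) ∉ lattice c.2 := by
      have h3 : Tendsto (fun ε : ℂ => α k + ε * α h) (𝓝[≠] 0) (𝓝[≠] (α k)) := by
        refine tendsto_nhdsWithin_iff.2 ⟨?_, ?_⟩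
        · have h4 : Continuous fun ε : ℂ => α k + ε * α h := by fun_prop
          have h5 := h4.tendsto 0
          rw [zero_mul, add_zero] at h5
          exact h5.mono_left nhdsWithin_le_nhds
        · filter_upwards [self_mem_nhdsWithin] with ε hε
          simpa [hh] using hε
      filter_upwards [h3.eventually (eventually_notMem_lattice (hW hx).1 (α k))] with ε hε
      have e : α (k + ε • h) = α k + ε * α h := by
        have h4 := map_add (LieModule.Weight.toLinear ℂ H 𝔤 α) k (ε • h)
        rw [map_smul] at h4
        exact h4
      rwa [e]
    obtain ⟨ε, h3, h4⟩ := (h1.and h2).exists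
    exact ⟨_, h3, h4⟩
  · push Not at hα
    exact Or.inl fun x => hα x.2

end

end EllipticLie

/-! ### Assembly of the theorem -/

open EllipticLie in
theorem mainTheorem11
    {𝔤 : Type*} [LieRing 𝔤] [LieAlgebra ℂ 𝔤] [FiniteDimensional ℂ 𝔤] [LieAlgebra.IsSimple ℂ 𝔤]
    (H : LieSubalgebra ℂ 𝔤) [H.IsCartanSubalgebra] (n : ℕ) [NeZero n] :
    -- the sheaves over the product with the Cartan subalgebra
    (∃ N : ℕ → ℕ, ∀ j : ℕ,
      IsLocallyFreeOfRank (fun x : Conf n × H => x.1) (fun x => (x.2 : 𝔤))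
        (ellipticConfTimes n H) j (N j)) ∧
    FibresExtend (fun x : Conf n × H => x.1) (fun x => (x.2 : 𝔤)) (ellipticConfTimes n H) ∧
    -- the sheaves over the elliptic configuration space
    (∃ N : ℕ → ℕ, ∀ j : ℕ,
      IsLocallyFreeOfRank (fun c : Conf n => c) (fun _ => (0 : 𝔤)) (ellipticConf n) j (N j)) ∧
    FibresExtend (fun c : Conf n => c) (fun _ => (0 : 𝔤)) (ellipticConf n) ∧
    -- the explicit functions are the limits of the generic formulas
    (∀ c ∈ ellipticConf n, ∀ w : ℂ, |w.im| < c.2.im →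
      ∀ (m : ℕ) (l : Fin n), ∀ t ∈ fibreRegular c,
        Tendsto (fun w' => genericFun c w' m l t) (𝓝[≠] w) (𝓝 (basisFun c w m l t))) ∧
    -- the explicit bases, for any choice of bases of the root spaces and of the Cartan subalgebra
    ∀ {ι : LieModule.Weight ℂ H 𝔤 → Type*}
      (b : ∀ α : LieModule.Weight ℂ H 𝔤, Basis (ι α) ℂ (LieAlgebra.rootSpace H (α : H → ℂ))),
      (∀ c ∈ ellipticConf n, ∀ h : H,
        (∀ α : LieModule.Weight ℂ H 𝔤, |(α h).im| < c.2.im) →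
        ∃ B : Basis (Σ α : LieModule.Weight ℂ H 𝔤, ι α × ℕ × Fin n) ℂ (fibre c (h : 𝔤)),
          ∀ α k m l t, (B ⟨α, k, m, l⟩ : fibreRegular c → 𝔤) t =
            basisFun c (α h) m l t • (b α k : 𝔤)) ∧
      (∀ j : ℕ, 1 ≤ j → ∀ U : Opens (Conf n × H),
        (∀ x ∈ U, x ∈ ellipticConfTimes n H ∧
          ∀ α : LieModule.Weight ℂ H 𝔤, |(α x.2).im| < x.1.2.im) →
        ∃ B : Basis (Σ α : LieModule.Weight ℂ H 𝔤, ι α × Fin j × Fin n) (holo U)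
            (sections (fun x : Conf n × H => x.1) (fun x => (x.2 : 𝔤)) U j),
          ∀ α k m l p, (B ⟨α, k, m, l⟩ : regularSet (fun x : Conf n × H => x.1) U → 𝔤) p =
            basisFun p.1.2.1 (α p.1.2.2) m l p.1.1 • (b α k : 𝔤)) ∧
      (∀ j : ℕ, 1 ≤ j → ∀ U : Opens (Conf n), (∀ c ∈ U, c ∈ ellipticConf n) →
        ∃ B : Basis (Σ α : LieModule.Weight ℂ H 𝔤, ι α × Fin j × Fin n) (holo U)
            (sections (fun c : Conf n => c) (fun _ => (0 : 𝔤)) U j),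
          ∀ α k m l p, (B ⟨α, k, m, l⟩ : regularSet (fun c : Conf n => c) U → 𝔤) p =
            basisFun p.1.2 0 m l p.1.1 • (b α k : 𝔤)) := by
  have : LieAlgebra.IsKilling ℂ 𝔤 := inferInstance
  set b₀ := fun α : LieModule.Weight ℂ H 𝔤 => finBasis ℂ (LieAlgebra.rootSpace H (α : H → ℂ))
  have hS := isOpen_ellipticConf n
  have hS' : IsOpen (ellipticConfTimes n H) := hS.preimage continuous_fst
  have hκ : Differentiable ℂ fun x : Conf n × H => x.1 := differentiable_fst
  have hκ' : Differentiable ℂ fun c : Conf n => c := differentiable_id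
  have hw : ∀ α : LieModule.Weight ℂ H 𝔤, Differentiable ℂ fun x : Conf n × H => α x.2 :=
    fun α => (differentiable_weight α).comp differentiable_snd
  refine ⟨?_, ?_, ?_, ?_, fun c hc w hw m l t ht => tendsto_genericFun hw m l ht, fun {ι} b =>
    ⟨fun c hc h hα => ?_, fun j hj U hU => ?_, fun j hj U hU => ?_⟩⟩
  · refine exists_rank_of_pos_of_zero (fun j hj => ⟨_, isLocallyFreeOfRank (rootBasis b₀) hκ hS'
      (fun x hx => hx) (fun x q => twist_rootBasis b₀ x.2 q)
      fun q => isLocallyScalarFree_of_pos hκ (hw q.1) hS' (fun x hx => hx) hj⟩) ?_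
    -- For `j = 0` the scalar rank depends on the weight: one for the zero weight, none for the
    -- roots.
    choose r hr using fun q : (Σ α : LieModule.Weight ℂ H 𝔤, Fin (finrank ℂ
      (LieAlgebra.rootSpace H (α : H → ℂ)))) => isLocallyScalarFree_zero (w := fun x => q.1 x.2)
        hκ.continuous hS' (fun x hx => hx) (weight_eq_zero_or_dense n q.1)
    exact ⟨_, isLocallyFreeOfRank (rootBasis b₀) hκ hS' (fun x hx => hx)
      (fun x q => twist_rootBasis b₀ x.2 q) hr⟩
  · exact fibresExtend (rootBasis b₀) hκ (fun q => hw q.1) hS' (fun x hx => hx)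
      fun x q => twist_rootBasis b₀ x.2 q
  · refine exists_rank_of_pos_of_zero (fun j hj => ⟨_, isLocallyFreeOfRank (rootBasis b₀) hκ' hS
      (fun x hx => hx) (fun x q => twist_zero_rootBasis b₀ q)
      fun q => isLocallyScalarFree_of_pos hκ' (differentiable_const 0) hS (fun x hx => hx) hj⟩) ?_
    obtain ⟨r, hr⟩ := isLocallyScalarFree_zero (w := fun _ => 0) hκ'.continuous hS
      (fun x hx => hx) (Or.inl fun _ => rfl)
    exact ⟨_, isLocallyFreeOfRank (rootBasis b₀) hκ' hS (fun x hx => hx)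
      (fun x q => twist_zero_rootBasis b₀ q) fun q => hr⟩
  · exact fibresExtend (rootBasis b₀) hκ' (fun q => differentiable_const 0) hS (fun x hx => hx)
      fun x q => twist_zero_rootBasis b₀ q
  · have := finite_index b
    have := Fintype.ofFinite (Σ α, ι α)
    obtain ⟨B, hB⟩ := exists_basis_fibre (rootBasis b) hc (fun q => hα q.1)
      (twist_rootBasis b h)
    refine ⟨B.reindex sigmaAssocEquiv, fun α k m l t => ?_⟩
    rw [Basis.reindex_apply]
    exact (hB ⟨α, k⟩ m l t).trans (by rw [rootBasis_apply])
  · have := finite_index b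
    have := Fintype.ofFinite (Σ α, ι α)
    -- The hypothesis on `U` already places every `α λ` in the strip, so the shift is `0` and the
    -- functions are the unshifted ones.
    obtain ⟨B, hB⟩ := exists_basis_sections (rootBasis b) hκ (fun x hx => (hU x hx).1)
      (fun x q => twist_rootBasis b x.2 q) fun q => isScalarBasis_shiftedBasisFun hκ (hw q.1)
        (fun x hx => (hU x hx).1) 0 (fun x hx => by simpa using (hU x hx).2 q.1) hj
    refine ⟨B.reindex ((Equiv.sigmaEquivProd _ _).trans sigmaAssocEquiv), fun α k m l p => ?_⟩
    rw [Basis.reindex_apply]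
    exact (hB ⟨α, k⟩ (m, l) p).trans (by rw [rootBasis_apply, shiftedBasisFun_zero])
  · have := finite_index b
    have := Fintype.ofFinite (Σ α, ι α)
    obtain ⟨B, hB⟩ := exists_basis_sections (rootBasis b) hκ' hU
      (fun x q => twist_zero_rootBasis b q) fun q => isScalarBasis_shiftedBasisFun hκ'
        (differentiable_const 0) hU 0 (fun x hx => by simpa using (hU x hx).1) hj
    refine ⟨B.reindex ((Equiv.sigmaEquivProd _ _).trans sigmaAssocEquiv), fun α k m l p => ?_⟩
    rw [Basis.reindex_apply]
    exact (hB ⟨α, k⟩ (m, l) p).trans (by rw [rootBasis_apply, shiftedBasisFun_zero])
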